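/- **Proposition 2.5.** Let $\Upsilon$ be a group of type $\mathrm{FP}_\infty$ (the trivial module $\mathbb{Z}$ has a resolution by finitely generated projective $\mathbb{Z}[\Upsilon]$-modules) with profinite completion $\iota\colon\Upsilon\to\widehat\Upsilon$, and suppose that $\Upsilon$ has separable cohomology, i.e. $\iota$ induces isomorphisms $H^n(\widehat\Upsilon,A)\to H^n(\Upsilon,A)$ for all $n\ge 0$ and all finite $\Upsilon$-modules $A$. Let $\widehat{\mathbb{Z}}[[\widehat\Upsilon]]=\varprojlim(\mathbb{Z}/n)[\widehat\Upsilon/U]$ be the completed group ring. For a $\mathbb{Z}[\Upsilon]$-module $M$ let $\widehat M$ be the inverse limit of its finite quotient modules, a profinite $\widehat{\mathbb{Z}}[[\widehat\Upsilon]]$-module, with canonical map $\iota_M\colon M\to\widehat M$. Let $\mathcal{I}_\Upsilon=\ker(\mathbb{Z}[\Upsilon]\to\mathbb{Z})$ and $\mathcal{I}_{\widehat\Upsilon}=\ker(\widehat{\mathbb{Z}}[[\widehat\Upsilon]]\to\widehat{\mathbb{Z}})$ be the augmentation ideals. Write $H^n(\Upsilon,M)=\mathrm{Ext}^n_{\mathbb{Z}[\Upsilon]}(\mathbb{Z},M)$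 and, for a profinite module $B$, $H^n(\widehat\Upsilon,B)=\mathrm{Ext}^n_{\widehat{\mathbb{Z}}[[\widehat\Upsilon]]}(\widehat{\mathbb{Z}},B)$, where $\mathrm{Ext}_{\widehat{\mathbb{Z}}[[\widehat\Upsilon]]}$ is taken in the abelian category of profinite $\widehat{\mathbb{Z}}[[\widehat\Upsilon]]$-modules. Then the canonical map $\mathcal{I}_\Upsilon\to\mathcal{I}_{\widehat\Upsilon}$ induces an isomorphism $\widehat{\mathcal{I}_\Upsilon}\cong\mathcal{I}_{\widehat\Upsilon}$ of profinite modules, and for every finitely generated $\mathbb{Z}[\Upsilon]$-module $M$ and every $n\ge0$ there are homomorphisms of abelian groups $$\iota_1^n\colon H^n(\Upsilon,M)\to H^n(\widehat\Upsilon,\widehat M),\qquad \iota_2^n\colon \mathrm{Ext}^n_{\mathbb{Z}[\Upsilon]}(\mathcal{I}_\Upsilon,M)\to\mathrm{Ext}^n_{\widehat{\mathbb{Z}}[[\widehat\Upsilon]]}(\mathcal{I}_{\widehat\Upsilon},\widehat M),$$ natural in $M$, whose composites with the restriction maps $H^n(\widehat\Upsilon,\widehat M)\to H^n(\Upsilon,\widehat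 M)$ and $\mathrm{Ext}^n_{\widehat{\mathbb{Z}}[[\widehat\Upsilon]]}(\mathcal{I}_{\widehat\Upsilon},\widehat M)\to\mathrm{Ext}^n_{\mathbb{Z}[\Upsilon]}(\mathcal{I}_\Upsilon,\widehat M)$ are the maps induced by $\iota_M$, and such that the following hold. (a) Let $1\to M\to E\to\Upsilon\to1$ be an extension of groups inducing the given $\Upsilon$-module structure on $M$. Profinite completion induces an extension of profinite groups $1\to\widehat M\to\widehat E\to\widehat\Upsilon\to1$ inducing the given $\widehat\Upsilon$-module structure on $\widehat M$, and if $[\zeta]\in H^2(\Upsilon,M)$ corresponds to the first extension, then $\iota_1^2([\zeta])$ corresponds to the second. (b) Let $0\to M\to E\to\mathcal{I}_\Upsilon\to0$ be an extension of $\mathbb{Z}[\Upsilon]$-modules. Profinite completion of modules induces an extension of profinite modules $0\to\widehat M\to\widehat E\to\mathcal{I}_{\widehat\Upsilon}\to0$, and $\iota_2^1$ sends the class of the first extension to the class of the second. (c) For all $n\ge0$ one has $\widehat\delta\circ\iota_2^n=\iota_1^{n+1}\circ\delta$, where $\delta\colon\mathrm{Ext}^n_{\mathbb{Z}[\Upsilon]}(\mathcal{I}_\Upsilon,M)\to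 H^{n+1}(\Upsilon,M)$ and $\widehat\delta\colon\mathrm{Ext}^n_{\widehat{\mathbb{Z}}[[\widehat\Upsilon]]}(\mathcal{I}_{\widehat\Upsilon},\widehat M)\to H^{n+1}(\widehat\Upsilon,\widehat M)$ are the boundary maps of the long exact sequences associated with the augmentation sequences $0\to\mathcal{I}_\Upsilon\to\mathbb{Z}[\Upsilon]\to\mathbb{Z}\to0$ and $0\to\mathcal{I}_{\widehat\Upsilon}\to\widehat{\mathbb{Z}}[[\widehat\Upsilon]]\to\widehat{\mathbb{Z}}\to0$; for $n\ge1$ both $\delta$ and $\widehat\delta$ are isomorphisms. -/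

import Mathlib

open CategoryTheory Limits Topology

universe u

namespace ProfCoh

/-- Profinite modules over a topological ring `R`: compact Hausdorff topological `R`-modules in which
the open submodules form a neighbourhood basis of zero, i.e. inverse limits of finite discrete
topological `R`-modules. -/
structure ProfMod (R : Type u) [Ring R] [TopologicalSpace R] : Type (u + 1) where
  of ::
  carrier : Type u
  [addCommGroup : AddCommGroup carrier]
  [module : Module R carrier]
  [topologicalSpace : TopologicalSpace carrier]
  [isTopologicalAddGroup : IsTopologicalAddGroup carrier]
  [continuousSMul : ContinuousSMul R carrier]
  [isLinearTopology : IsLinearTopology R carrier]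
  [compactSpace : CompactSpace carrier]
  [t2Space : T2Space carrier]

namespace ProfMod

variable {R : Type u} [Ring R] [TopologicalSpace R]

instance : CoeSort (ProfMod R) (Type u) := ⟨ProfMod.carrier⟩

attribute [instance] addCommGroup module topologicalSpace isTopologicalAddGroup continuousSMul
  isLinearTopology compactSpace t2Space

/-- Morphisms of profinite modules are the continuous linear maps. -/
@[ext]
structure Hom (A B : ProfMod R) : Type u where
  hom : A →L[R] B

instance : Category (ProfMod R) where
  Hom A B := Hom A B
  id A := ⟨ContinuousLinearMap.id R A⟩
  comp f g := ⟨g.hom.comp f.hom⟩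

instance : ConcreteCategory (ProfMod R) (fun A B => A →L[R] B) where
  hom f := f.hom
  ofHom f := ⟨f⟩

/-- A continuous linear map as a morphism. -/
abbrev ofHom {A B : ProfMod R} (f : A →L[R] B) : A ⟶ B := ⟨f⟩

lemma comp_apply' {A B C : ProfMod R} (f : A ⟶ B) (g : B ⟶ C) (x : A) :
    (f ≫ g).hom x = g.hom (f.hom x) := rfl

lemma hom_ext' {A B : ProfMod R} {f g : A ⟶ B} (h : ∀ x, f.hom x = g.hom x) : f = g :=
  Hom.ext (ContinuousLinearMap.ext h)

/-- Morphisms are the same as continuous linear maps. -/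
def homEquiv (A B : ProfMod R) : (A ⟶ B) ≃ (A →L[R] B) where
  toFun f := f.hom
  invFun f := ⟨f⟩

instance (A B : ProfMod R) : AddCommGroup (A ⟶ B) := (homEquiv A B).addCommGroup

lemma add_hom {A B : ProfMod R} (f g : A ⟶ B) : (f + g).hom = f.hom + g.hom := rfl
lemma zero_hom {A B : ProfMod R} : (0 : A ⟶ B).hom = 0 := rfl

instance : Preadditive (ProfMod R) where
  add_comp _ _ _ f g h := hom_ext' fun x => by
    change h.hom (f.hom x + g.hom x) = h.hom (f.hom x) + h.hom (g.hom x)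
    exact map_add _ _ _
  comp_add _ _ _ _ _ _ := rfl

section constructions

set_option linter.unusedSectionVars false

lemma isLinearTopology_of {B : Type u} [AddCommGroup B] [Module R B] [TopologicalSpace B]
    (h : ∀ s ∈ 𝓝 (0 : B), ∃ N : Submodule R B, (N : Set B) ∈ 𝓝 0 ∧ (N : Set B) ⊆ s) :
    IsLinearTopology R B where
  hasBasis_submodule' := ⟨fun s => ⟨fun hs => h s hs, fun ⟨_, hN, hNs⟩ => Filter.mem_of_superset hN hNs⟩⟩

lemma isLinearTopology_of_inducing {B : Type u} [AddCommGroup B] [Module R B] [TopologicalSpace B]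
    {J : Type*} {A : J → Type*} [∀ j, TopologicalSpace (A j)] [∀ j, DiscreteTopology (A j)]
    (π : B → ∀ j, A j) (hπ : IsInducing π) (K : J → Submodule R B)
    (hK : ∀ j b, b ∈ K j ↔ π b j = π 0 j) : IsLinearTopology R B := by
  refine isLinearTopology_of fun s hs => ?_
  rw [hπ.nhds_eq_comap, Filter.mem_comap] at hs
  obtain ⟨t, ht, hts⟩ := hs
  rw [nhds_pi, Filter.mem_pi'] at ht
  obtain ⟨I, v, hv, hvt⟩ := ht
  refine ⟨⨅ j ∈ I, K j, ?_, ?_⟩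
  · have : ((⨅ j ∈ I, K j : Submodule R B) : Set B) = ⋂ j ∈ I, (fun b => π b j) ⁻¹' {π 0 j} := by
      ext b; simp [hK]
    rw [this, Filter.biInter_finset_mem]
    intro j _
    exact (((continuous_apply j).comp hπ.continuous).continuousAt).preimage_mem_nhds
      ((isOpen_discrete _).mem_nhds rfl)
  · intro b hb
    apply hts
    apply hvt
    intro j hj
    simp only [Submodule.coe_iInf, Set.mem_iInter, SetLike.mem_coe, hK] at hb
    rw [hb j hj]
    exact mem_of_mem_nhds (hv j)

lemma isLinearTopology_submodule {B : Type u} [AddCommGroup B] [Module R B] [TopologicalSpace B]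
    [IsLinearTopology R B] (N : Submodule R B) : IsLinearTopology R N := by
  refine isLinearTopology_of fun s hs => ?_
  rw [nhds_subtype, Filter.mem_comap] at hs
  obtain ⟨t, ht, hts⟩ := hs
  obtain ⟨K, hK, hKt⟩ := (IsLinearTopology.hasBasis_submodule R).mem_iff.1 ht
  exact ⟨K.comap N.subtype, continuous_subtype_val.continuousAt.preimage_mem_nhds hK,
    fun x hx => hts (hKt hx)⟩

lemma isLinearTopology_quotient {B : Type u} [AddCommGroup B] [Module R B] [TopologicalSpace B]
    [IsTopologicalAddGroup B] [IsLinearTopology R B] (N : Submodule R B) :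
    IsLinearTopology R (B ⧸ N) := by
  refine isLinearTopology_of fun s hs => ?_
  have hc : Continuous (N.mkQ : B → B ⧸ N) := continuous_quot_mk
  obtain ⟨K, hK, hKs⟩ := (IsLinearTopology.hasBasis_submodule R).mem_iff.1
    (hc.continuousAt.preimage_mem_nhds (x := 0) (by simpa using hs))
  refine ⟨K.map N.mkQ, ?_, ?_⟩
  · have := N.isOpenQuotientMap_mkQ.isOpenMap.image_mem_nhds hK
    simpa using this
  · rintro _ ⟨x, hx, rfl⟩
    exact hKs hx

lemma isLinearTopology_prod {A B : Type u} [AddCommGroup A] [Module R A] [TopologicalSpace A]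
    [AddCommGroup B] [Module R B] [TopologicalSpace B] [IsLinearTopology R A]
    [IsLinearTopology R B] : IsLinearTopology R (A × B) := by
  refine isLinearTopology_of fun s hs => ?_
  rw [Prod.zero_eq_mk, mem_nhds_prod_iff] at hs
  obtain ⟨a, ha, b, hb, hab⟩ := hs
  obtain ⟨K, hK, hKs⟩ := (IsLinearTopology.hasBasis_submodule R).mem_iff.1 ha
  obtain ⟨L, hL, hLs⟩ := (IsLinearTopology.hasBasis_submodule R).mem_iff.1 hb
  exact ⟨K.prod L, prod_mem_nhds hK hL, fun x hx => hab ⟨hKs hx.1, hLs hx.2⟩⟩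

/-- A closed submodule of a profinite module. -/
def sub (A : ProfMod R) (N : Submodule R A) (hN : IsClosed (N : Set A)) : ProfMod R :=
  haveI := isLinearTopology_submodule N
  haveI : CompactSpace N := isCompact_iff_compactSpace.1 hN.isCompact
  of N

/-- The quotient of a profinite module by a closed submodule. -/
def quot (A : ProfMod R) (N : Submodule R A) (hN : IsClosed (N : Set A)) : ProfMod R :=
  haveI := isLinearTopology_quotient N
  haveI : IsClosed (N.toAddSubgroup : Set A) := hN
  haveI : T3Space (A ⧸ N) := Submodule.t3_quotient_of_isClosed N
  haveI : CompactSpace (A ⧸ N) := inferInstanceAs (CompactSpace (Quotient _))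
  of (A ⧸ N)

/-- The product of two profinite modules. -/
def prod (A B : ProfMod R) : ProfMod R :=
  haveI := isLinearTopology_prod (R := R) (A := A) (B := B)
  of (A × B)

/-- Factorisation through an injective morphism. -/
lemma exists_lift {A B W : ProfMod R} (f : A ⟶ B) (hf : Function.Injective f.hom) (k : W ⟶ B)
    (hk : ∀ w, ∃ a, f.hom a = k.hom w) : ∃ l : W ⟶ A, l ≫ f = k := by
  choose l hl using hk
  have hind : IsInducing f.hom := (f.hom.continuous.isClosedEmbedding hf).isInducing
  refine ⟨⟨⟨⟨⟨l, ?_⟩, ?_⟩, ?_⟩⟩, hom_ext' hl⟩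
  · intro x y; apply hf; simp [hl]
  · intro r x; apply hf; simp [hl]
  · refine hind.continuous_iff.2 ?_
    convert k.hom.continuous
    ext x; exact hl x

/-- Factorisation through a surjective morphism. -/
lemma exists_desc {A B W : ProfMod R} (f : A ⟶ B) (hf : Function.Surjective f.hom) (k : A ⟶ W)
    (hk : ∀ a, f.hom a = 0 → k.hom a = 0) : ∃ l : B ⟶ W, f ≫ l = k := by
  have hk' : ∀ a a', f.hom a = f.hom a' → k.hom a = k.hom a' := by
    intro a a' h
    rw [← sub_eq_zero, ← map_sub]
    exact hk _ (by rw [map_sub, h, sub_self])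
  choose s hs using hf
  have hq : IsQuotientMap f.hom := f.hom.continuous.isClosedMap.isQuotientMap f.hom.continuous
    (fun b => ⟨s b, hs b⟩)
  have key : ∀ a, k.hom (s (f.hom a)) = k.hom a := fun a => hk' _ _ (hs _)
  refine ⟨⟨⟨⟨⟨fun b => k.hom (s b), ?_⟩, ?_⟩, ?_⟩⟩, hom_ext' key⟩
  · intro x y; rw [← map_add]; apply hk'; simp [hs]
  · intro r x; simp only [RingHom.id_apply]; rw [← map_smul]; apply hk'; simp [hs]
  · refine hq.continuous_iff.2 ?_
    convert k.hom.continuous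
    ext x; exact key x

end constructions

section abelian

lemma isClosed_ker {A B : ProfMod R} (f : A ⟶ B) :
    IsClosed ((LinearMap.ker f.hom.toLinearMap : Submodule R A) : Set A) :=
  f.hom.isClosed_ker

lemma isClosed_range {A B : ProfMod R} (f : A ⟶ B) :
    IsClosed ((LinearMap.range f.hom.toLinearMap : Submodule R B) : Set B) := by
  have := (isCompact_range f.hom.continuous).isClosed
  exact this

/-- The inclusion of the kernel. -/
def kerι {A B : ProfMod R} (f : A ⟶ B) : A.sub _ (isClosed_ker f) ⟶ A :=
  ⟨(LinearMap.ker f.hom.toLinearMap).subtypeL⟩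

/-- The projection onto the cokernel. -/
def cokerπ {A B : ProfMod R} (f : A ⟶ B) : B ⟶ B.quot _ (isClosed_range f) :=
  ⟨(LinearMap.range f.hom.toLinearMap).mkQL⟩

lemma kerι_injective {A B : ProfMod R} (f : A ⟶ B) : Function.Injective (kerι f).hom :=
  Subtype.val_injective

lemma cokerπ_surjective {A B : ProfMod R} (f : A ⟶ B) : Function.Surjective (cokerπ f).hom :=
  Submodule.mkQ_surjective _

lemma kerι_comp {A B : ProfMod R} (f : A ⟶ B) : kerι f ≫ f = 0 :=
  hom_ext' fun x => x.2

lemma comp_cokerπ {A B : ProfMod R} (f : A ⟶ B) : f ≫ cokerπ f = 0 :=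
  hom_ext' fun x => (Submodule.Quotient.mk_eq_zero _).2 ⟨x, rfl⟩

lemma cokerπ_eq_zero {A B : ProfMod R} (f : A ⟶ B) (b : B) :
    (cokerπ f).hom b = 0 ↔ ∃ a, f.hom a = b :=
  (Submodule.Quotient.mk_eq_zero _)

lemma mono_of_injective {A B : ProfMod R} (f : A ⟶ B) (hf : Function.Injective f.hom) : Mono f where
  right_cancellation _ _ e := hom_ext' fun x => hf (congrArg (fun k => k.hom x) e)

lemma epi_of_surjective {A B : ProfMod R} (f : A ⟶ B) (hf : Function.Surjective f.hom) : Epi f where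
  left_cancellation _ _ e := hom_ext' fun x => by
    obtain ⟨y, rfl⟩ := hf x
    exact congrArg (fun k => k.hom y) e

lemma injective_of_mono {A B : ProfMod R} (f : A ⟶ B) [Mono f] : Function.Injective f.hom := by
  have h0 : kerι f = 0 := by rw [← cancel_mono f, kerι_comp, zero_comp]
  refine (injective_iff_map_eq_zero f.hom).2 fun a ha => ?_
  exact congrArg (fun k => k.hom (⟨a, ha⟩ : LinearMap.ker f.hom.toLinearMap)) h0

lemma surjective_of_epi {A B : ProfMod R} (f : A ⟶ B) [Epi f] : Function.Surjective f.hom := by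
  have h0 : cokerπ f = 0 := by rw [← cancel_epi f, comp_cokerπ, comp_zero]
  intro b
  exact (cokerπ_eq_zero f b).1 (congrArg (fun k => k.hom b) h0)

/-- Any injective morphism vanishing exactly where required is a kernel. -/
noncomputable def isLimitOfExact {A B C : ProfMod R} (f : A ⟶ B) (g : B ⟶ C) (w : f ≫ g = 0)
    (hf : Function.Injective f.hom) (h : ∀ b, g.hom b = 0 → ∃ a, f.hom a = b) :
    IsLimit (KernelFork.ofι f w) :=
  haveI := mono_of_injective f hf
  KernelFork.IsLimit.ofι' f w fun k hk =>
    ⟨_, (exists_lift f hf k fun x => h _ (congrArg (fun k => k.hom x) hk)).choose_spec⟩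

/-- Any surjective morphism vanishing exactly where required is a cokernel. -/
noncomputable def isColimitOfExact {A B C : ProfMod R} (f : A ⟶ B) (g : B ⟶ C) (w : f ≫ g = 0)
    (hg : Function.Surjective g.hom) (h : ∀ b, g.hom b = 0 → ∃ a, f.hom a = b) :
    IsColimit (CokernelCofork.ofπ g w) :=
  haveI := epi_of_surjective g hg
  CokernelCofork.IsColimit.ofπ' g w fun k hk =>
    ⟨_, (exists_desc g hg k fun x hx => by
      obtain ⟨a, rfl⟩ := h x hx
      exact congrArg (fun k => k.hom a) hk).choose_spec⟩

instance : HasKernels (ProfMod R) where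
  has_limit f := ⟨⟨_, isLimitOfExact (kerι f) f (kerι_comp f) (kerι_injective f)
    fun b hb => ⟨(⟨b, hb⟩ : LinearMap.ker f.hom.toLinearMap), rfl⟩⟩⟩

instance : HasCokernels (ProfMod R) where
  has_colimit f := ⟨⟨_, isColimitOfExact f (cokerπ f) (comp_cokerπ f) (cokerπ_surjective f)
    fun b hb => (cokerπ_eq_zero f b).1 hb⟩⟩

instance : HasZeroObject (ProfMod R) :=
  ⟨of PUnit, ⟨fun B => ⟨⟨⟨0⟩, fun f => hom_ext' fun x => by
      rw [Subsingleton.elim x 0, map_zero, map_zero]⟩⟩,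
    fun B => ⟨⟨⟨0⟩, fun f => hom_ext' fun x => rfl⟩⟩⟩⟩

instance : HasBinaryProducts (ProfMod R) :=
  haveI : ∀ A B : ProfMod R, HasLimit (pair A B) := fun A B =>
    ⟨⟨_, BinaryFan.isLimitMk (W := A.prod B) (fst := (⟨ContinuousLinearMap.fst R A B⟩ : Hom (A.prod B) A))
      (snd := (⟨ContinuousLinearMap.snd R A B⟩ : Hom (A.prod B) B))
      (fun s => ⟨ContinuousLinearMap.prod s.fst.hom s.snd.hom⟩) (fun _ => rfl) (fun _ => rfl)
      (fun _ _ h₁ h₂ => hom_ext' fun x => Prod.ext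
        (congrArg (fun k => k.hom x) h₁) (congrArg (fun k => k.hom x) h₂))⟩⟩
  hasBinaryProducts_of_hasLimit_pair _

instance : Abelian (ProfMod R) where
  has_finite_products := hasFiniteProducts_of_has_binary_and_terminal
  normalMonoOfMono f _ := ⟨⟨_, cokerπ f, comp_cokerπ f,
    isLimitOfExact f _ _ (injective_of_mono f) fun b hb => (cokerπ_eq_zero f b).1 hb⟩⟩
  normalEpiOfEpi f _ := ⟨⟨_, kerι f, kerι_comp f,
    isColimitOfExact _ f _ (surjective_of_epi f)
      fun b hb => ⟨(⟨b, hb⟩ : LinearMap.ker f.hom.toLinearMap), rfl⟩⟩⟩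

noncomputable instance : HasExt.{u + 1} (ProfMod R) := HasExt.standard _

end abelian

section exact

/-- A short complex of profinite modules which is exact on elements is short exact. -/
lemma shortExact_of (S : ShortComplex (ProfMod R)) (hf : Function.Injective S.f.hom)
    (h : ∀ b, S.g.hom b = 0 → ∃ a, S.f.hom a = b) (hg : Function.Surjective S.g.hom) :
    S.ShortExact where
  mono_f := mono_of_injective _ hf
  epi_g := epi_of_surjective _ hg
  exact := S.exact_of_f_is_kernel (isLimitOfExact S.f S.g S.zero hf h)

lemma ker_le_of_exact {S : ShortComplex (ProfMod R)} (hS : S.ShortExact) (b : S.X₂)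
    (hb : S.g.hom b = 0) : ∃ a, S.f.hom a = b := by
  have := hS.mono_f
  have hb' : b ∈ LinearMap.ker S.g.hom.toLinearMap := hb
  have := congrArg (fun k => k.hom (⟨b, hb'⟩ : LinearMap.ker S.g.hom.toLinearMap))
    (hS.exact.lift_f (kerι S.g) (kerι_comp S.g))
  exact ⟨_, this⟩

/-- Forget the topology and restrict scalars along a ring homomorphism. -/
noncomputable def restrict {S : Type u} [Ring S] (φ : S →+* R) : ProfMod R ⥤ ModuleCat.{u} S where
  obj A := (ModuleCat.restrictScalars φ).obj (ModuleCat.of R A)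
  map f := (ModuleCat.restrictScalars φ).map (ModuleCat.ofHom f.hom.toLinearMap)
  map_id _ := rfl
  map_comp _ _ := rfl

variable {S : Type u} [Ring S] (φ : S →+* R)

instance : (restrict φ).Additive where
  map_add := rfl

lemma restrict_shortExact (T : ShortComplex (ProfMod R)) (hT : T.ShortExact) :
    (T.map (restrict φ)).ShortExact where
  mono_f := by
    have := hT.mono_f
    exact (ModuleCat.mono_iff_injective _).2 (injective_of_mono T.f)
  epi_g := by
    have := hT.epi_g
    exact (ModuleCat.epi_iff_surjective _).2 (surjective_of_epi T.g)
  exact := (ShortComplex.moduleCat_exact_iff _).2 fun b hb => ker_le_of_exact hT b hb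

lemma restrict_exact : PreservesFiniteLimits (restrict φ) ∧ PreservesFiniteColimits (restrict φ) :=
  ((restrict φ).exact_tfae.out 0 3).1 (restrict_shortExact φ)

instance : PreservesFiniteLimits (restrict φ) := (restrict_exact φ).1
instance : PreservesFiniteColimits (restrict φ) := (restrict_exact φ).2

end exact
end ProfMod

section CompletedGroupRing

variable (G : Type u) [Group G] [TopologicalSpace G]

namespace CompletedGroupRing

/-- Indices of the finite levels of the completed group ring: a modulus `n ≥ 1` and an open normal
subgroup `U`. -/
abbrev Index := ℕ+ × OpenNormalSubgroup G

variable {G}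

/-- The level `(ℤ/n)[G/U]`. -/
def Level (i : Index G) : Type u := MonoidAlgebra (ZMod i.1) (G ⧸ i.2.toSubgroup)

noncomputable instance (i : Index G) : Ring (Level i) :=
  inferInstanceAs (Ring (MonoidAlgebra (ZMod i.1) (G ⧸ i.2.toSubgroup)))

instance (i : Index G) : TopologicalSpace (Level i) := ⊥
instance (i : Index G) : DiscreteTopology (Level i) := ⟨rfl⟩

instance [IsTopologicalGroup G] [CompactSpace G] (i : Index G) : Finite (Level i) :=
  haveI : Finite (G ⧸ i.2.toSubgroup) := inferInstanceAs (Finite (G ⧸ i.2.toOpenSubgroup.toSubgroup))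
  Finite.of_injective (fun (x : MonoidAlgebra (ZMod i.1) (G ⧸ i.2.toSubgroup)) q => x.coeff q)
    fun _ _ h => MonoidAlgebra.coeff_injective (DFunLike.coe_injective h)

/-- The order on indices for which the levels form an inverse system. -/
def Refines (i j : Index G) : Prop := (j.1 : ℕ) ∣ i.1 ∧ i.2.toSubgroup ≤ j.2.toSubgroup

/-- The transition maps `(ℤ/n)[G/U] → (ℤ/m)[G/V]` for `m ∣ n` and `U ≤ V`. -/
noncomputable def transition {i j : Index G} (h : Refines i j) : Level i →+* Level j :=
  (MonoidAlgebra.mapRingHom (G ⧸ j.2.toSubgroup) (ZMod.castHom h.1 (ZMod j.1))).comp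
    (MonoidAlgebra.mapDomainRingHom (ZMod i.1)
      (QuotientGroup.map i.2.toSubgroup j.2.toSubgroup (MonoidHom.id G) h.2))

/-- The augmentation of a level. -/
noncomputable def levelAug (i : Index G) : Level i →+* ZMod i.1 :=
  (MonoidAlgebra.lift (ZMod i.1) (ZMod i.1) (G ⧸ i.2.toSubgroup) 1).toRingHom

/-- The group element `g` in a level. -/
noncomputable def levelOf (i : Index G) : G →* Level i :=
  (MonoidAlgebra.of (ZMod i.1) (G ⧸ i.2.toSubgroup)).comp (QuotientGroup.mk' i.2.toSubgroup)

lemma level_hom_ext {i : Index G} {A : Type*} [Ring A] {f g : Level i →+* A}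
    (h : ∀ x, f (levelOf i x) = g (levelOf i x)) : f = g := by
  refine MonoidAlgebra.ringHom_ext (fun r => ?_) (fun q => ?_)
  · obtain ⟨n, rfl⟩ := ZMod.intCast_surjective r
    have : (MonoidAlgebra.single (1 : G ⧸ i.2.toSubgroup) (n : ZMod i.1)) =
        ((n : MonoidAlgebra (ZMod i.1) (G ⧸ i.2.toSubgroup))) := by
      simp [MonoidAlgebra.intCast_def]
    rw [this]
    exact (map_intCast f n).trans (map_intCast g n).symm
  · obtain ⟨x, rfl⟩ := QuotientGroup.mk_surjective q
    exact h x

lemma transition_levelOf {i j : Index G} (h : Refines i j) (x : G) :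
    transition h (levelOf i x) = levelOf j x := by
  change MonoidAlgebra.map _ (MonoidAlgebra.mapDomain _ (MonoidAlgebra.single _ 1)) =
    MonoidAlgebra.single _ 1
  rw [MonoidAlgebra.mapDomain_single, MonoidAlgebra.map_single]
  exact congrArg (MonoidAlgebra.single _) (map_one (ZMod.castHom h.1 (ZMod j.1)))

lemma levelAug_levelOf (i : Index G) (x : G) : levelAug i (levelOf i x) = 1 :=
  (MonoidAlgebra.lift_single _ _ _).trans (by simp)

variable (G)

/-- The compatible families in the product of all levels. -/
noncomputable def compatible : Subring (∀ i : Index G, Level i) where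
  carrier := {x | ∀ (i j : Index G) (h : Refines i j), transition h (x i) = x j}
  mul_mem' hx hy i j h := by simp [hx i j h, hy i j h]
  one_mem' i j h := by simp
  add_mem' hx hy i j h := by simp [hx i j h, hy i j h]
  zero_mem' i j h := by simp
  neg_mem' hx i j h := by simp [hx i j h]

end CompletedGroupRing

open CompletedGroupRing

/-- The completed group ring `ℤ̂[[G]] = lim (ℤ/n)[G/U]` of a profinite group `G`, with its
inverse limit topology. -/
def CompletedGroupRing : Type u := compatible G

namespace CompletedGroupRing

variable {G}

noncomputable instance : Ring (CompletedGroupRing G) := inferInstanceAs (Ring (compatible G))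
instance : TopologicalSpace (CompletedGroupRing G) :=
  inferInstanceAs (TopologicalSpace (compatible G))
instance : IsTopologicalRing (CompletedGroupRing G) :=
  inferInstanceAs (IsTopologicalRing (compatible G))
instance : T2Space (CompletedGroupRing G) := inferInstanceAs (T2Space (compatible G))

/-- The projection to a level. -/
noncomputable def proj (i : Index G) : CompletedGroupRing G →+* Level i :=
  (Pi.evalRingHom _ i).comp (compatible G).subtype

lemma continuous_proj (i : Index G) : Continuous (proj i) :=
  (continuous_apply i).comp continuous_subtype_val

lemma ext_proj {x y : CompletedGroupRing G} (h : ∀ i, proj i x = proj i y) : x = y :=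
  Subtype.ext (funext h)

lemma transition_proj {i j : Index G} (h : Refines i j) (x : CompletedGroupRing G) :
    transition h (proj i x) = proj j x := x.2 i j h

lemma isClosed_compatible : IsClosed (compatible G : Set (∀ i : Index G, Level i)) := by
  have : (compatible G : Set (∀ i : Index G, Level i)) =
      ⋂ (i : Index G) (j : Index G) (h : Refines i j), {x | transition h (x i) = x j} := by
    ext x; simp [compatible]
  rw [this]
  refine isClosed_iInter fun i => isClosed_iInter fun j => isClosed_iInter fun h => ?_
  exact isClosed_eq (continuous_of_discreteTopology.comp (continuous_apply i)) (continuous_apply j)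

instance [IsTopologicalGroup G] [CompactSpace G] : CompactSpace (CompletedGroupRing G) :=
  isCompact_iff_compactSpace.1 isClosed_compatible.isCompact

instance : IsLinearTopology (CompletedGroupRing G) (CompletedGroupRing G) :=
  ProfMod.isLinearTopology_of_inducing (A := Level) (fun x => x.1) IsInducing.subtypeVal
    (fun i => RingHom.ker (proj i)) (fun _ _ => Iff.rfl)

/-- The canonical homomorphism `G → ℤ̂[[G]]ˣ`, as a map to the ring. -/
noncomputable def of : G →* CompletedGroupRing G where
  toFun g := ⟨fun i => levelOf i g, fun _ _ h => transition_levelOf h g⟩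
  map_one' := Subtype.ext (funext fun i => map_one (levelOf i))
  map_mul' x y := Subtype.ext (funext fun i => map_mul (levelOf i) x y)

end CompletedGroupRing

/-- The ring `ℤ̂ = lim ℤ/n`, as compatible families. -/
def zhatCompatible : Subring (∀ n : ℕ+, ZMod n) where
  carrier := {x | ∀ (n m : ℕ+) (h : (m : ℕ) ∣ n), ZMod.castHom h (ZMod m) (x n) = x m}
  mul_mem' hx hy i j h := by simp only [Pi.mul_apply, map_mul, hx i j h, hy i j h]
  one_mem' i j h := by simp only [Pi.one_apply, map_one]
  add_mem' hx hy i j h := by simp only [Pi.add_apply, map_add, hx i j h, hy i j h]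
  zero_mem' i j h := by simp only [Pi.zero_apply, map_zero]
  neg_mem' hx i j h := by simp only [Pi.neg_apply, map_neg, hx i j h]

/-- The profinite integers, with the inverse limit topology. -/
def ZHat : Type := zhatCompatible

namespace ZHat

instance : CommRing ZHat := inferInstanceAs (CommRing zhatCompatible)
instance : TopologicalSpace ZHat := inferInstanceAs (TopologicalSpace zhatCompatible)
instance : IsTopologicalRing ZHat := inferInstanceAs (IsTopologicalRing zhatCompatible)
instance : T2Space ZHat := inferInstanceAs (T2Space zhatCompatible)

lemma isClosed_compatible : IsClosed (zhatCompatible : Set (∀ n : ℕ+, ZMod n)) := by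
  have : (zhatCompatible : Set (∀ n : ℕ+, ZMod n)) =
      ⋂ (n : ℕ+) (m : ℕ+) (h : (m : ℕ) ∣ n), {x | ZMod.castHom h (ZMod m) (x n) = x m} := by
    ext x; simp [zhatCompatible]
  rw [this]
  refine isClosed_iInter fun i => isClosed_iInter fun j => isClosed_iInter fun h => ?_
  exact isClosed_eq (continuous_of_discreteTopology.comp (continuous_apply i)) (continuous_apply j)

instance : CompactSpace ZHat :=
  isCompact_iff_compactSpace.1 isClosed_compatible.isCompact

end ZHat

namespace CompletedGroupRing

variable {G}

lemma levelAug_transition {i j : Index G} (h : Refines i j) (x : Level i) :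
    levelAug j (transition h x) = ZMod.castHom h.1 (ZMod j.1) (levelAug i x) := by
  have : (levelAug j).comp (transition h) = (ZMod.castHom h.1 (ZMod j.1)).comp (levelAug i) :=
    level_hom_ext fun x => by
      rw [RingHom.comp_apply, RingHom.comp_apply, transition_levelOf, levelAug_levelOf,
        levelAug_levelOf, map_one]
  exact DFunLike.congr_fun this x

/-- The open normal subgroup `G` of `G`. -/
def topONS : OpenNormalSubgroup G := ⟨⊤, inferInstanceAs (⊤ : Subgroup G).Normal⟩

variable (G) in
/-- The augmentation `ℤ̂[[G]] → ℤ̂`. -/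
noncomputable def aug : CompletedGroupRing G →+* ZHat :=
  (RingHom.pi fun n : ℕ+ => (levelAug (n, topONS)).comp (proj (n, topONS))).codRestrict
    zhatCompatible fun x n m h => by
      have hr : Refines ((n, topONS) : Index G) (m, topONS) := ⟨h, le_rfl⟩
      have := levelAug_transition hr (proj (n, topONS) x)
      rw [transition_proj] at this
      exact this.symm

lemma continuous_aug : Continuous (aug G) :=
  Continuous.subtype_mk (continuous_pi fun n =>
    (continuous_of_discreteTopology (f := levelAug ((n, topONS) : Index G))).comp
      (continuous_proj _)) _

lemma aug_surjective : Function.Surjective (aug G) := by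
  intro z
  let c (i : Index G) : ZMod i.1 →+* Level i :=
    MonoidAlgebra.singleOneRingHom (R := ZMod i.1) (M := G ⧸ i.2.toSubgroup)
  refine ⟨⟨fun i => c i (z.1 i.1), fun i j h => ?_⟩, Subtype.ext (funext fun n => ?_)⟩
  · change transition h (c i (z.1 i.1)) = c j (z.1 j.1)
    rw [← z.2 i.1 j.1 h.1]
    exact DFunLike.congr_fun (Subsingleton.elim ((transition h).comp (c i))
      ((c j).comp (ZMod.castHom h.1 (ZMod j.1)))) (z.1 i.1)
  · exact DFunLike.congr_fun (Subsingleton.elim ((levelAug (n, topONS)).comp (c (n, topONS)))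
      (RingHom.id _)) (z.1 n)

lemma aug_of (g : G) : aug G (of g) = 1 :=
  Subtype.ext (funext fun _ => levelAug_levelOf _ g)

end CompletedGroupRing

end CompletedGroupRing

open CompletedGroupRing Abelian

section Objects

variable (G : Type u) [Group G] [TopologicalSpace G] [IsTopologicalGroup G] [CompactSpace G]

/-- The free profinite module `ℤ̂[[G]]` of rank one. -/
noncomputable def regularHat : ProfMod (CompletedGroupRing G) := ProfMod.of (CompletedGroupRing G)

/-- The augmentation ideal `I_G` of a profinite group, as a profinite module. -/
noncomputable def augIdealHat : ProfMod (CompletedGroupRing G) :=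
  (regularHat G).sub (RingHom.ker (aug G)) (isClosed_singleton.preimage continuous_aug)

/-- The additive group `ℤ̂`, on which `ℤ̂[[G]]` acts through the augmentation. -/
def TrivialCarrier (_G : Type u) : Type u := ULift.{u} ZHat

namespace TrivialCarrier

instance : AddCommGroup (TrivialCarrier G) := inferInstanceAs (AddCommGroup (ULift.{u} ZHat))
instance : TopologicalSpace (TrivialCarrier G) :=
  inferInstanceAs (TopologicalSpace (ULift.{u} ZHat))
instance : IsTopologicalAddGroup (TrivialCarrier G) :=
  inferInstanceAs (IsTopologicalAddGroup (ULift.{u} ZHat))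
instance : CompactSpace (TrivialCarrier G) := inferInstanceAs (CompactSpace (ULift.{u} ZHat))
instance : T2Space (TrivialCarrier G) := inferInstanceAs (T2Space (ULift.{u} ZHat))

noncomputable instance : Module (CompletedGroupRing G) (TrivialCarrier G) :=
  letI : Module ZHat (TrivialCarrier G) := inferInstanceAs (Module ZHat (ULift.{u} ZHat))
  Module.compHom (TrivialCarrier G) (aug G)

lemma smul_def (r : CompletedGroupRing G) (x : TrivialCarrier G) :
    r • x = ULift.up (aug G r * x.down) := rfl

instance : ContinuousSMul (CompletedGroupRing G) (TrivialCarrier G) :=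
  ⟨continuous_uliftUp.comp ((continuous_aug.comp continuous_fst).mul
    (continuous_uliftDown.comp continuous_snd))⟩

instance : IsLinearTopology (CompletedGroupRing G) (TrivialCarrier G) :=
  ProfMod.isLinearTopology_of_inducing (A := fun n : ℕ+ => ZMod n)
    (fun x : TrivialCarrier G => x.down.1)
    ((IsInducing.subtypeVal (t := (zhatCompatible : Set (∀ n : ℕ+, ZMod n)))).comp
      (IsEmbedding.uliftDown (X := ZHat)).isInducing)
    (fun n =>
      { carrier := {x | x.down.1 n = 0}
        add_mem' := fun {x y} hx hy => by
          change x.down.1 n + y.down.1 n = 0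
          rw [show x.down.1 n = 0 from hx, show y.down.1 n = 0 from hy, add_zero]
        zero_mem' := rfl
        smul_mem' := fun r x hx => by
          change (aug G r).1 n * x.down.1 n = 0
          rw [show x.down.1 n = 0 from hx, mul_zero] })
    (fun _ _ => Iff.rfl)

end TrivialCarrier

/-- The trivial profinite module `ℤ̂`. -/
noncomputable def trivialHat : ProfMod (CompletedGroupRing G) := ProfMod.of (TrivialCarrier G)

/-- The augmentation `ℤ̂[[G]] → ℤ̂` as a morphism of profinite modules. -/
noncomputable def augHatHom : regularHat G ⟶ trivialHat G :=
  ⟨{ toFun := fun x : CompletedGroupRing G => (ULift.up (aug G x) : TrivialCarrier G)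
     map_add' := fun x y => congrArg ULift.up (map_add (aug G) x y)
     map_smul' := fun r x => congrArg ULift.up (map_mul (aug G) r x)
     cont := continuous_uliftUp.comp continuous_aug }⟩

/-- The sequence `0 → I_G → ℤ̂[[G]] → ℤ̂ → 0`. -/
noncomputable def augSeqHat : ShortComplex (ProfMod (CompletedGroupRing G)) where
  X₁ := augIdealHat G
  X₂ := regularHat G
  X₃ := trivialHat G
  f := ⟨(RingHom.ker (aug G) : Submodule (CompletedGroupRing G) (CompletedGroupRing G)).subtypeL⟩
  g := augHatHom G
  zero := ProfMod.hom_ext' fun x => congrArg ULift.up x.2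

lemma augSeqHat_shortExact : (augSeqHat G).ShortExact :=
  ProfMod.shortExact_of _ Subtype.val_injective
    (fun b hb => ⟨(⟨b, congrArg ULift.down hb⟩ : RingHom.ker (aug G)), rfl⟩)
    (fun z => by
      obtain ⟨x, hx⟩ := aug_surjective (G := G) z.down
      exact ⟨x, congrArg ULift.up hx⟩)

end Objects

section Discrete

variable (Υ : Type u) [Group Υ]

/-- The augmentation `ℤ[Υ] → ℤ`. -/
noncomputable def augZ : MonoidAlgebra ℤ Υ →+* ℤ := (MonoidAlgebra.lift ℤ ℤ Υ 1).toRingHom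

/-- The trivial `ℤ[Υ]`-module `ℤ`. -/
noncomputable def trivialZ : ModuleCat.{u} (MonoidAlgebra ℤ Υ) :=
  (ModuleCat.restrictScalars (augZ Υ)).obj (ModuleCat.of ℤ (ULift.{u} ℤ))

/-- The augmentation ideal `I_Υ` as a `ℤ[Υ]`-module. -/
noncomputable def augIdeal : ModuleCat.{u} (MonoidAlgebra ℤ Υ) :=
  ModuleCat.of (MonoidAlgebra ℤ Υ) (RingHom.ker (augZ Υ))

/-- The augmentation as a morphism `ℤ[Υ] → ℤ` of `ℤ[Υ]`-modules. -/
noncomputable def augHom :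
    ModuleCat.of (MonoidAlgebra ℤ Υ) (MonoidAlgebra ℤ Υ) ⟶ trivialZ Υ :=
  ModuleCat.ofHom (Y := trivialZ Υ)
    { toFun := fun x : MonoidAlgebra ℤ Υ => (ULift.up (augZ Υ x) : ULift.{u} ℤ)
      map_add' := fun x y => congrArg ULift.up (map_add (augZ Υ) x y)
      map_smul' := fun r x => congrArg ULift.up (map_mul (augZ Υ) r x) }

/-- The sequence `0 → I_Υ → ℤ[Υ] → ℤ → 0`. -/
noncomputable def augSeq : ShortComplex (ModuleCat.{u} (MonoidAlgebra ℤ Υ)) where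
  X₁ := augIdeal Υ
  X₂ := ModuleCat.of (MonoidAlgebra ℤ Υ) (MonoidAlgebra ℤ Υ)
  X₃ := trivialZ Υ
  f := ModuleCat.ofHom
    (RingHom.ker (augZ Υ) : Submodule (MonoidAlgebra ℤ Υ) (MonoidAlgebra ℤ Υ)).subtype
  g := augHom Υ
  zero := by
    ext x
    exact congrArg ULift.up x.2

lemma augZ_of (g : Υ) : augZ Υ (MonoidAlgebra.of ℤ Υ g) = 1 :=
  (MonoidAlgebra.lift_single _ _ _).trans (by simp)

lemma augSeq_shortExact : (augSeq Υ).ShortExact where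
  mono_f := (ModuleCat.mono_iff_injective _).2 Subtype.val_injective
  epi_g := (ModuleCat.epi_iff_surjective _).2 fun z => by
    refine ⟨((z : ULift.{u} ℤ).down : MonoidAlgebra ℤ Υ), congrArg ULift.up ?_⟩
    exact (map_intCast (augZ Υ) _).trans (Int.cast_id)
  exact := (ShortComplex.moduleCat_exact_iff _).2 fun b hb =>
    ⟨(⟨b, congrArg ULift.down hb⟩ : RingHom.ker (augZ Υ)), rfl⟩

end Discrete

section Hat

variable (Υ : Type u) [Group Υ]

/-- The profinite completion `Υ̂` of the group `Υ`. -/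
abbrev Hat : ProfiniteGrp.{u} := ProfiniteGrp.ProfiniteCompletion.completion (GrpCat.of Υ)

/-- The canonical map `Υ → Υ̂`. -/
noncomputable def eta : Υ →* Hat Υ := (ProfiniteGrp.ProfiniteCompletion.eta (GrpCat.of Υ)).hom

/-- The completed group ring `ℤ̂[[Υ̂]]`. -/
noncomputable abbrev RHat : Type u := CompletedGroupRing (Hat Υ)

/-- The canonical ring homomorphism `ℤ[Υ] → ℤ̂[[Υ̂]]`, extending `Υ → Υ̂`. -/
noncomputable def toHat : MonoidAlgebra ℤ Υ →+* RHat Υ :=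
  (MonoidAlgebra.lift ℤ (RHat Υ) Υ (CompletedGroupRing.of.comp (eta Υ))).toRingHom

lemma toHat_of (g : Υ) : toHat Υ (MonoidAlgebra.of ℤ Υ g) = CompletedGroupRing.of (eta Υ g) :=
  (MonoidAlgebra.lift_single _ _ _).trans (by simp)

lemma aug_toHat (a : MonoidAlgebra ℤ Υ) : aug (Hat Υ) (toHat Υ a) = (augZ Υ a : ZHat) := by
  have : (aug (Hat Υ)).comp (toHat Υ) = (Int.castRingHom ZHat).comp (augZ Υ) := by
    refine MonoidAlgebra.ringHom_ext' (RingHom.ext_int _ _) (MonoidHom.ext fun g => ?_)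
    change aug (Hat Υ) (toHat Υ (MonoidAlgebra.of ℤ Υ g)) =
      Int.castRingHom ZHat (augZ Υ (MonoidAlgebra.of ℤ Υ g))
    rw [toHat_of, aug_of, augZ_of, map_one]
  exact DFunLike.congr_fun this a

lemma eta_surjective_mod (U : OpenNormalSubgroup (Hat Υ)) (q : Hat Υ ⧸ U.toSubgroup) :
    ∃ g : Υ, (QuotientGroup.mk (eta Υ g) : Hat Υ ⧸ U.toSubgroup) = q := by
  obtain ⟨x, rfl⟩ := QuotientGroup.mk_surjective q
  obtain ⟨g, hg⟩ := (ProfiniteGrp.ProfiniteCompletion.denseRange (GrpCat.of Υ)).exists_mem_open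
    (s := (fun y => x⁻¹ * y) ⁻¹' (U : Set (Hat Υ))) (U.isOpen'.preimage (continuous_const_mul _))
    ⟨x, by simp [one_mem]⟩
  exact ⟨g, (QuotientGroup.eq.2 hg).symm⟩

lemma exists_approx (r : RHat Υ) (i : Index (Hat Υ)) :
    ∃ a : MonoidAlgebra ℤ Υ, proj i (toHat Υ a) = proj i r := by
  have key : ∀ y : Level i, ∃ a : MonoidAlgebra ℤ Υ, proj i (toHat Υ a) = y := by
    intro y
    refine MonoidAlgebra.induction_on (motive := fun y : Level i => ∃ a, proj i (toHat Υ a) = y) y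
      (fun q => ?_) ?_ ?_
    · obtain ⟨g, rfl⟩ := eta_surjective_mod Υ i.2 q
      exact ⟨MonoidAlgebra.of ℤ Υ g, by rw [toHat_of]; rfl⟩
    · rintro _ _ ⟨a, rfl⟩ ⟨b, rfl⟩
      exact ⟨a + b, (congrArg (proj i) (map_add (toHat Υ) a b)).trans (map_add (proj i) _ _)⟩
    · rintro c _ ⟨a, rfl⟩
      obtain ⟨n, rfl⟩ := ZMod.intCast_surjective c
      refine ⟨n • a, ((congrArg (proj i) (map_zsmul (toHat Υ) n a)).trans
        (map_zsmul (proj i) n _)).trans ?_⟩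
      let y : MonoidAlgebra (ZMod i.1) (Hat Υ ⧸ i.2.toSubgroup) := proj i (toHat Υ a)
      exact (Int.cast_smul_eq_zsmul (ZMod i.1) n y).symm
  exact key _

lemma exists_refinement (i j : Index (Hat Υ)) : ∃ k, Refines k i ∧ Refines k j :=
  ⟨(i.1 * j.1, i.2 ⊓ j.2),
    ⟨⟨_, PNat.mul_coe _ _⟩, fun _ hx => hx.1⟩,
    ⟨⟨_, (PNat.mul_coe _ _).trans (mul_comm _ _)⟩, fun _ hx => hx.2⟩⟩

variable {Υ}

lemma proj_eq_of_refines {i j : Index (Hat Υ)} (h : Refines i j) {r s : RHat Υ}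
    (hrs : proj i r = proj i s) : proj j r = proj j s := by
  rw [← transition_proj h, ← transition_proj h, hrs]

section finite

variable (A : Type u) [AddCommGroup A] [Module (MonoidAlgebra ℤ Υ) A] [Finite A]

/-- A finite `ℤ[Υ]`-module factors through a level. -/
lemma exists_level : ∃ i : Index (Hat Υ), ∀ a : MonoidAlgebra ℤ Υ,
    proj i (toHat Υ a) = 0 → ∀ x : A, a • x = 0 := by
  let _ : MulAction Υ A := MulAction.compHom A (MonoidAlgebra.of ℤ Υ)
  let K : Subgroup Υ := (MulAction.toPermHom Υ A).ker
  have : K.FiniteIndex := Subgroup.finiteIndex_ker _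
  let K' : FiniteIndexNormalSubgroup Υ := FiniteIndexNormalSubgroup.ofSubgroup K
  let Q : ProfiniteGrp.{u} := (ProfiniteGrp.ProfiniteCompletion.diagram (GrpCat.of Υ)).obj K'
  have : DiscreteTopology Q := ⟨rfl⟩
  have hev : Continuous fun x : Hat Υ => (x.1 K' : Q) :=
    (continuous_apply (A := fun K => (ProfiniteGrp.ProfiniteCompletion.diagram (GrpCat.of Υ)).obj K)
      K').comp continuous_subtype_val
  let U : OpenNormalSubgroup (Hat Υ) :=
    { carrier := {x | x.1 K' = 1}
      mul_mem' := fun {x y} hx hy => by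
        change x.1 K' * y.1 K' = 1
        rw [show x.1 K' = 1 from hx, show y.1 K' = 1 from hy, mul_one]
      one_mem' := rfl
      inv_mem' := fun {x} hx => by
        change (x.1 K')⁻¹ = 1
        rw [show x.1 K' = 1 from hx, inv_one]
      isOpen' := hev.isOpen_preimage _ (isOpen_discrete ({1} : Set Q))
      isNormal' := ⟨fun x hx g => by
        change g.1 K' * x.1 K' * (g.1 K')⁻¹ = 1
        rw [show x.1 K' = 1 from hx, mul_one, mul_inv_cancel]⟩ }
  have hU : ∀ g h : Υ, (QuotientGroup.mk (eta Υ g) : Hat Υ ⧸ U.toSubgroup) =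
      QuotientGroup.mk (eta Υ h) → ∀ x : A,
        MonoidAlgebra.of ℤ Υ g • x = MonoidAlgebra.of ℤ Υ h • x := by
    intro g h hgh x
    have h1 : (QuotientGroup.mk (g⁻¹ * h) : Υ ⧸ K'.toSubgroup) = 1 := QuotientGroup.eq.1 hgh
    have h2 : g⁻¹ * h ∈ K := (QuotientGroup.eq_one_iff _).1 h1
    have h3 : (g⁻¹ * h) • x = x := DFunLike.congr_fun (MonoidHom.mem_ker.1 h2) x
    have h4 : h • x = g • x := by
      rw [← mul_inv_cancel_left g h, mul_smul, h3]
    exact h4.symm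
  choose σ hσ using eta_surjective_mod Υ U
  let n : ℕ+ := ⟨Nat.card A, Nat.card_pos⟩
  let i : Index (Hat Υ) := (n, U)
  refine ⟨i, fun a ha x => ?_⟩
  let c (q : Hat Υ ⧸ U.toSubgroup) : ZMod n →+ A :=
    ZMod.lift n ⟨zmultiplesHom A (MonoidAlgebra.of ℤ Υ (σ q) • x), by
      simp only [zmultiplesHom_apply, natCast_zsmul]
      exact card_nsmul_eq_zero'⟩
  let F : MonoidAlgebra (ZMod n) (Hat Υ ⧸ U.toSubgroup) →+ A :=
    (Finsupp.liftAddHom c).comp MonoidAlgebra.coeffAddEquiv.toAddMonoidHom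
  let p : MonoidAlgebra ℤ Υ →+ MonoidAlgebra (ZMod n) (Hat Υ ⧸ U.toSubgroup) :=
    ((proj i).comp (toHat Υ)).toAddMonoidHom
  have key : F.comp p = (AddMonoidHom.flip (smulAddHom (MonoidAlgebra ℤ Υ) A)) x := by
    refine MonoidAlgebra.addMonoidHom_ext fun g m => ?_
    have hs : (MonoidAlgebra.single g m : MonoidAlgebra ℤ Υ) = m • MonoidAlgebra.of ℤ Υ g := by
      simp
    have hp : p (MonoidAlgebra.of ℤ Υ g) = MonoidAlgebra.single (QuotientGroup.mk (eta Υ g)) 1 :=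
      congrArg (proj i) (toHat_of Υ g)
    have hF : F (MonoidAlgebra.single (QuotientGroup.mk (eta Υ g)) 1) =
        MonoidAlgebra.of ℤ Υ g • x := by
      have h1 : F (MonoidAlgebra.single (QuotientGroup.mk (eta Υ g)) 1) =
          c (QuotientGroup.mk (eta Υ g)) 1 :=
        Finsupp.liftAddHom_apply_single c _ _
      rw [h1, ← hU _ _ (hσ (QuotientGroup.mk (eta Υ g))) x]
      have := ZMod.lift_coe n ⟨zmultiplesHom A
        (MonoidAlgebra.of ℤ Υ (σ (QuotientGroup.mk (eta Υ g))) • x), by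
          simp only [zmultiplesHom_apply, natCast_zsmul]
          exact card_nsmul_eq_zero'⟩ 1
      rw [Int.cast_one] at this
      exact this.trans (one_zsmul _)
    rw [hs, map_zsmul, map_zsmul, AddMonoidHom.comp_apply, hp, hF]
    rfl
  have := DFunLike.congr_fun key a
  have hp0 : p a = 0 := ha
  rw [AddMonoidHom.comp_apply, hp0, map_zero] at this
  exact this.symm

/-- A chosen level through which the action on a finite module factors. -/
noncomputable def hatLevel : Index (Hat Υ) := (exists_level A).choose

lemma hatLevel_spec (a : MonoidAlgebra ℤ Υ) (h : proj (hatLevel A) (toHat Υ a) = 0) (x : A) :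
    a • x = 0 := (exists_level A).choose_spec a h x

variable {A}

/-- The action of `ℤ̂[[Υ̂]]` on a finite `ℤ[Υ]`-module: `r` acts as any element of `ℤ[Υ]`
approximating it at a level through which the action factors. -/
noncomputable def hatSMul (r : RHat Υ) (x : A) : A := (exists_approx Υ r (hatLevel A)).choose • x

lemma hatSMul_eq (r : RHat Υ) (x : A) (a : MonoidAlgebra ℤ Υ)
    (h : proj (hatLevel A) (toHat Υ a) = proj (hatLevel A) r) : hatSMul r x = a • x := by
  rw [hatSMul, ← sub_eq_zero, ← sub_smul]
  refine hatLevel_spec A _ ?_ x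
  rw [map_sub, map_sub, (exists_approx Υ r (hatLevel A)).choose_spec, h, sub_self]

variable (A) in
/-- The `ℤ̂[[Υ̂]]`-module structure on a finite `ℤ[Υ]`-module. -/
noncomputable abbrev hatModule : Module (RHat Υ) A where
  smul := hatSMul
  one_smul x := by
    change hatSMul 1 x = x
    rw [hatSMul_eq 1 x 1 (by rw [map_one]), one_smul]
  mul_smul r s x := by
    change hatSMul (r * s) x = hatSMul r (hatSMul s x)
    obtain ⟨a, ha⟩ := exists_approx Υ r (hatLevel A)
    obtain ⟨b, hb⟩ := exists_approx Υ s (hatLevel A)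
    rw [hatSMul_eq s x b hb, hatSMul_eq r _ a ha,
      hatSMul_eq (r * s) x (a * b) (by simp only [map_mul, ha, hb]), mul_smul]
  smul_zero r := smul_zero (M := MonoidAlgebra ℤ Υ) _
  smul_add r x y := smul_add (M := MonoidAlgebra ℤ Υ) _ x y
  add_smul r s x := by
    change hatSMul (r + s) x = hatSMul r x + hatSMul s x
    obtain ⟨a, ha⟩ := exists_approx Υ r (hatLevel A)
    obtain ⟨b, hb⟩ := exists_approx Υ s (hatLevel A)
    rw [hatSMul_eq s x b hb, hatSMul_eq r _ a ha,
      hatSMul_eq (r + s) x (a + b) (by simp only [map_add, ha, hb]), add_smul]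
  zero_smul x := by
    change hatSMul 0 x = 0
    rw [hatSMul_eq 0 x 0 (by rw [map_zero]), zero_smul]

lemma hatSMul_toHat (a : MonoidAlgebra ℤ Υ) (x : A) : hatSMul (toHat Υ a) x = a • x :=
  hatSMul_eq _ x a rfl

lemma map_hatSMul {B : Type u} [AddCommGroup B] [Module (MonoidAlgebra ℤ Υ) B] [Finite B]
    (φ : A →ₗ[MonoidAlgebra ℤ Υ] B) (r : RHat Υ) (x : A) :
    φ (hatSMul r x) = hatSMul r (φ x) := by
  obtain ⟨k, hA, hB⟩ := exists_refinement Υ (hatLevel A) (hatLevel B)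
  obtain ⟨a, ha⟩ := exists_approx Υ r k
  rw [hatSMul_eq r x a (proj_eq_of_refines hA ha), hatSMul_eq r (φ x) a (proj_eq_of_refines hB ha),
    map_smul]

lemma continuous_hatSMul [TopologicalSpace A] [DiscreteTopology A] :
    Continuous fun p : RHat Υ × A => hatSMul p.1 p.2 := by
  have hc : ∀ x : A, ∀ r s : RHat Υ, proj (hatLevel A) r = proj (hatLevel A) s →
      hatSMul r x = hatSMul s x := by
    intro x r s h
    obtain ⟨a, ha⟩ := exists_approx Υ r (hatLevel A)
    rw [hatSMul_eq r x a ha, hatSMul_eq s x a (ha.trans h)]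
  refine continuous_prod_of_discrete_right.2 fun x => continuous_discrete_rng.2 fun y => ?_
  have : (fun r : RHat Υ => hatSMul r x) ⁻¹' {y} = proj (hatLevel A) ⁻¹'
      (proj (hatLevel A) '' ((fun r : RHat Υ => hatSMul r x) ⁻¹' {y})) := by
    refine Set.Subset.antisymm (Set.subset_preimage_image _ _) ?_
    rintro r ⟨s, hs, hsr⟩
    exact (hc x r s hsr.symm).trans hs
  change IsOpen ((fun r : RHat Υ => hatSMul r x) ⁻¹' {y})
  rw [this]
  exact (isOpen_discrete _).preimage (continuous_proj _)

end finite

section Completion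

variable (M : Type u) [AddCommGroup M] [Module (MonoidAlgebra ℤ Υ) M]

/-- The submodules of finite index. -/
abbrev FinIndex : Type u := {N : Submodule (MonoidAlgebra ℤ Υ) M // Finite (M ⧸ N)}

variable {M}

/-- The finite quotient `M / N`, a discrete `ℤ̂[[Υ̂]]`-module. -/
def FinQuot (N : FinIndex (Υ := Υ) M) : Type u := M ⧸ N.1

variable (N : FinIndex (Υ := Υ) M)

noncomputable instance : AddCommGroup (FinQuot N) := inferInstanceAs (AddCommGroup (M ⧸ N.1))
noncomputable instance : Module (MonoidAlgebra ℤ Υ) (FinQuot N) :=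
  inferInstanceAs (Module (MonoidAlgebra ℤ Υ) (M ⧸ N.1))
instance : Finite (FinQuot N) := N.2
instance : TopologicalSpace (FinQuot N) := ⊥
instance : DiscreteTopology (FinQuot N) := ⟨rfl⟩
noncomputable instance : Module (RHat Υ) (FinQuot N) := hatModule (FinQuot N)
instance : ContinuousSMul (RHat Υ) (FinQuot N) := ⟨continuous_hatSMul⟩

/-- The projection `M → M / N`. -/
noncomputable def FinQuot.mk : M →ₗ[MonoidAlgebra ℤ Υ] FinQuot N := N.1.mkQ

variable {N}

/-- The projection `M / N → M / N'` for `N ≤ N'`. -/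
noncomputable def FinQuot.trans {N' : FinIndex (Υ := Υ) M} (h : N.1 ≤ N'.1) :
    FinQuot N →ₗ[MonoidAlgebra ℤ Υ] FinQuot N' := Submodule.factor h

lemma smul_finQuot (r : RHat Υ) (x : FinQuot N) : r • x = hatSMul r x := rfl

variable (M) in
/-- The compatible families of elements in the finite quotients of `M`. -/
noncomputable def completionSubmodule : Submodule (RHat Υ) (∀ N : FinIndex (Υ := Υ) M, FinQuot N) where
  carrier := {x | ∀ (N N' : FinIndex (Υ := Υ) M) (h : N.1 ≤ N'.1), FinQuot.trans h (x N) = x N'}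
  add_mem' hx hy N N' h := by
    rw [Pi.add_apply, Pi.add_apply, map_add, hx N N' h, hy N N' h]
  zero_mem' N N' h := map_zero _
  smul_mem' r x hx N N' h := by
    rw [Pi.smul_apply, Pi.smul_apply, smul_finQuot, smul_finQuot, map_hatSMul, hx N N' h]

lemma isClosed_completionSubmodule :
    IsClosed (completionSubmodule (Υ := Υ) M : Set (∀ N : FinIndex (Υ := Υ) M, FinQuot N)) := by
  have : (completionSubmodule (Υ := Υ) M : Set (∀ N : FinIndex (Υ := Υ) M, FinQuot N)) =
      ⋂ (N : FinIndex (Υ := Υ) M) (N' : FinIndex (Υ := Υ) M) (h : N.1 ≤ N'.1),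
        {x | FinQuot.trans h (x N) = x N'} := by
    ext x; simp [completionSubmodule]
  rw [this]
  refine isClosed_iInter fun i => isClosed_iInter fun j => isClosed_iInter fun h => ?_
  exact isClosed_eq (continuous_of_discreteTopology.comp (continuous_apply i)) (continuous_apply j)

instance : CompactSpace (completionSubmodule (Υ := Υ) M) :=
  isCompact_iff_compactSpace.1 isClosed_completionSubmodule.isCompact

instance : IsLinearTopology (RHat Υ) (completionSubmodule (Υ := Υ) M) :=
  ProfMod.isLinearTopology_of_inducing (A := fun N : FinIndex (Υ := Υ) M => FinQuot N)
    (fun x => x.1) IsInducing.subtypeVal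
    (fun N => LinearMap.ker ((LinearMap.proj N).comp (completionSubmodule (Υ := Υ) M).subtype))
    (fun _ _ => Iff.rfl)

end Completion

/-- The profinite completion `M̂ = lim M/N` over the submodules `N` of finite index, a profinite
`ℤ̂[[Υ̂]]`-module. -/
noncomputable def completion (M : ModuleCat.{u} (MonoidAlgebra ℤ Υ)) : ProfMod (RHat Υ) :=
  ProfMod.of (completionSubmodule (Υ := Υ) M)

/-- Underlying `ℤ[Υ]`-module of a profinite `ℤ̂[[Υ̂]]`-module. -/
noncomputable abbrev resHat : ProfMod (RHat Υ) ⥤ ModuleCat.{u} (MonoidAlgebra ℤ Υ) :=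
  ProfMod.restrict (toHat Υ)

/-- The canonical map `M → M̂`. -/
noncomputable def toCompletion (M : ModuleCat.{u} (MonoidAlgebra ℤ Υ)) :
    M ⟶ resHat.obj (completion M) :=
  ModuleCat.ofHom (Y := resHat.obj (completion M))
    { toFun := fun m => (⟨fun N => FinQuot.mk N m, fun _ _ _ => rfl⟩ : completionSubmodule (Υ := Υ) M)
      map_add' := fun x y => Subtype.ext (funext fun N => map_add (FinQuot.mk N) x y)
      map_smul' := fun a x => Subtype.ext (funext fun N =>
        (map_smul (FinQuot.mk N) a x).trans (hatSMul_toHat a (FinQuot.mk N x)).symm) }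

variable {M M' : ModuleCat.{u} (MonoidAlgebra ℤ Υ)}

/-- The preimage of a submodule of finite index. -/
noncomputable def FinIndex.comap (φ : M ⟶ M') (N : FinIndex (Υ := Υ) M') : FinIndex (Υ := Υ) M :=
  ⟨N.1.comap φ.hom, by
    have := N.2
    refine Finite.of_injective (Submodule.mapQ (N.1.comap φ.hom) N.1 φ.hom le_rfl) ?_
    rw [← LinearMap.ker_eq_bot, Submodule.ker_mapQ]
    simp⟩

/-- The map on finite quotients induced by a homomorphism. -/
noncomputable def FinQuot.map (φ : M ⟶ M') (N : FinIndex (Υ := Υ) M') :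
    FinQuot (N.comap φ) →ₗ[MonoidAlgebra ℤ Υ] FinQuot N :=
  Submodule.mapQ (N.1.comap φ.hom) N.1 φ.hom le_rfl

lemma FinQuot.map_trans (φ : M ⟶ M') {N N' : FinIndex (Υ := Υ) M'} (h : N.1 ≤ N'.1)
    (x : FinQuot (N.comap φ)) : FinQuot.trans h (FinQuot.map φ N x) =
      FinQuot.map φ N' (FinQuot.trans (N := N.comap φ) (N' := N'.comap φ) (Submodule.comap_mono h) x) := by
  obtain ⟨m, rfl⟩ := Submodule.mkQ_surjective _ x
  rfl

/-- The continuous homomorphism `M̂ → M̂'` induced by a homomorphism `M → M'`. -/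
noncomputable def completionMap (φ : M ⟶ M') : completion M ⟶ completion M' :=
  ⟨{ toFun := fun x : completionSubmodule (Υ := Υ) M =>
        (⟨fun N => FinQuot.map φ N (x.1 (N.comap φ)), fun N N' h => by
          rw [FinQuot.map_trans, x.2 _ _ (Submodule.comap_mono h)]⟩ : completionSubmodule (Υ := Υ) M')
     map_add' := fun x y => Subtype.ext (funext fun N => map_add (FinQuot.map φ N) _ _)
     map_smul' := fun r x => Subtype.ext (funext fun N => map_hatSMul (FinQuot.map φ N) r _)
     cont := Continuous.subtype_mk (continuous_pi fun N =>
      (continuous_of_discreteTopology (f := FinQuot.map φ N)).comp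
        ((continuous_apply (A := fun N : FinIndex (Υ := Υ) M => FinQuot N) _).comp continuous_subtype_val)) _ }⟩

lemma completionMap_toCompletion (φ : M ⟶ M') :
    toCompletion M ≫ resHat.map (completionMap φ) = φ ≫ toCompletion M' := rfl

variable (Υ) in
/-- The canonical map `ℤ → ℤ̂`. -/
noncomputable def trivialToHat : trivialZ Υ ⟶ resHat.obj (trivialHat (Hat Υ)) :=
  ModuleCat.ofHom (X := trivialZ Υ) (Y := resHat.obj (trivialHat (Hat Υ)))
    { toFun := fun z : ULift.{u} ℤ => (ULift.up (z.down : ZHat) : TrivialCarrier (Hat Υ))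
      map_add' := fun x y => congrArg ULift.up (Int.cast_add x.down y.down)
      map_smul' := fun a x => congrArg ULift.up (by
        change ((augZ Υ a * (x : ULift.{u} ℤ).down : ℤ) : ZHat) =
          aug (Hat Υ) (toHat Υ a) * ((x : ULift.{u} ℤ).down : ZHat)
        rw [aug_toHat, Int.cast_mul]) }

variable (Υ) in
/-- The canonical map `I_Υ → I_Υ̂`, the restriction of `ℤ[Υ] → ℤ̂[[Υ̂]]`. -/
noncomputable def augIdealToHat : augIdeal Υ ⟶ resHat.obj (augIdealHat (Hat Υ)) :=
  ModuleCat.ofHom (X := augIdeal Υ) (Y := resHat.obj (augIdealHat (Hat Υ)))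
    { toFun := fun x : RingHom.ker (augZ Υ) => (⟨toHat Υ x.1, by
        rw [RingHom.mem_ker, aug_toHat, RingHom.mem_ker.1 x.2, Int.cast_zero]⟩ :
          RingHom.ker (aug (Hat Υ)))
      map_add' := fun x y => Subtype.ext (map_add (toHat Υ) x.1 y.1)
      map_smul' := fun a x => Subtype.ext (map_mul (toHat Υ) a x.1) }

end Hat

section Cohomology

variable (Υ : Type u) [Group Υ]

/-- Type `FP_∞`: the trivial module `ℤ` has a resolution by finitely generated projective
`ℤ[Υ]`-modules. -/
def IsFPInfty : Prop :=
  ∃ P : ProjectiveResolution (trivialZ Υ),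
    ∀ n, Module.Finite (MonoidAlgebra ℤ Υ) (P.complex.X n)

variable {Υ}

/-- Group cohomology `H^n(Υ, M) = Ext^n_{ℤ[Υ]}(ℤ, M)`. -/
abbrev GrpH (M : ModuleCat.{u} (MonoidAlgebra ℤ Υ)) (n : ℕ) : Type u :=
  Ext.{u} (trivialZ Υ) M n

/-- Cohomology of the profinite group `Υ̂` with profinite coefficients,
`H^n(Υ̂, B) = Ext^n(ℤ̂, B)` in the abelian category of profinite `ℤ̂[[Υ̂]]`-modules. -/
abbrev ProfH (B : ProfMod (RHat Υ)) (n : ℕ) : Type (u + 1) :=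
  Ext.{u + 1} (trivialHat (Hat Υ)) B n

/-- `Ext^n_{ℤ[Υ]}(I_Υ, M)`. -/
abbrev AugExt (M : ModuleCat.{u} (MonoidAlgebra ℤ Υ)) (n : ℕ) : Type u :=
  Ext.{u} (augIdeal Υ) M n

/-- `Ext^n(I_Υ̂, B)` in the category of profinite `ℤ̂[[Υ̂]]`-modules. -/
abbrev ProfAugExt (B : ProfMod (RHat Υ)) (n : ℕ) : Type (u + 1) :=
  Ext.{u + 1} (augIdealHat (Hat Υ)) B n

/-- The boundary map `Ext^n(I_Υ, M) → H^{n+1}(Υ, M)` of the long exact sequence associated with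
`0 → I_Υ → ℤ[Υ] → ℤ → 0`. -/
noncomputable def boundary (M : ModuleCat.{u} (MonoidAlgebra ℤ Υ)) (n : ℕ) :
    AugExt M n →+ GrpH M (n + 1) :=
  (augSeq_shortExact Υ).extClass.precomp M (add_comm 1 n)

/-- The boundary map `Ext^n(I_Υ̂, B) → H^{n+1}(Υ̂, B)` of the long exact sequence associated with
`0 → I_Υ̂ → ℤ̂[[Υ̂]] → ℤ̂ → 0`. -/
noncomputable def boundaryHat (B : ProfMod (RHat Υ)) (n : ℕ) :
    ProfAugExt B n →+ ProfH B (n + 1) :=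
  (augSeqHat_shortExact (Hat Υ)).extClass.precomp B (add_comm 1 n)

/-- The map `H^n(Υ̂, B) → H^n(Υ, B)` induced by `Υ → Υ̂`: apply the exact restriction functor, then
pull back along `ℤ → ℤ̂`. -/
noncomputable def resH (B : ProfMod (RHat Υ)) (n : ℕ) (z : ProfH B n) : GrpH (resHat.obj B) n :=
  (Ext.mk₀ (trivialToHat Υ)).comp (z.mapExactFunctor resHat) (zero_add n)

/-- The map `Ext^n(I_Υ̂, B) → Ext^n(I_Υ, B)`: apply the exact restriction functor, then
pull back along `I_Υ → I_Υ̂`. -/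
noncomputable def resAugExt (B : ProfMod (RHat Υ)) (n : ℕ) (z : ProfAugExt B n) :
    AugExt (resHat.obj B) n :=
  (Ext.mk₀ (augIdealToHat Υ)).comp (z.mapExactFunctor resHat) (zero_add n)

variable (Υ) in
/-- Separable cohomology (cohomological goodness): for every finite `Υ`-module `A`, the map
`Υ → Υ̂` induces isomorphisms `H^n(Υ̂, A) → H^n(Υ, A)`. A finite `Υ`-module is the same as a finite
object of the category of profinite `ℤ̂[[Υ̂]]`-modules. -/
def HasSeparableCohomology : Prop :=
  ∀ A : ProfMod (RHat Υ), Finite A → ∀ n : ℕ, Function.Bijective (resH A n)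

end Cohomology

section Extensions

variable {Υ : Type u} [Group Υ]

/-- `z ∈ H²(Υ, M)` is the class of the inhomogeneous 2-cocycle `f`. In terms of the bar resolution
`⋯ → P₂ → P₁ → I_Υ → 0` with `P₁` free on symbols `[g] ↦ g - 1` and `d[g|h] = g[h] - [gh] + [g]`,
this means that `z` is the image under the boundary map of the class of an extension
`0 → M → N → I_Υ → 0` admitting a lift `[g] ↦ s g` of `P₁ → I_Υ` to `N` whose value on
`d[g|h]` is `f g h`. -/
def IsCocycleClass {M : ModuleCat.{u} (MonoidAlgebra ℤ Υ)} (f : Υ → Υ → M) (z : GrpH M 2) : Prop :=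
  ∃ (N : ModuleCat.{u} (MonoidAlgebra ℤ Υ)) (i : M ⟶ N) (p : N ⟶ augIdeal Υ) (w : i ≫ p = 0)
    (hS : (ShortComplex.mk i p w).ShortExact) (s : Υ → N),
    (∀ g, p.hom (s g) = (⟨MonoidAlgebra.of ℤ Υ g - 1, by
      rw [RingHom.mem_ker, map_sub, augZ_of, map_one, sub_self]⟩ : RingHom.ker (augZ Υ))) ∧
    (∀ g h, i.hom (f g h) = MonoidAlgebra.of ℤ Υ g • s h - s (g * h) + s g) ∧
    z = boundary M 1 hS.extClass

/-- The extension of groups `1 → M → E → Υ → 1` induces the given `Υ`-module structure on `M`. -/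
def InducesAction {M : ModuleCat.{u} (MonoidAlgebra ℤ Υ)} {E : Type u} [Group E]
    (S : GroupExtension (Multiplicative M) E Υ) : Prop :=
  ∀ (e : E) (m : M), e * S.inl (Multiplicative.ofAdd m) * e⁻¹ =
    S.inl (Multiplicative.ofAdd (MonoidAlgebra.of ℤ Υ (S.rightHom e) • m))

/-- `z ∈ H²(Υ, M)` corresponds to the extension of groups `1 → M → E → Υ → 1`: it is the class of
the factor set `f` of a set-theoretic section `σ`, i.e. `σ g * σ h = f g h * σ (g * h)`. -/
def CorrespondsTo {M : ModuleCat.{u} (MonoidAlgebra ℤ Υ)} {E : Type u} [Group E]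
    (S : GroupExtension (Multiplicative M) E Υ) (z : GrpH M 2) : Prop :=
  ∃ (σ : Υ → E) (f : Υ → Υ → M), (∀ g, S.rightHom (σ g) = g) ∧
    (∀ g h, σ g * σ h = S.inl (Multiplicative.ofAdd (f g h)) * σ (g * h)) ∧
    IsCocycleClass f z

/-- The profinite analogue of `IsCocycleClass`: `z ∈ H²(Υ̂, B)` is the class of the continuous
2-cocycle `f`. Now `P₁` is the free profinite module on the profinite space of symbols `[g]`, so
that the lift `s` has to be continuous. -/
def IsProfCocycleClass {B : ProfMod (RHat Υ)} (f : Hat Υ → Hat Υ → B) (z : ProfH B 2) : Prop :=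
  ∃ (N : ProfMod (RHat Υ)) (i : B ⟶ N) (p : N ⟶ augIdealHat (Hat Υ)) (w : i ≫ p = 0)
    (hS : (ShortComplex.mk i p w).ShortExact) (s : Hat Υ → N), Continuous s ∧
    (∀ g, p.hom (s g) = (⟨CompletedGroupRing.of g - 1, by
      rw [RingHom.mem_ker, map_sub, aug_of, map_one, sub_self]⟩ : RingHom.ker (aug (Hat Υ)))) ∧
    (∀ g h, i.hom (f g h) = CompletedGroupRing.of g • s h - s (g * h) + s g) ∧
    z = boundaryHat B 1 hS.extClass

/-- `1 → B → F → Υ̂ → 1` is an extension of profinite groups (the maps are continuous) inducing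
the given structure of `Υ̂`-module on `B`. -/
def IsProfiniteExtension {B : ProfMod (RHat Υ)} {F : ProfiniteGrp.{u}}
    (S : GroupExtension (Multiplicative B) F (Hat Υ)) : Prop :=
  Continuous (fun b : B => S.inl (Multiplicative.ofAdd b)) ∧ Continuous S.rightHom ∧
    ∀ (e : F) (b : B), e * S.inl (Multiplicative.ofAdd b) * e⁻¹ =
      S.inl (Multiplicative.ofAdd (CompletedGroupRing.of (S.rightHom e) • b))

/-- `z ∈ H²(Υ̂, B)` corresponds to the extension of profinite groups `1 → B → F → Υ̂ → 1`: it is the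
class of the factor set of a continuous section. -/
def ProfCorrespondsTo {B : ProfMod (RHat Υ)} {F : ProfiniteGrp.{u}}
    (S : GroupExtension (Multiplicative B) F (Hat Υ)) (z : ProfH B 2) : Prop :=
  ∃ (σ : Hat Υ → F) (f : Hat Υ → Hat Υ → B), Continuous σ ∧ (∀ g, S.rightHom (σ g) = g) ∧
    (∀ g h, σ g * σ h = S.inl (Multiplicative.ofAdd (f g h)) * σ (g * h)) ∧
    IsProfCocycleClass f z

/-- The continuous homomorphism `Ê → Υ̂` induced by a homomorphism `E → Υ`. -/
noncomputable def hatMap {E : Type u} [Group E] (p : E →* Υ) : Hat E →* Hat Υ :=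
  (ProfiniteGrp.profiniteCompletion.map (GrpCat.ofHom p)).hom.toMonoidHom

end Extensions

end ProfCoh

open Abelian ProfCoh

namespace ProfCoh

open CompletedGroupRing

/-! The proof isolates two properties of a map `u : L ⟶ L'` from a discrete module to a profinite
one. It is universal (`IsUniversal`) when it is a profinite completion. It is good (`IsGood`) when
moreover restriction along it is bijective on Ext with finite coefficients. Separable cohomology
says precisely that `ℤ → ℤ̂` is good, and everything else is propagated from there.

The central point is `shortExact_of_projective`. Let `0 → K → P → L → 0` be exact with `P`
projective and `L` good. Completion is right exact for formal reasons, and injectivity of `K̂ → P̂`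
is tested in a finite quotient `A` of `K̂`. The class in Ext¹(L, A) obtained by pushing the
presentation out along `K → A` comes from Ext¹(L', A). This forces `K̂ → A` to vanish on the kernel
of `K̂ → P̂`. Dimension shifting then shows that `K` is good again (`IsGood.kernel`). For the
augmentation sequence this identifies the completion of `I_Υ` with `I_Υ̂` and makes `I_Υ → I_Υ̂`
good. A pushout argument extends exactness to arbitrary extensions of a good module
(`shortExact_of_isGood`).

The maps on Ext are given in degree zero by completing homomorphisms, and one degree higher by
transport along surjective boundary maps (`exists_extLift_succ`). In degree one every extension is a
pushout of a projective presentation, so its class goes to the class of the completed extension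
(`exists_extLift_one`); this is (b). The maps on cohomology in positive degrees are built from those
for `I_Υ` by the augmentation sequences, so (c) holds by construction.

For (a), the class of a group extension `E` is the boundary of a module extension `N` of `I_Υ` by
`M`, and `E` carries a crossed homomorphism to `N` extending the inclusion of `M`. Completing `N`
gives a profinite group `Crossed` of pairs `(x, g)` with `x` lying over `g - 1`. The crossed
homomorphism induces an isomorphism from `Ê` onto it (`exists_profinite_extension`). Exactness of
the completed group extension, the action and a continuous factor set are all read off there; the
continuous section comes from `ProfMod.exists_continuous_section`. -/

lemma mem_nhds_of_inducing_pi {B : Type*} [TopologicalSpace B] {J : Type*} {A : J → Type*}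
    [∀ j, TopologicalSpace (A j)] [∀ j, DiscreteTopology (A j)] {π : B → ∀ j, A j}
    (hπ : IsInducing π) {x : B} {s : Set B} (hs : s ∈ 𝓝 x) :
    ∃ I : Finset J, ∀ y, (∀ j ∈ I, π y j = π x j) → y ∈ s := by
  rw [hπ.nhds_eq_comap, Filter.mem_comap] at hs
  obtain ⟨t, ht, hts⟩ := hs
  rw [nhds_pi, Filter.mem_pi'] at ht
  obtain ⟨I, v, hv, hvt⟩ := ht
  refine ⟨I, fun y hy => hts (hvt fun j hj => ?_)⟩
  rw [hy j hj]
  exact mem_of_mem_nhds (hv j)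

/-! ### Open submodules and finite quotients of profinite modules. -/

namespace ProfMod

variable {R : Type u} [Ring R] [TopologicalSpace R] (B : ProfMod R)

lemma exists_open_submodule {s : Set B} (hs : s ∈ 𝓝 (0 : B)) :
    ∃ V : Submodule R B, IsOpen (V : Set B) ∧ (V : Set B) ⊆ s := by
  obtain ⟨V, hV, hVs⟩ := (IsLinearTopology.hasBasis_submodule R).mem_iff.1 hs
  exact ⟨V, V.toAddSubgroup.isOpen_of_mem_nhds hV, hVs⟩

/-- This reduces statements about profinite modules to their finite quotients, where the hypothesis
on cohomology applies. -/
lemma eq_zero_of_forall_open {x : B}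
    (h : ∀ V : Submodule R B, IsOpen (V : Set B) → x ∈ V) : x = 0 := by
  by_contra hx
  obtain ⟨V, hV, hVs⟩ := B.exists_open_submodule (isOpen_compl_singleton.mem_nhds (Ne.symm hx))
  exact hVs (h V hV) rfl

variable {B}

lemma isClosed_of_isOpen {V : Submodule R B} (hV : IsOpen (V : Set B)) : IsClosed (V : Set B) :=
  V.toAddSubgroup.isClosed_of_isOpen hV

lemma finite_quotient {V : Submodule R B} (hV : IsOpen (V : Set B)) : Finite (B ⧸ V) :=
  AddSubgroup.quotient_finite_of_isOpen V.toAddSubgroup hV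

instance finite_quot {V : Submodule R B} (hV : IsOpen (V : Set B)) :
    Finite (B.quot V (isClosed_of_isOpen hV)) := finite_quotient hV

/-- The projection to the quotient by a closed submodule. -/
def quotπ (V : Submodule R B) (hV : IsClosed (V : Set B)) : B ⟶ B.quot V hV := ⟨V.mkQL⟩

lemma quotπ_eq_zero {V : Submodule R B} {hV : IsClosed (V : Set B)} (x : B) :
    (quotπ V hV).hom x = 0 ↔ x ∈ V := Submodule.Quotient.mk_eq_zero _

/-- A bijective morphism is an isomorphism. -/
lemma isIso_of_bijective {A B : ProfMod R} (f : A ⟶ B) (hf : Function.Bijective f.hom) :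
    IsIso f := by
  have := mono_of_injective f hf.1
  have := epi_of_surjective f hf.2
  exact isIso_of_mono_of_epi f

end ProfMod

/-! ### The universal property of profinite completion. -/

section universal

variable {Υ : Type u} [Group Υ]

/-- A neighbourhood involves finitely many levels; a single level refines them all, and there
approximation by `ℤ[Υ]` is possible. Density is what turns `ℤ[Υ]`-linearity plus continuity into
linearity over the completed ring. -/
lemma denseRange_toHat : DenseRange (toHat Υ) := by
  intro r
  refine mem_closure_iff_nhds.2 fun s hs => ?_
  obtain ⟨I, hI⟩ := mem_nhds_of_inducing_pi (A := Level) (π := fun x : RHat Υ => x.1)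
    IsInducing.subtypeVal hs
  have key : ∀ I : Finset (Index (Hat Υ)), ∃ k, ∀ i ∈ I, Refines k i := by
    classical
    intro I
    induction I using Finset.induction_on with
    | empty => exact ⟨(1, topONS), by simp⟩
    | insert i I _ ih =>
      obtain ⟨k, hk⟩ := ih
      obtain ⟨l, hl, hl'⟩ := exists_refinement Υ k i
      refine ⟨l, fun j hj => ?_⟩
      rcases Finset.mem_insert.1 hj with rfl | hj
      · exact hl'
      · exact ⟨(hk j hj).1.trans hl.1, hl.2.trans (hk j hj).2⟩
  obtain ⟨k, hk⟩ := key I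
  obtain ⟨a, ha⟩ := exists_approx Υ r k
  exact ⟨toHat Υ a, hI _ fun j hj => proj_eq_of_refines (hk j hj) ha, a, rfl⟩

variable {L M : ModuleCat.{u} (MonoidAlgebra ℤ Υ)} {L' M' : ProfMod (RHat Υ)}

/-- The underlying function of a homomorphism to a profinite module. -/
noncomputable def fn (u : L ⟶ resHat.obj L') : L → L' := fun x => u.hom x

lemma fn_add (u : L ⟶ resHat.obj L') (x y : L) : fn u (x + y) = fn u x + fn u y :=
  map_add u.hom x y

lemma fn_zero (u : L ⟶ resHat.obj L') : fn u 0 = 0 := map_zero u.hom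

lemma fn_smul (u : L ⟶ resHat.obj L') (a : MonoidAlgebra ℤ Υ) (x : L) :
    fn u (a • x) = toHat Υ a • fn u x := map_smul u.hom a x

lemma fn_ext {u v : L ⟶ resHat.obj L'} (h : ∀ x, fn u x = fn v x) : u = v := by
  ext x; exact h x

/-- The preimage of a submodule of a profinite module. -/
noncomputable def preim (u : L ⟶ resHat.obj L') (V : Submodule (RHat Υ) L') :
    Submodule (MonoidAlgebra ℤ Υ) L where
  carrier := {x | fn u x ∈ V}
  add_mem' hx hy := by
    change fn u _ ∈ V; rw [fn_add]; exact V.add_mem hx hy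
  zero_mem' := by change fn u _ ∈ V; rw [fn_zero]; exact V.zero_mem
  smul_mem' a x hx := by change fn u _ ∈ V; rw [fn_smul]; exact V.smul_mem _ hx

lemma finite_preim (u : L ⟶ resHat.obj L') {V : Submodule (RHat Υ) L'}
    (hV : IsOpen (V : Set L')) : Finite (L ⧸ preim u V) := by
  have := ProfMod.finite_quotient hV
  let φ : L →+ L' ⧸ V := V.mkQ.toAddMonoidHom.comp ⟨⟨fn u, fn_zero u⟩, fn_add u⟩
  have hφ : ∀ x, φ x = 0 ↔ x ∈ preim u V := fun x => Submodule.Quotient.mk_eq_zero V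
  refine Finite.of_injective (Quotient.lift φ fun a b hab => ?_) ?_
  · rw [← sub_eq_zero, ← map_sub, hφ]
    exact (Submodule.quotientRel_def _).1 hab
  · rintro ⟨a⟩ ⟨b⟩ hab
    refine (Submodule.Quotient.eq (preim u V)).2 ?_
    rw [← hφ, map_sub, sub_eq_zero]
    exact hab

/-- `u : L ⟶ L'` exhibits `L'` as the profinite completion of `L`: every homomorphism from `L` to a
profinite module factors uniquely through `u`. -/
def IsUniversal (u : L ⟶ resHat.obj L') : Prop :=
  ∀ (B : ProfMod (RHat Υ)) (f : L ⟶ resHat.obj B), ∃! g : L' ⟶ B, u ≫ resHat.map g = f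

lemma hom_ext_of_denseRange {u : L ⟶ resHat.obj L'} (hd : DenseRange (fn u)) {B : ProfMod (RHat Υ)}
    {g h : L' ⟶ B} (H : u ≫ resHat.map g = u ≫ resHat.map h) : g = h := by
  have := hd.equalizer g.hom.continuous h.hom.continuous
    (funext fun x => congrArg (fun k => fn k x) H)
  exact ProfMod.hom_ext' fun x => congrFun this x

/-- The required morphism is the one whose graph is the closure of all pairs `(u m, f m)`. It
remains to see that this closed submodule projects bijectively onto `L'`. -/
theorem IsUniversal.of_denseRange (u : L ⟶ resHat.obj L') (hd : DenseRange (fn u))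
    (h : ∀ N : Submodule (MonoidAlgebra ℤ Υ) L, Finite (L ⧸ N) →
      ∃ V : Submodule (RHat Υ) L', IsOpen (V : Set L') ∧ preim u V ≤ N) : IsUniversal u := by
  intro B f
  refine existsUnique_of_exists_of_unique ?_ fun g g' hg hg' =>
    hom_ext_of_denseRange hd (hg.trans hg'.symm)
  let S : Set (L' × B) := Set.range fun m => (fn u m, fn f m)
  let Γ : Submodule (RHat Υ) (L'.prod B) :=
    { carrier := closure S
      add_mem' := fun {x y} hx hy => map_mem_closure₂ continuous_add hx hy (by
        rintro _ ⟨a, rfl⟩ _ ⟨b, rfl⟩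
        exact ⟨a + b, Prod.ext (fn_add u a b) (fn_add f a b)⟩)
      zero_mem' := subset_closure ⟨0, Prod.ext (fn_zero u) (fn_zero f)⟩
      smul_mem' := fun r x hx => map_mem_closure₂ (continuous_smul (M := RHat Υ) (X := L' × B))
        (denseRange_toHat r) hx (by
        rintro _ ⟨a, rfl⟩ _ ⟨b, rfl⟩
        exact ⟨a • b, Prod.ext (fn_smul u a b) (fn_smul f a b)⟩) }
  let G : ProfMod (RHat Υ) := (L'.prod B).sub Γ isClosed_closure
  let p : G ⟶ L' := ⟨(ContinuousLinearMap.fst (RHat Υ) L' B).comp Γ.subtypeL⟩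
  let q : G ⟶ B := ⟨(ContinuousLinearMap.snd (RHat Υ) L' B).comp Γ.subtypeL⟩
  have hinj : Function.Injective p.hom := by
    refine (injective_iff_map_eq_zero p.hom).2 ?_
    rintro ⟨⟨x, b⟩, hxb⟩ hx
    obtain rfl : x = 0 := hx
    have hb : b = 0 := by
      refine B.eq_zero_of_forall_open fun V hV => ?_
      -- The preimage of `V` under `f` has finite index, so it contains the preimage of an open `W`.
      -- A graph point near `(0, b)` with first entry in `W` then has second entry in `V`, which
      -- puts `b` in `V`.
      obtain ⟨W, hW, hWV⟩ := h (preim f V) (finite_preim f hV)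
      have hc : Continuous fun y : L' × B => b - y.2 := continuous_const.sub continuous_snd
      obtain ⟨_, ⟨hm1, hm2⟩, m, rfl⟩ := mem_closure_iff.1 hxb
        ((Prod.fst ⁻¹' (W : Set L')) ∩ ((fun y : L' × B => b - y.2) ⁻¹' (V : Set B)))
        ((hW.preimage continuous_fst).inter (hV.preimage hc))
        ⟨W.zero_mem, by change b - b ∈ V; rw [sub_self]; exact V.zero_mem⟩
      have h1 : fn f m ∈ V := hWV hm1
      simpa using V.add_mem hm2 h1
    subst hb
    rfl
  have hsurj : Function.Surjective p.hom := by
    -- The image is compact, hence closed, and contains the dense range of `u`.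
    have hcl : IsClosed (Set.range p.hom) := (isCompact_range p.hom.continuous).isClosed
    have : closure (Set.range (fn u)) ⊆ Set.range p.hom :=
      closure_minimal (by
        rintro _ ⟨m, rfl⟩
        exact ⟨(⟨(fn u m, fn f m), subset_closure ⟨m, rfl⟩⟩ : Γ), rfl⟩) hcl
    exact fun x => this (hd x)
  have := ProfMod.isIso_of_bijective p ⟨hinj, hsurj⟩
  refine ⟨inv p ≫ q, fn_ext fun m => ?_⟩
  let γ : G := (⟨(fn u m, fn f m), subset_closure ⟨m, rfl⟩⟩ : Γ)
  have h1 : (inv p).hom (p.hom γ) = γ := by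
    rw [← ProfMod.comp_apply', IsIso.hom_inv_id]; rfl
  change q.hom ((inv p).hom (p.hom γ)) = _
  rw [h1]
  rfl

/-- The morphism out of the completion corresponding to a homomorphism. -/
noncomputable def IsUniversal.desc {u : L ⟶ resHat.obj L'} (hu : IsUniversal u)
    {B : ProfMod (RHat Υ)} (f : L ⟶ resHat.obj B) : L' ⟶ B := (hu B f).choose

lemma IsUniversal.fac {u : L ⟶ resHat.obj L'} (hu : IsUniversal u)
    {B : ProfMod (RHat Υ)} (f : L ⟶ resHat.obj B) : u ≫ resHat.map (hu.desc f) = f :=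
  (hu B f).choose_spec.1

lemma IsUniversal.hom_ext {u : L ⟶ resHat.obj L'} (hu : IsUniversal u)
    {B : ProfMod (RHat Υ)} {g h : L' ⟶ B} (H : u ≫ resHat.map g = u ≫ resHat.map h) : g = h :=
  (hu B _).unique H rfl

lemma denseRange_toCompletion (M : ModuleCat.{u} (MonoidAlgebra ℤ Υ)) :
    DenseRange (fn (toCompletion M)) := by
  intro x
  refine mem_closure_iff_nhds.2 fun s hs => ?_
  obtain ⟨I, hI⟩ := mem_nhds_of_inducing_pi (A := fun N : FinIndex (Υ := Υ) M => FinQuot N)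
    (π := fun x : completionSubmodule (Υ := Υ) M => x.1) IsInducing.subtypeVal hs
  have key : ∀ I : Finset (FinIndex (Υ := Υ) M), ∃ k : FinIndex (Υ := Υ) M,
      ∀ i ∈ I, k.1 ≤ i.1 := by
    classical
    intro I
    induction I using Finset.induction_on with
    | empty => exact ⟨⟨⊤, inferInstance⟩, by simp⟩
    | insert i I _ ih =>
      obtain ⟨k, hk⟩ := ih
      have h1 := k.2
      have h2 := i.2
      have : Finite (M ⧸ (k.1 ⊓ i.1)) := by
        refine Finite.of_injective
          (fun x => (Submodule.factor (inf_le_left : k.1 ⊓ i.1 ≤ k.1) x,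
            Submodule.factor (inf_le_right : k.1 ⊓ i.1 ≤ i.1) x)) ?_
        intro x y hxy
        obtain ⟨x, rfl⟩ := Submodule.mkQ_surjective _ x
        obtain ⟨y, rfl⟩ := Submodule.mkQ_surjective _ y
        have e1 := (Submodule.Quotient.eq k.1).1 (congrArg Prod.fst hxy)
        have e2 := (Submodule.Quotient.eq i.1).1 (congrArg Prod.snd hxy)
        exact (Submodule.Quotient.eq _).2 ⟨e1, e2⟩
      refine ⟨⟨k.1 ⊓ i.1, this⟩, fun j hj => ?_⟩
      rcases Finset.mem_insert.1 hj with rfl | hj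
      · exact inf_le_right
      · exact inf_le_left.trans (hk j hj)
  obtain ⟨k, hk⟩ := key I
  let x' : completionSubmodule (Υ := Υ) M := x
  obtain ⟨m, hm⟩ := Submodule.mkQ_surjective _ (x'.1 k)
  refine ⟨_, hI _ fun j hj => ?_, m, rfl⟩
  rw [← x'.2 k j (hk j hj), ← hm]
  rfl

theorem isUniversal_toCompletion (M : ModuleCat.{u} (MonoidAlgebra ℤ Υ)) :
    IsUniversal (toCompletion M) := by
  refine IsUniversal.of_denseRange _ (denseRange_toCompletion M) ?_
  · intro N hN
    let N' : FinIndex (Υ := Υ) M := ⟨N, hN⟩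
    refine ⟨LinearMap.ker ((LinearMap.proj (R := RHat Υ)
      (φ := fun N : FinIndex (Υ := Υ) M => FinQuot N) N').comp
      (completionSubmodule (Υ := Υ) M).subtype), ?_, ?_⟩
    · have : Continuous fun x : completionSubmodule (Υ := Υ) M => x.1 N' :=
        (continuous_apply N').comp continuous_subtype_val
      exact (isOpen_discrete ({0} : Set (FinQuot N'))).preimage this
    · intro x hx
      exact (Submodule.Quotient.mk_eq_zero N).1 hx

variable (Υ) in
/-- The canonical map `ℤ[Υ] → ℤ̂[[Υ̂]]` as a homomorphism of modules. -/
noncomputable def regularToHat :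
    ModuleCat.of (MonoidAlgebra ℤ Υ) (MonoidAlgebra ℤ Υ) ⟶ resHat.obj (regularHat (Hat Υ)) :=
  ModuleCat.ofHom (Y := resHat.obj (regularHat (Hat Υ)))
    { toFun := fun x : MonoidAlgebra ℤ Υ => (toHat Υ x : RHat Υ)
      map_add' := fun x y => map_add (toHat Υ) x y
      map_smul' := fun a x => map_mul (toHat Υ) a x }

/-- The action on a finite quotient `ℤ[Υ]/N` factors through some level. Applied to the class of
`1`, this shows that the kernel of the projection to that level meets `ℤ[Υ]` inside `N`. -/
theorem isUniversal_regularToHat : IsUniversal (regularToHat Υ) := by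
  refine IsUniversal.of_denseRange _ denseRange_toHat fun N hN => ?_
  obtain ⟨i, hi⟩ := exists_level (Υ := Υ) (MonoidAlgebra ℤ Υ ⧸ N)
  refine ⟨(RingHom.ker (proj i) : Submodule (RHat Υ) (RHat Υ)), ?_, fun a ha => ?_⟩
  · exact (isOpen_discrete ({0} : Set (Level i))).preimage (continuous_proj i)
  · have := hi a ha (N.mkQ 1)
    rw [← map_smul, smul_eq_mul, mul_one] at this
    exact (Submodule.Quotient.mk_eq_zero N).1 this

lemma finite_index_trivial {N : Submodule (MonoidAlgebra ℤ Υ) (trivialZ Υ)}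
    (hN : Finite (trivialZ Υ ⧸ N)) :
    ∃ n : ℕ+, ∀ x : ULift.{u} ℤ, ((n : ℕ) : ℤ) ∣ x.down → (x : trivialZ Υ) ∈ N := by
  refine ⟨⟨Nat.card (trivialZ Υ ⧸ N), Nat.card_pos⟩, ?_⟩
  rintro ⟨_⟩ ⟨k, rfl⟩
  let y : trivialZ Υ := (ULift.up k : ULift.{u} ℤ)
  have h1 : (Nat.card (trivialZ Υ ⧸ N)) • (N.mkQ y) = 0 := card_nsmul_eq_zero'
  rw [← map_nsmul] at h1
  have h2 := (Submodule.Quotient.mk_eq_zero N).1 h1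
  have e : (ULift.up ((Nat.card (trivialZ Υ ⧸ N) : ℤ) * k) : ULift.{u} ℤ) =
      Nat.card (trivialZ Υ ⧸ N) • (ULift.up k : ULift.{u} ℤ) :=
    ULift.ext _ _ (nsmul_eq_mul _ _).symm
  exact e ▸ h2

lemma ZHat.intCast_apply (k : ℤ) (n : ℕ+) : (k : ZHat).1 n = (k : ZMod n) :=
  map_intCast ((Pi.evalRingHom _ n).comp zhatCompatible.subtype) k

theorem isUniversal_trivialToHat : IsUniversal (trivialToHat Υ) := by
  have hind : IsInducing fun x : TrivialCarrier (Hat Υ) => x.down.1 :=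
    (IsInducing.subtypeVal (t := (zhatCompatible : Set (∀ n : ℕ+, ZMod n)))).comp
      (IsEmbedding.uliftDown (X := ZHat)).isInducing
  refine IsUniversal.of_denseRange _ (fun z => ?_) fun N hN => ?_
  · refine mem_closure_iff_nhds.2 fun s hs => ?_
    obtain ⟨I, hI⟩ := mem_nhds_of_inducing_pi hind hs
    let z' : TrivialCarrier (Hat Υ) := z
    -- Finitely many moduli are constrained, and the residue modulo their product determines all of
    -- them.
    obtain ⟨k, hk⟩ := ZMod.intCast_surjective (z'.down.1 (∏ i ∈ I, i))
    refine ⟨_, hI _ fun j hj => ?_, (ULift.up k : ULift.{u} ℤ), rfl⟩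
    have hd : (j : ℕ) ∣ ((∏ i ∈ I, i : ℕ+) : ℕ) := PNat.dvd_iff.1 (Finset.dvd_prod_of_mem _ hj)
    refine Eq.trans ?_ (z'.down.2 _ j hd)
    rw [← hk, map_intCast]
    exact ZHat.intCast_apply k j
  · obtain ⟨n, hn⟩ := finite_index_trivial hN
    have hc : Continuous fun x : TrivialCarrier (Hat Υ) => x.down.1 n :=
      (continuous_apply n).comp hind.continuous
    obtain ⟨V, hV, hVs⟩ := (trivialHat (Hat Υ)).exists_open_submodule
      (((isOpen_discrete ({0} : Set (ZMod n))).preimage hc).mem_nhds (x := 0) rfl)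
    refine ⟨V, hV, fun x hx => hn x ?_⟩
    have h1 : ((x : ULift.{u} ℤ).down : ZHat).1 n = 0 := hVs hx
    rw [ZHat.intCast_apply] at h1
    exact (ZMod.intCast_zmod_eq_zero_iff_dvd _ _).1 h1

end universal

variable {Υ : Type u} [Group Υ]

/-! ### Restriction maps on Ext and good modules. -/

section

variable {L M : ModuleCat.{u} (MonoidAlgebra ℤ Υ)} {L' M' : ProfMod (RHat Υ)}

/-- The comparison `Ext^n(L', B) → Ext^n(L, B)` along `u : L ⟶ L'`: apply the exact restriction
functor, then pull back along `u`. -/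
noncomputable def resExt (u : L ⟶ resHat.obj L') (B : ProfMod (RHat Υ)) (n : ℕ) :
    Ext.{u + 1} L' B n →+ Ext.{u} L (resHat.obj B) n :=
  ((Ext.mk₀ u).precomp (resHat.obj B) (zero_add n)).comp (resHat.mapExtAddHom L' B n)

lemma resExt_apply (u : L ⟶ resHat.obj L') (B : ProfMod (RHat Υ)) (n : ℕ) (z : Ext.{u + 1} L' B n) :
    resExt u B n z = (Ext.mk₀ u).comp (z.mapExactFunctor resHat) (zero_add n) := rfl

lemma resExt_mk₀ (u : L ⟶ resHat.obj L') {B : ProfMod (RHat Υ)} (g : L' ⟶ B) :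
    resExt u B 0 (Ext.mk₀ g) = Ext.mk₀ (u ≫ resHat.map g) := by
  rw [resExt_apply, Ext.mapExactFunctor_mk₀, Ext.mk₀_comp_mk₀]

lemma resExt_comp (u : L ⟶ resHat.obj L') {B C : ProfMod (RHat Υ)} {n m k : ℕ}
    (z : Ext.{u + 1} L' B n) (w : Ext.{u + 1} B C m) (h : n + m = k) :
    resExt u C k (z.comp w h) = (resExt u B n z).comp (w.mapExactFunctor resHat) h := by
  rw [resExt_apply, resExt_apply, Ext.mapExactFunctor_comp,
    Ext.comp_assoc _ _ _ (zero_add n) h (by lia)]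

/-- `u : L ⟶ L'` exhibits `L'` as the profinite completion of `L`, and restriction along `u` is an
isomorphism on `Ext` with finite coefficients. -/
structure IsGood (u : L ⟶ resHat.obj L') : Prop where
  universal : IsUniversal u
  bijective : ∀ A : ProfMod (RHat Υ), Finite A → ∀ n, Function.Bijective (resExt u A n)

/-- `resH` is by definition the function underlying `resExt (trivialToHat Υ)`, so the hypothesis is
literally the second field. -/
lemma isGood_trivialToHat (h : HasSeparableCohomology Υ) : IsGood (trivialToHat Υ) :=
  ⟨isUniversal_trivialToHat, h⟩

lemma IsUniversal.bijective_zero {u : L ⟶ resHat.obj L'} (hu : IsUniversal u)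
    (B : ProfMod (RHat Υ)) : Function.Bijective (resExt u B 0) := by
  constructor
  · intro x y hxy
    obtain ⟨f, rfl⟩ := (Ext.mk₀_bijective _ _).2 x
    obtain ⟨g, rfl⟩ := (Ext.mk₀_bijective _ _).2 y
    rw [resExt_mk₀, resExt_mk₀] at hxy
    rw [hu.hom_ext ((Ext.mk₀_bijective _ _).1 hxy)]
  · intro x
    obtain ⟨f, rfl⟩ := (Ext.mk₀_bijective _ _).2 x
    exact ⟨Ext.mk₀ (hu.desc f), by rw [resExt_mk₀, hu.fac]⟩

/-- Restriction preserves epimorphisms, so a lift exists on `L`; the universal property extends it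
to `L'` and shows that the extension is still a lift. -/
lemma IsUniversal.projective {u : L ⟶ resHat.obj L'} (hu : IsUniversal u) [Projective L] :
    Projective L' where
  factors {E X} f e _ := by
    refine ⟨hu.desc (Projective.factorThru (u ≫ resHat.map f) (resHat.map e)), hu.hom_ext ?_⟩
    rw [Functor.map_comp, ← Category.assoc, hu.fac, Projective.factorThru_comp]

lemma IsUniversal.of_isIso {L'' : ProfMod (RHat Υ)} {u : L ⟶ resHat.obj L'} (hu : IsUniversal u)
    (g : L' ⟶ L'') [IsIso g] {v : L ⟶ resHat.obj L''} (hv : u ≫ resHat.map g = v) :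
    IsUniversal v := by
  subst hv
  intro B f
  refine ⟨inv g ≫ hu.desc f, ?_, fun k hk => ?_⟩
  · change (u ≫ resHat.map g) ≫ resHat.map (inv g ≫ hu.desc f) = f
    rw [Category.assoc, ← Functor.map_comp, IsIso.hom_inv_id_assoc, hu.fac]
  · rw [← cancel_epi g, IsIso.hom_inv_id_assoc]
    refine hu.hom_ext ?_
    rw [hu.fac, Functor.map_comp, ← Category.assoc]
    exact hk

end

/-! ### Completion of projective presentations and dimension shifting. -/

section exactness

variable {K P L : ModuleCat.{u} (MonoidAlgebra ℤ Υ)} {K' P' L' : ProfMod (RHat Υ)}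
  {f : K ⟶ P} {g : P ⟶ L} {w : f ≫ g = 0} {f' : K' ⟶ P'} {g' : P' ⟶ L'}
  {u₁ : K ⟶ resHat.obj K'} {u₂ : P ⟶ resHat.obj P'} {u₃ : L ⟶ resHat.obj L'}

lemma exact_modules (hS : (ShortComplex.mk f g w).ShortExact) {x : P} (hx : g.hom x = 0) :
    ∃ y, f.hom y = x := (ShortComplex.moduleCat_exact_iff _).1 hS.exact x hx

lemma surjective_modules (hS : (ShortComplex.mk f g w).ShortExact) :
    Function.Surjective g.hom := (ModuleCat.epi_iff_surjective _).1 hS.epi_g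

lemma injective_modules (hS : (ShortComplex.mk f g w).ShortExact) :
    Function.Injective f.hom := (ModuleCat.mono_iff_injective _).1 hS.mono_f

/-- A homomorphism of modules vanishing on the kernel of a surjection factors. -/
lemma exists_desc_modules {A B C : ModuleCat.{u} (MonoidAlgebra ℤ Υ)} (p : A ⟶ B)
    (hp : Function.Surjective p.hom) (k : A ⟶ C) (h : ∀ x, p.hom x = 0 → k.hom x = 0) :
    ∃ l : B ⟶ C, p ≫ l = k := by
  choose s hs using hp
  have hk : ∀ a b, p.hom a = p.hom b → k.hom a = k.hom b := fun a b hab => by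
    rw [← sub_eq_zero, ← map_sub]
    exact h _ (by rw [map_sub, hab, sub_self])
  refine ⟨ModuleCat.ofHom ⟨⟨fun b => k.hom (s b), fun x y => ?_⟩, fun r x => ?_⟩, ?_⟩
  · rw [← map_add]; exact hk _ _ (by rw [hs, map_add, hs, hs])
  · rw [RingHom.id_apply, ← map_smul]; exact hk _ _ (by rw [hs, map_smul, hs])
  · ext x; exact hk _ _ (hs _)

/-- The middle term of an extension is a pushout of any presentation of the right end. -/
lemma exists_desc_of_presentation (hS : (ShortComplex.mk f g w).ShortExact)
    {M E C : ModuleCat.{u} (MonoidAlgebra ℤ Υ)} {i : M ⟶ E} {p : E ⟶ L} {w' : i ≫ p = 0}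
    (hT : (ShortComplex.mk i p w').ShortExact) (a : K ⟶ M) (b : P ⟶ E) (hab : f ≫ b = a ≫ i)
    (hb : b ≫ p = g) (l : M ⟶ C) (r : P ⟶ C) (hlr : f ≫ r = a ≫ l) :
    ∃ q : E ⟶ C, i ≫ q = l := by
  have hab' : ∀ κ, b.hom (f.hom κ) = i.hom (a.hom κ) := fun κ => ConcreteCategory.congr_hom hab κ
  have hb' : ∀ x, p.hom (b.hom x) = g.hom x := fun x => ConcreteCategory.congr_hom hb x
  have hlr' : ∀ κ, r.hom (f.hom κ) = l.hom (a.hom κ) := fun κ => ConcreteCategory.congr_hom hlr κ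
  -- The map `(m, y) ↦ i m + b y` is onto, and its kernel consists of the pairs `(-a κ, f κ)`. The
  -- map `(l, r)` vanishes on these, so it descends to `E`.
  let h : ModuleCat.of (MonoidAlgebra ℤ Υ) (M × P) ⟶ E := ModuleCat.ofHom (i.hom.coprod b.hom)
  let k : ModuleCat.of (MonoidAlgebra ℤ Υ) (M × P) ⟶ C := ModuleCat.ofHom (l.hom.coprod r.hom)
  obtain ⟨q, hq⟩ := exists_desc_modules h (fun x => by
      obtain ⟨y, hy⟩ := surjective_modules hS (p.hom x)
      obtain ⟨m, hm⟩ := exact_modules hT (x := x - b.hom y) (by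
        rw [map_sub, hb', hy, sub_self])
      exact ⟨(m, y), by
        change i.hom m + b.hom y = x
        rw [hm, sub_add_cancel]⟩) k (by
      rintro ⟨m, y⟩ hmy
      have hmy : i.hom m + b.hom y = 0 := hmy
      have hy : g.hom y = 0 := by
        have h0 : p.hom (i.hom m) = 0 := ConcreteCategory.congr_hom w' m
        have h1 := congrArg p.hom hmy
        rwa [map_add, h0, zero_add, hb', map_zero] at h1
      obtain ⟨κ, rfl⟩ := exact_modules hS hy
      have hm : m = - a.hom κ := by
        apply injective_modules hT
        rw [map_neg, ← hab']
        exact eq_neg_of_add_eq_zero_left hmy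
      change l.hom m + r.hom (f.hom κ) = 0
      rw [hm, map_neg, hlr', neg_add_cancel])
  refine ⟨q, ?_⟩
  ext m
  have := ConcreteCategory.congr_hom hq (m, 0)
  change q.hom (i.hom m + b.hom 0) = l.hom m + r.hom 0 at this
  rw [map_zero, map_zero, add_zero, add_zero] at this
  exact this

/-- The maps `u₁`, `u₂`, `u₃` form a morphism from the discrete sequence to the restriction of the
profinite one, and extension classes are natural for such morphisms. Hence restriction commutes with
the boundary maps. -/
lemma resExt_extClass_comp {w' : f' ≫ g' = 0} (hS : (ShortComplex.mk f g w).ShortExact)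
    (hS' : (ShortComplex.mk f' g' w').ShortExact)
    (hf : u₁ ≫ resHat.map f' = f ≫ u₂) (hg : u₂ ≫ resHat.map g' = g ≫ u₃)
    (B : ProfMod (RHat Υ)) {n m : ℕ} (z : Ext.{u + 1} K' B n) (h : 1 + n = m) :
    resExt u₃ B m (hS'.extClass.comp z h) = hS.extClass.comp (resExt u₁ B n z) h := by
  let φ : ShortComplex.mk f g w ⟶ (ShortComplex.mk f' g' w').map resHat :=
    { τ₁ := u₁, τ₂ := u₂, τ₃ := u₃, comm₁₂ := hf, comm₂₃ := hg }
  have key : hS.extClass.comp (Ext.mk₀ u₁) (add_zero 1) =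
      (Ext.mk₀ u₃).comp (hS'.extClass.mapExactFunctor resHat) (zero_add 1) := by
    rw [Ext.mapExactFunctor_extClass]
    exact ShortComplex.ShortExact.extClass_naturality hS (hS'.map_of_exact resHat) φ
  rw [resExt_comp, resExt_apply, resExt_apply, ← key]
  exact Ext.comp_assoc (a₁₂ := 1) hS.extClass _ _ (add_zero 1) (zero_add n) (by lia)

lemma surjective_of_universal (hS : (ShortComplex.mk f g w).ShortExact)
    (hg : u₂ ≫ resHat.map g' = g ≫ u₃) (h₃ : IsUniversal u₃) : Function.Surjective g'.hom := by
  have : Epi g' := by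
    refine Preadditive.epi_of_cancel_zero _ fun {B} k hk => h₃.hom_ext ?_
    have := hS.epi_g
    have : Epi g := this
    rw [← cancel_epi g, ← Category.assoc, ← Category.assoc, ← hg, Category.assoc,
      Category.assoc, ← Functor.map_comp, hk, ← Functor.map_comp, comp_zero]
  exact ProfMod.surjective_of_epi _

/-- Right exactness: the projection of `P'` to the cokernel of `f'` kills the image of `K`. It
therefore factors over `L`, then by universality over `L'`, and so it vanishes on the kernel of
`g'`. -/
lemma exact_of_universal (hS : (ShortComplex.mk f g w).ShortExact)
    (hf : u₁ ≫ resHat.map f' = f ≫ u₂) (hg : u₂ ≫ resHat.map g' = g ≫ u₃)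
    (h₂ : IsUniversal u₂) (h₃ : IsUniversal u₃) (x : P') (hx : g'.hom x = 0) :
    ∃ y, f'.hom y = x := by
  let π := ProfMod.cokerπ f'
  obtain ⟨l, hl⟩ := exists_desc_modules g (surjective_modules hS)
    (u₂ ≫ resHat.map π) (fun x hx => by
      obtain ⟨y, rfl⟩ := exact_modules hS hx
      have : fn u₂ (f.hom y) = f'.hom (fn u₁ y) := (congrArg (fun k => fn k y) hf).symm
      change π.hom (fn u₂ (f.hom y)) = 0
      rw [this]
      exact (ProfMod.cokerπ_eq_zero _ _).2 ⟨_, rfl⟩)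
  have : g' ≫ h₃.desc l = π := by
    refine h₂.hom_ext ?_
    rw [Functor.map_comp, ← Category.assoc, hg, Category.assoc, h₃.fac, hl]
  refine (ProfMod.cokerπ_eq_zero f' x).1 ?_
  change π.hom x = 0
  rw [← this, ProfMod.comp_apply', hx, map_zero]

lemma comp_eq_zero_of_universal (w : f ≫ g = 0)
    (hf : u₁ ≫ resHat.map f' = f ≫ u₂) (hg : u₂ ≫ resHat.map g' = g ≫ u₃)
    (h₁ : IsUniversal u₁) : f' ≫ g' = 0 := by
  refine h₁.hom_ext ?_
  rw [Functor.map_comp, ← Category.assoc, hf, Category.assoc, hg, ← Category.assoc, w, zero_comp,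
    Functor.map_zero, comp_zero]

/-- Completion is exact on a projective presentation of a good module. -/
theorem shortExact_of_projective (hS : (ShortComplex.mk f g w).ShortExact) [Projective P]
    (hf : u₁ ≫ resHat.map f' = f ≫ u₂) (hg : u₂ ≫ resHat.map g' = g ≫ u₃)
    (h₁ : IsUniversal u₁) (h₂ : IsUniversal u₂) (h₃ : IsGood u₃) :
    ∃ w' : f' ≫ g' = 0, (ShortComplex.mk f' g' w').ShortExact := by
  have hw := comp_eq_zero_of_universal w hf hg h₁
  refine ⟨hw, ProfMod.shortExact_of _ ?_ (exact_of_universal hS hf hg h₂ h₃.universal)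
    (surjective_of_universal hS hg h₃.universal)⟩
  -- Only injectivity of `f'` is left. The true kernel of `g'` gives a second exact sequence, to
  -- which `K'` maps by `c`; this sequence is available before `f'` is known to be injective.
  have hT : (ShortComplex.mk _ g' (ProfMod.kerι_comp g')).ShortExact :=
    ProfMod.shortExact_of _ (ProfMod.kerι_injective _)
    (fun b hb => ⟨(⟨b, hb⟩ : LinearMap.ker g'.hom.toLinearMap), rfl⟩)
    (surjective_of_universal hS hg h₃.universal)
  obtain ⟨c, hc⟩ := ProfMod.exists_lift (ProfMod.kerι g') (ProfMod.kerι_injective _) f'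
    (fun x => ⟨(⟨f'.hom x, (congrArg (fun k : K' ⟶ L' => k.hom x) hw :)⟩ :
      LinearMap.ker g'.hom.toLinearMap), rfl⟩)
  have := h₂.projective
  refine (injective_iff_map_eq_zero f'.hom).2 fun x hx => ?_
  refine K'.eq_zero_of_forall_open fun V hV => ?_
  let A := K'.quot V (ProfMod.isClosed_of_isOpen hV)
  let π : K' ⟶ A := ProfMod.quotπ V (ProfMod.isClosed_of_isOpen hV)
  have hA : Finite A := ProfMod.finite_quot hV
  let α : K ⟶ resHat.obj A := u₁ ≫ resHat.map π
  -- Goodness in degree one lifts the boundary of `α` to a class over `L'`. As `P'` is projective,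
  -- that class is itself the boundary of a morphism `k` from the kernel of `g'` to `A`.
  obtain ⟨z, hz⟩ := (h₃.bijective A hA 1).2 (hS.extClass.comp (Ext.mk₀ α) (add_zero 1))
  obtain ⟨k, rfl⟩ := Ext.contravariant_sequence_exact₃ hT A z
    (Ext.eq_zero_of_projective (P := P') _)
    (n₀ := 0) rfl
  obtain ⟨k, rfl⟩ := (Ext.mk₀_bijective _ _).2 k
  have e1 := resExt_extClass_comp (u₁ := u₁ ≫ resHat.map c) hS hT
    (by rw [Category.assoc, ← Functor.map_comp, hc, hf]) hg A (Ext.mk₀ k) (add_zero 1)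
  rw [resExt_mk₀] at e1
  -- The homomorphism `α` and the restriction of `k` have the same boundary, so their difference
  -- extends to `P`.
  have e2 : hS.extClass.comp (Ext.mk₀ (α - (u₁ ≫ resHat.map c) ≫ resHat.map k))
      (add_zero 1) = 0 := by
    rw [sub_eq_add_neg, Ext.mk₀_add, Ext.mk₀_neg, Ext.comp_add, Ext.comp_neg, ← e1, ← hz]
    exact add_neg_cancel _
  obtain ⟨y, hy⟩ := Ext.contravariant_sequence_exact₁ hS _ _ (add_zero 1) e2
  obtain ⟨y, rfl⟩ := (Ext.mk₀_bijective _ _).2 y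
  rw [Ext.mk₀_comp_mk₀] at hy
  have hy : f ≫ y = α - (u₁ ≫ resHat.map c) ≫ resHat.map k := (Ext.mk₀_bijective _ _).1 hy
  -- After completion, `π` is a sum of two terms, one factoring through `c` and one through `f'`.
  -- Both vanish at `x`, since `f' x = 0` forces `c x = 0`.
  have e3 : π = c ≫ k + f' ≫ h₂.desc y := by
    refine h₁.hom_ext ?_
    rw [Functor.map_add, Preadditive.comp_add, Functor.map_comp, Functor.map_comp,
      ← Category.assoc _ _ (resHat.map (h₂.desc y)), hf, Category.assoc, h₂.fac, hy,
      Category.assoc, add_sub_cancel]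
  have hcx : c.hom x = 0 := by
    apply ProfMod.kerι_injective g'
    rw [← ProfMod.comp_apply', hc, hx, map_zero]
  refine (ProfMod.quotπ_eq_zero (hV := ProfMod.isClosed_of_isOpen hV) x).1 ?_
  change π.hom x = 0
  rw [e3, ProfMod.add_hom]
  change k.hom (c.hom x) + (h₂.desc y).hom (f'.hom x) = 0
  rw [hcx, hx, map_zero, map_zero, add_zero]

/-- Dimension shifting: the kernel of a projective presentation of a good module is good. -/
theorem IsGood.kernel {w' : f' ≫ g' = 0} (hS : (ShortComplex.mk f g w).ShortExact)
    (hS' : (ShortComplex.mk f' g' w').ShortExact) [Projective P] [Projective P']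
    (hf : u₁ ≫ resHat.map f' = f ≫ u₂) (hg : u₂ ≫ resHat.map g' = g ≫ u₃)
    (h₁ : IsUniversal u₁) (h₃ : IsGood u₃) : IsGood u₁ := by
  refine ⟨h₁, fun A hA n => ?_⟩
  -- Degree zero is the universal property. Above it both boundary maps are isomorphisms because `P`
  -- and `P'` are projective, which moves the claim to degree `n + 2` for the right end.
  rcases n with _ | n
  · exact h₁.bijective_zero A
  have hb := h₃.bijective A hA (n + 2)
  have key := fun z => resExt_extClass_comp hS hS' hf hg A (n := n + 1) z
    (by lia : 1 + (n + 1) = n + 2)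
  constructor
  · refine (injective_iff_map_eq_zero _).2 fun z hz => ?_
    have e : hS'.extClass.comp z (by lia : 1 + (n + 1) = n + 2) = 0 := by
      apply hb.1
      rw [key, hz, Ext.comp_zero, map_zero]
    obtain ⟨y, rfl⟩ := Ext.contravariant_sequence_exact₁ hS' _ _ _ e
    rw [Ext.eq_zero_of_projective (P := P') y, Ext.comp_zero]
  · intro y
    obtain ⟨z, hz⟩ := hb.2 (hS.extClass.comp y (by lia : 1 + (n + 1) = n + 2))
    obtain ⟨z, rfl⟩ := Ext.contravariant_sequence_exact₃ hS' A z
      (Ext.eq_zero_of_projective (P := P') _) (n₀ := n + 1) (by lia)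
    refine ⟨z, ?_⟩
    rw [key, ← sub_eq_zero, sub_eq_add_neg, ← Ext.comp_neg, ← Ext.comp_add] at hz
    obtain ⟨x, hx⟩ := Ext.contravariant_sequence_exact₁ hS _ _ _ hz
    rw [Ext.eq_zero_of_projective (P := P) x, Ext.comp_zero] at hx
    rw [← sub_eq_zero, sub_eq_add_neg, ← hx]

end exactness

/-! ### Completion of arbitrary extensions of a good module. -/

section presentation

variable {L : ModuleCat.{u} (MonoidAlgebra ℤ Υ)} {L' : ProfMod (RHat Υ)}

/-- The kernel of the chosen projective presentation of a module. -/
noncomputable abbrev syz (L : ModuleCat.{u} (MonoidAlgebra ℤ Υ)) :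
    ModuleCat.{u} (MonoidAlgebra ℤ Υ) := kernel (Projective.π L)

lemma pres_shortExact (L : ModuleCat.{u} (MonoidAlgebra ℤ Υ)) :
    (ShortComplex.mk (kernel.ι (Projective.π L)) (Projective.π L)
      (kernel.condition _)).ShortExact where
  mono_f := by dsimp only; infer_instance
  epi_g := by dsimp only; infer_instance
  exact := ShortComplex.exact_of_f_is_kernel _ (kernelIsKernel _)

/-- The projection in the completion of the chosen projective presentation. -/
noncomputable def presHatπ (u : L ⟶ resHat.obj L') : completion (Projective.over L) ⟶ L' :=
  (isUniversal_toCompletion (Projective.over L)).desc (Projective.π L ≫ u)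

lemma presHatπ_fac (u : L ⟶ resHat.obj L') :
    toCompletion (Projective.over L) ≫ resHat.map (presHatπ u) = Projective.π L ≫ u :=
  IsUniversal.fac _ _

lemma presHat_zero (u : L ⟶ resHat.obj L') :
    completionMap (kernel.ι (Projective.π L)) ≫ presHatπ u = 0 :=
  comp_eq_zero_of_universal (kernel.condition _) (completionMap_toCompletion _) (presHatπ_fac u)
    (isUniversal_toCompletion _)

lemma presHat_shortExact {u : L ⟶ resHat.obj L'} (hu : IsGood u) :
    (ShortComplex.mk _ _ (presHat_zero u)).ShortExact :=
  (shortExact_of_projective (pres_shortExact L) (completionMap_toCompletion _) (presHatπ_fac u)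
    (isUniversal_toCompletion _) (isUniversal_toCompletion _) hu).2

instance (P : ModuleCat.{u} (MonoidAlgebra ℤ Υ)) [Projective P] : Projective (completion P) :=
  (isUniversal_toCompletion P).projective

lemma isGood_syz {u : L ⟶ resHat.obj L'} (hu : IsGood u) : IsGood (toCompletion (syz L)) :=
  IsGood.kernel (pres_shortExact L) (presHat_shortExact hu) (completionMap_toCompletion _)
    (presHatπ_fac u) (isUniversal_toCompletion _) hu

/-- The chosen presentation of the right end of a short exact sequence maps to it. -/
lemma exists_pres_map {M E : ModuleCat.{u} (MonoidAlgebra ℤ Υ)} {i : M ⟶ E} {p : E ⟶ L}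
    {w : i ≫ p = 0} (hS : (ShortComplex.mk i p w).ShortExact) :
    ∃ (a : syz L ⟶ M) (b : Projective.over L ⟶ E),
      kernel.ι (Projective.π L) ≫ b = a ≫ i ∧ b ≫ p = Projective.π L := by
  have : Epi p := hS.epi_g
  have : Mono i := hS.mono_f
  have hl : Projective.factorThru (Projective.π L) p ≫ p = Projective.π L :=
    Projective.factorThru_comp _ _
  exact ⟨hS.exact.lift (kernel.ι (Projective.π L) ≫ Projective.factorThru (Projective.π L) p)
    (by dsimp only; rw [Category.assoc, hl, kernel.condition]), _, (hS.exact.lift_f _ _).symm, hl⟩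

/-- In an abelian category monomorphisms are stable under pushout. This produces a target detecting
the injectivity of `M' → E'`. -/
lemma exists_mono_square {A B C : ProfMod (RHat Υ)} (a : A ⟶ B) (f : A ⟶ C) [Mono f] :
    ∃ (Q : ProfMod (RHat Υ)) (l : B ⟶ Q) (r : C ⟶ Q), a ≫ l = f ≫ r ∧ Mono l :=
  ⟨pushout a f, pushout.inl a f, pushout.inr a f, pushout.condition, inferInstance⟩

/-- Completion is exact on extensions of a good module. -/
theorem shortExact_of_isGood {M E : ModuleCat.{u} (MonoidAlgebra ℤ Υ)} {M' E' : ProfMod (RHat Υ)}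
    {i : M ⟶ E} {p : E ⟶ L} {w : i ≫ p = 0} (hS : (ShortComplex.mk i p w).ShortExact)
    {i' : M' ⟶ E'} {p' : E' ⟶ L'} {u₁ : M ⟶ resHat.obj M'} {u₂ : E ⟶ resHat.obj E'}
    {u₃ : L ⟶ resHat.obj L'} (hf : u₁ ≫ resHat.map i' = i ≫ u₂)
    (hg : u₂ ≫ resHat.map p' = p ≫ u₃)
    (h₁ : IsUniversal u₁) (h₂ : IsUniversal u₂) (h₃ : IsGood u₃) :
    ∃ w' : i' ≫ p' = 0, (ShortComplex.mk i' p' w').ShortExact := by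
  refine ⟨comp_eq_zero_of_universal w hf hg h₁, ProfMod.shortExact_of _ ?_
    (exact_of_universal hS hf hg h₂ h₃.universal) (surjective_of_universal hS hg h₃.universal)⟩
  obtain ⟨a, b, hab, hb⟩ := exists_pres_map hS
  have hmono : Mono (completionMap (kernel.ι (Projective.π L))) := (presHat_shortExact h₃).mono_f
  -- `Q` is the pushout of `M'` and the completed presentation over the completed syzygy. It
  -- contains `M'`, since completion is already known to be exact on the presentation.
  obtain ⟨Q, l, r, hlr, hl⟩ := exists_mono_square
    ((isUniversal_toCompletion (syz L)).desc (a ≫ u₁)) (completionMap (kernel.ι (Projective.π L)))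
  have hlr' : kernel.ι (Projective.π L) ≫ toCompletion (Projective.over L) ≫ resHat.map r =
      a ≫ u₁ ≫ resHat.map l := by
    have := congrArg (fun k => toCompletion (syz L) ≫ resHat.map k) hlr
    simp only [Functor.map_comp, ← Category.assoc] at this
    rw [IsUniversal.fac, completionMap_toCompletion] at this
    simpa only [Category.assoc] using this.symm
  -- Before completion `E` is the corresponding pushout, hence maps to `Q` compatibly with `M`. So
  -- the monomorphism `M' → Q` factors through `E'`.
  obtain ⟨q, hq⟩ := exists_desc_of_presentation (pres_shortExact L) hS a b hab hb _ _ hlr'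
  have hfq : i' ≫ h₂.desc q = l := by
    refine h₁.hom_ext ?_
    rw [Functor.map_comp, ← Category.assoc, hf, Category.assoc, h₂.fac, hq]
  have : Mono (i' ≫ h₂.desc q) := hfq ▸ hl
  have := mono_of_mono i' (h₂.desc q)
  exact ProfMod.injective_of_mono _

end presentation

variable {Υ : Type u} [Group Υ]

/-! ### Construction of the maps on Ext. -/

section lift

/-- A family of homomorphisms `Ext^n(L, M) → Ext^n(L', M̂)`, natural in `M`, which lifts the map
induced by `M → M̂` along the comparison map of `u : L ⟶ L'`. -/
structure IsExtLift {L : ModuleCat.{u} (MonoidAlgebra ℤ Υ)} {L' : ProfMod (RHat Υ)}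
    (u : L ⟶ resHat.obj L') (n : ℕ)
    (j : ∀ M : ModuleCat.{u} (MonoidAlgebra ℤ Υ),
      Ext.{u} L M n →+ Ext.{u + 1} L' (completion M) n) : Prop where
  res : ∀ M z, resExt u (completion M) n (j M z) = z.comp (Ext.mk₀ (toCompletion M)) (add_zero n)
  naturality : ∀ (M M' : ModuleCat.{u} (MonoidAlgebra ℤ Υ)) (φ : M ⟶ M') (z : Ext.{u} L M n),
    j M' (z.comp (Ext.mk₀ φ) (add_zero n)) =
      (j M z).comp (Ext.mk₀ (completionMap φ)) (add_zero n)

variable {K P L : ModuleCat.{u} (MonoidAlgebra ℤ Υ)} {K' P' L' : ProfMod (RHat Υ)}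
  {f : K ⟶ P} {g : P ⟶ L} {w : f ≫ g = 0} {f' : K' ⟶ P'} {g' : P' ⟶ L'} {w' : f' ≫ g' = 0}
  {u₁ : K ⟶ resHat.obj K'} {u₂ : P ⟶ resHat.obj P'} {u₃ : L ⟶ resHat.obj L'}

lemma exists_extLift_zero {u : L ⟶ resHat.obj L'} (hu : IsUniversal u) :
    ∃ j, IsExtLift u 0 j ∧ ∀ (M : ModuleCat.{u} (MonoidAlgebra ℤ Υ)) (f : L ⟶ M),
      j M (Ext.mk₀ f) = Ext.mk₀ (hu.desc (f ≫ toCompletion M)) := by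
  let j (M : ModuleCat.{u} (MonoidAlgebra ℤ Υ)) :
      Ext.{u} L M 0 →+ Ext.{u + 1} L' (completion M) 0 :=
    (Ext.addEquiv₀.symm.toAddMonoidHom.comp
      (AddMonoidHom.mk' (fun f : L ⟶ M => hu.desc (f ≫ toCompletion M)) fun f f' => hu.hom_ext (by
        rw [Functor.map_add, Preadditive.comp_add, hu.fac, hu.fac, hu.fac,
          Preadditive.add_comp]))).comp Ext.addEquiv₀.toAddMonoidHom
  have hj : ∀ (M : ModuleCat.{u} (MonoidAlgebra ℤ Υ)) (f : L ⟶ M),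
      j M (Ext.mk₀ f) = Ext.mk₀ (hu.desc (f ≫ toCompletion M)) := fun M f => by
    change Ext.mk₀ (hu.desc (Ext.addEquiv₀ (Ext.mk₀ f) ≫ toCompletion M)) = _
    congr 3
    exact Ext.addEquiv₀.apply_symm_apply f
  refine ⟨j, ⟨fun M z => ?_, fun M M' φ z => ?_⟩, hj⟩
  · obtain ⟨f, rfl⟩ := (Ext.mk₀_bijective _ _).2 z
    rw [hj, resExt_mk₀, hu.fac, Ext.mk₀_comp_mk₀]
  · obtain ⟨f, rfl⟩ := (Ext.mk₀_bijective _ _).2 z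
    rw [Ext.mk₀_comp_mk₀, hj, hj, Ext.mk₀_comp_mk₀]
    congr 1
    refine hu.hom_ext ?_
    rw [hu.fac, Functor.map_comp, ← Category.assoc, hu.fac, Category.assoc, Category.assoc,
      completionMap_toCompletion]

/-- The boundary map kills what it has to, in degree zero. -/
lemma boundary_zero_of_boundary_zero (hS : (ShortComplex.mk f g w).ShortExact)
    (hS' : (ShortComplex.mk f' g' w').ShortExact)
    (hf : u₁ ≫ resHat.map f' = f ≫ u₂) (h₁ : IsUniversal u₁) (h₂ : IsUniversal u₂)
    (M : ModuleCat.{u} (MonoidAlgebra ℤ Υ)) (k : K ⟶ M)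
    (h : hS.extClass.comp (Ext.mk₀ k) (add_zero 1) = 0) :
    hS'.extClass.comp (Ext.mk₀ (h₁.desc (k ≫ toCompletion M))) (add_zero 1) = 0 := by
  obtain ⟨y, hy⟩ := Ext.contravariant_sequence_exact₁ hS _ _ (add_zero 1) h
  obtain ⟨y, rfl⟩ := (Ext.mk₀_bijective _ _).2 y
  rw [Ext.mk₀_comp_mk₀] at hy
  have hy : f ≫ y = k := (Ext.mk₀_bijective _ _).1 hy
  have : h₁.desc (k ≫ toCompletion M) = f' ≫ h₂.desc (y ≫ toCompletion M) := by
    refine h₁.hom_ext ?_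
    rw [h₁.fac, Functor.map_comp, ← Category.assoc, hf, Category.assoc, h₂.fac, ← hy,
      Category.assoc]
  rw [this, ← Ext.mk₀_comp_mk₀]
  exact hS'.extClass_comp_assoc (Ext.mk₀ (h₂.desc (y ≫ toCompletion M))) (h := add_zero 1)

lemma boundary_surjective {C : Type*} [Category* C] [Abelian C] [HasExt.{u} C] {A B D : C}
    {f : A ⟶ B} {g : B ⟶ D} {w : f ≫ g = 0} (hS : (ShortComplex.mk f g w).ShortExact)
    [Projective B] (Y : C) (n : ℕ) :
    Function.Surjective (hS.extClass.precomp Y (add_comm 1 n)) := fun z =>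
  Ext.contravariant_sequence_exact₃ hS Y z (Ext.eq_zero_of_projective (P := B) _) (add_comm 1 n)

lemma boundary_injective {C : Type*} [Category* C] [Abelian C] [HasExt.{u} C] {A B D : C}
    {f : A ⟶ B} {g : B ⟶ D} {w : f ≫ g = 0} (hS : (ShortComplex.mk f g w).ShortExact)
    [Projective B] (Y : C) (n : ℕ) :
    Function.Injective (hS.extClass.precomp Y (add_comm 1 (n + 1))) := by
  refine (injective_iff_map_eq_zero _).2 fun z hz => ?_
  obtain ⟨y, rfl⟩ := Ext.contravariant_sequence_exact₁ hS Y z (add_comm 1 (n + 1)) hz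
  rw [Ext.eq_zero_of_projective (P := B) y, Ext.comp_zero]

/-- Projectivity of `P` makes the boundary map surjective, so compatibility with boundaries dictates
the new map. The condition `hv` makes it well defined. It is checked by hand in degree zero and is
automatic above, where the boundary is injective. -/
lemma exists_extLift_succ (hS : (ShortComplex.mk f g w).ShortExact)
    (hS' : (ShortComplex.mk f' g' w').ShortExact) [Projective P]
    (hf : u₁ ≫ resHat.map f' = f ≫ u₂) (hg : u₂ ≫ resHat.map g' = g ≫ u₃) {n : ℕ}
    {j : ∀ M : ModuleCat.{u} (MonoidAlgebra ℤ Υ), Ext.{u} K M n →+ Ext.{u + 1} K' (completion M) n}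
    (hj : IsExtLift u₁ n j)
    (hv : ∀ M z, hS.extClass.comp z (add_comm 1 n) = 0 →
      hS'.extClass.comp (j M z) (add_comm 1 n) = 0) :
    ∃ j', IsExtLift u₃ (n + 1) j' ∧ ∀ M z, j' M (hS.extClass.comp z (add_comm 1 n)) =
      hS'.extClass.comp (j M z) (add_comm 1 n) := by
  let δ M := hS.extClass.precomp M (add_comm 1 n)
  let δ' M := hS'.extClass.precomp (completion M) (add_comm 1 n)
  have hδ : ∀ M, Function.Surjective (δ M) := fun M => boundary_surjective hS M n
  let j' M := AddMonoidHom.liftOfSurjective (δ M) (hδ M) ⟨(δ' M).comp (j M), fun z hz => hv M z hz⟩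
  have hj' : ∀ M z, j' M (hS.extClass.comp z (add_comm 1 n)) =
      hS'.extClass.comp (j M z) (add_comm 1 n) := fun M z =>
    AddMonoidHom.liftOfRightInverse_comp_apply (δ M) _ _
      ⟨(δ' M).comp (j M), fun z hz => hv M z hz⟩ z
  refine ⟨j', ⟨fun M z => ?_, fun M M' φ z => ?_⟩, hj'⟩
  · obtain ⟨y, rfl⟩ := hδ M z
    change resExt u₃ _ _ (j' M (hS.extClass.comp y (add_comm 1 n))) =
      (hS.extClass.comp y (add_comm 1 n)).comp _ _
    rw [hj', resExt_extClass_comp hS hS' hf hg, hj.res]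
    exact (Ext.comp_assoc _ _ _ (add_comm 1 n) (add_zero n) (by lia)).symm
  · obtain ⟨y, rfl⟩ := hδ M z
    change j' M' ((hS.extClass.comp y (add_comm 1 n)).comp _ _) =
      (j' M (hS.extClass.comp y (add_comm 1 n))).comp _ _
    rw [hj', Ext.comp_assoc _ _ _ (add_comm 1 n) (add_zero n) (by lia), hj', hj.naturality]
    exact (Ext.comp_assoc _ _ _ (add_comm 1 n) (add_zero n) (by lia)).symm

/-- Every extension of `L` by `M` is the pushout of the presentation of `L` along some `a : syz L ⟶
M`, so its class is the boundary of `a`. The completed extension is likewise the pushout along the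
completion of `a`, which is the degree-zero value of the lift at `a`. -/
lemma exists_extLift_one {u : L ⟶ resHat.obj L'} (hu : IsGood u) :
    ∃ j, IsExtLift u 1 j ∧ ∀ (M E : ModuleCat.{u} (MonoidAlgebra ℤ Υ)) (E' : ProfMod (RHat Υ))
      (i : M ⟶ E) (p : E ⟶ L) (w : i ≫ p = 0) (i' : completion M ⟶ E') (p' : E' ⟶ L')
      (w' : i' ≫ p' = 0) (hS : (ShortComplex.mk i p w).ShortExact)
      (hS' : (ShortComplex.mk i' p' w').ShortExact) (v : E ⟶ resHat.obj E'),
      toCompletion M ≫ resHat.map i' = i ≫ v → v ≫ resHat.map p' = p ≫ u →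
      j M hS.extClass = hS'.extClass := by
  have hK := isUniversal_toCompletion (syz L)
  have hP := isUniversal_toCompletion (Projective.over L)
  obtain ⟨j, hj, hj0⟩ := exists_extLift_zero hK
  have hT := pres_shortExact L
  have hT' := presHat_shortExact hu
  obtain ⟨j', hj', hjj'⟩ := exists_extLift_succ hT hT' (completionMap_toCompletion _)
    (presHatπ_fac u) hj (fun M z hz => by
      obtain ⟨k, rfl⟩ := (Ext.mk₀_bijective _ _).2 z
      rw [hj0]
      exact boundary_zero_of_boundary_zero hT hT' (completionMap_toCompletion _) hK hP M k hz)
  refine ⟨j', hj', fun M E E' i p w i' p' w' hS hS' v hi hp => ?_⟩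
  obtain ⟨a, b, hab, hb⟩ := exists_pres_map hS
  have e1 : hT.extClass.comp (Ext.mk₀ a) (add_zero 1) = hS.extClass := by
    let φ : ShortComplex.mk _ _ (kernel.condition (Projective.π L)) ⟶ ShortComplex.mk i p w :=
      { τ₁ := a, τ₂ := b, τ₃ := 𝟙 L, comm₁₂ := hab.symm
        comm₂₃ := hb.trans (Category.comp_id _).symm }
    exact (ShortComplex.ShortExact.extClass_naturality hT hS φ).trans (Ext.mk₀_id_comp _)
  have e2 : hT'.extClass.comp (Ext.mk₀ (hK.desc (a ≫ toCompletion M))) (add_zero 1) =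
      hS'.extClass := by
    let φ : ShortComplex.mk _ _ (presHat_zero u) ⟶ ShortComplex.mk i' p' w' :=
      { τ₁ := hK.desc (a ≫ toCompletion M), τ₂ := hP.desc (b ≫ v), τ₃ := 𝟙 L'
        comm₁₂ := hK.hom_ext (by
          dsimp only
          rw [Functor.map_comp, ← Category.assoc, hK.fac, Category.assoc, hi, Functor.map_comp,
            ← Category.assoc (toCompletion _), completionMap_toCompletion, Category.assoc, hP.fac,
            ← Category.assoc, ← Category.assoc, hab])
        comm₂₃ := hP.hom_ext (by
          dsimp only
          rw [Functor.map_comp, ← Category.assoc, hP.fac, Category.assoc, hp, ← Category.assoc, hb,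
            Category.comp_id, presHatπ_fac]) }
    exact (ShortComplex.ShortExact.extClass_naturality hT' hS' φ).trans (Ext.mk₀_id_comp _)
  rw [← e1, ← e2, hjj' M (Ext.mk₀ a), hj0]

/-- The induction passes from `L` to its syzygy, which is again good; this is why `L`, `L'` and `u`
are quantified after `n`. -/
lemma exists_extLift (n : ℕ) : ∀ {L : ModuleCat.{u} (MonoidAlgebra ℤ Υ)} {L' : ProfMod (RHat Υ)}
    {u : L ⟶ resHat.obj L'}, IsGood u → ∃ j, IsExtLift u (n + 1) j := by
  induction n with
  | zero => exact fun hu => (exists_extLift_one hu).imp fun _ => And.left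
  | succ n ih =>
    intro L L' u hu
    obtain ⟨j, hj⟩ := ih (isGood_syz hu)
    obtain ⟨j', hj', -⟩ := exists_extLift_succ (pres_shortExact L) (presHat_shortExact hu)
      (completionMap_toCompletion _) (presHatπ_fac u) hj (fun M z hz => by
        rw [(injective_iff_map_eq_zero _).1 (boundary_injective (pres_shortExact L) M n) z hz,
          map_zero, Ext.comp_zero])
    exact ⟨j', hj'⟩

end lift

/-! ### The augmentation sequences. -/

section augmentation

variable (Υ)

/-- The inclusion of the augmentation ideal. -/
noncomputable def augι : augIdeal Υ ⟶ ModuleCat.of (MonoidAlgebra ℤ Υ) (MonoidAlgebra ℤ Υ) :=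
  (augSeq Υ).f

lemma augι_augHom : augι Υ ≫ augHom Υ = 0 := (augSeq Υ).zero

lemma aug_shortExact : (ShortComplex.mk (augι Υ) (augHom Υ) (augι_augHom Υ)).ShortExact :=
  augSeq_shortExact Υ

/-- The inclusion of the augmentation ideal of the completed group ring. -/
noncomputable def augHatι : augIdealHat (Hat Υ) ⟶ regularHat (Hat Υ) := (augSeqHat (Hat Υ)).f

lemma augHatι_augHatHom : augHatι Υ ≫ augHatHom (Hat Υ) = 0 := (augSeqHat (Hat Υ)).zero

lemma augHat_shortExact :
    (ShortComplex.mk (augHatι Υ) (augHatHom (Hat Υ)) (augHatι_augHatHom Υ)).ShortExact :=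
  augSeqHat_shortExact (Hat Υ)

lemma augIdealToHat_augHatι :
    augIdealToHat Υ ≫ resHat.map (augHatι Υ) = augι Υ ≫ regularToHat Υ := rfl

lemma regularToHat_augHatHom :
    regularToHat Υ ≫ resHat.map (augHatHom (Hat Υ)) = augHom Υ ≫ trivialToHat Υ := by
  refine fn_ext fun x => congrArg ULift.up ?_
  exact aug_toHat Υ x

instance : Projective (ModuleCat.of (MonoidAlgebra ℤ Υ) (MonoidAlgebra ℤ Υ)) :=
  ModuleCat.projective_of_free (Module.Basis.singleton PUnit.{1} (MonoidAlgebra ℤ Υ))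

instance : Projective (regularHat (Hat Υ)) := isUniversal_regularToHat.projective

variable {Υ}

/-- Since `ℤ → ℤ̂` is good, completing the augmentation sequence keeps it exact. The completion of
`I_Υ` and `I_Υ̂` are thus both the kernel of `ℤ̂[[Υ̂]] → ℤ̂`. -/
lemma isIso_desc_augIdealToHat (h : HasSeparableCohomology Υ) :
    IsIso ((isUniversal_toCompletion (augIdeal Υ)).desc (augIdealToHat Υ)) := by
  have hI := isUniversal_toCompletion (augIdeal Υ)
  obtain ⟨w, hw⟩ := shortExact_of_projective (aug_shortExact Υ)
    (f' := hI.desc (augι Υ ≫ regularToHat Υ)) (hI.fac _) (regularToHat_augHatHom Υ) hI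
    isUniversal_regularToHat (isGood_trivialToHat h)
  have hd : hI.desc (augIdealToHat Υ) ≫ augHatι Υ = hI.desc (augι Υ ≫ regularToHat Υ) := by
    refine hI.hom_ext ?_
    rw [Functor.map_comp, ← Category.assoc, hI.fac, hI.fac, augIdealToHat_augHatι]
  have hinj : Function.Injective (augHatι Υ).hom := Subtype.val_injective
  have := hw.mono_f
  refine ProfMod.isIso_of_bijective _ ⟨fun x y hxy => ?_, fun x => ?_⟩
  · refine ProfMod.injective_of_mono (hI.desc (augι Υ ≫ regularToHat Υ)) ?_
    rw [← hd, ProfMod.comp_apply', ProfMod.comp_apply', hxy]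
  · obtain ⟨y, hy⟩ := ProfMod.ker_le_of_exact hw ((augHatι Υ).hom x)
      (congrArg (fun k : augIdealHat (Hat Υ) ⟶ trivialHat (Hat Υ) => k.hom x)
        (augHatι_augHatHom Υ) :)
    refine ⟨y, hinj ?_⟩
    rw [← hy, ← ProfMod.comp_apply', hd]

lemma isGood_augIdealToHat (h : HasSeparableCohomology Υ) : IsGood (augIdealToHat Υ) := by
  have := isIso_desc_augIdealToHat h
  exact IsGood.kernel (aug_shortExact Υ) (augHat_shortExact Υ) (augIdealToHat_augHatι Υ)
    (regularToHat_augHatHom Υ)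
    ((isUniversal_toCompletion (augIdeal Υ)).of_isIso _ (IsUniversal.fac _ _))
    (isGood_trivialToHat h)

theorem exists_lifts (h : HasSeparableCohomology Υ) :
    ∃ (j₁ : ∀ n (M : ModuleCat.{u} (MonoidAlgebra ℤ Υ)), GrpH M n →+ ProfH (completion M) n)
      (j₂ : ∀ n (M : ModuleCat.{u} (MonoidAlgebra ℤ Υ)), AugExt M n →+ ProfAugExt (completion M) n),
      (∀ n, IsExtLift (trivialToHat Υ) n (j₁ n)) ∧ (∀ n, IsExtLift (augIdealToHat Υ) n (j₂ n)) ∧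
      (∀ n M z, j₁ (n + 1) M (boundary M n z) = boundaryHat (completion M) n (j₂ n M z)) ∧
      ∀ (M E : ModuleCat.{u} (MonoidAlgebra ℤ Υ)) (E' : ProfMod (RHat Υ))
        (i : M ⟶ E) (p : E ⟶ augIdeal Υ) (w : i ≫ p = 0) (i' : completion M ⟶ E')
        (p' : E' ⟶ augIdealHat (Hat Υ)) (w' : i' ≫ p' = 0)
        (hS : (ShortComplex.mk i p w).ShortExact)
        (hS' : (ShortComplex.mk i' p' w').ShortExact) (v : E ⟶ resHat.obj E'),
        toCompletion M ≫ resHat.map i' = i ≫ v → v ≫ resHat.map p' = p ≫ augIdealToHat Υ →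
        j₂ 1 M hS.extClass = hS'.extClass := by
  have hI := isGood_augIdealToHat h
  obtain ⟨a, ha, ha'⟩ := exists_extLift_zero hI.universal
  obtain ⟨b, hb, hb'⟩ := exists_extLift_one hI
  choose c hc using fun n => exists_extLift (n + 1) hI
  -- Degrees zero and one are singled out because their values on homomorphisms and on extension
  -- classes are needed; in higher degrees any lift will do.
  let j₂ : ∀ n (M : ModuleCat.{u} (MonoidAlgebra ℤ Υ)), AugExt M n →+ ProfAugExt (completion M) n
    | 0 => a
    | 1 => b
    | n + 2 => c n
  have hj₂ : ∀ n, IsExtLift (augIdealToHat Υ) n (j₂ n)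
    | 0 => ha
    | 1 => hb
    | n + 2 => hc n
  have hsucc : ∀ n, ∃ j', IsExtLift (trivialToHat Υ) (n + 1) j' ∧
      ∀ M z, j' M ((aug_shortExact Υ).extClass.comp z (add_comm 1 n)) =
        (augHat_shortExact Υ).extClass.comp (j₂ n M z) (add_comm 1 n) := by
    intro n
    refine exists_extLift_succ (aug_shortExact Υ) (augHat_shortExact Υ) (augIdealToHat_augHatι Υ)
      (regularToHat_augHatHom Υ) (hj₂ n) ?_
    rcases n with _ | n
    · intro M z hz
      obtain ⟨k, rfl⟩ := (Ext.mk₀_bijective _ _).2 z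
      change (augHat_shortExact Υ).extClass.comp (a M (Ext.mk₀ k)) _ = 0
      rw [ha']
      exact boundary_zero_of_boundary_zero (aug_shortExact Υ) (augHat_shortExact Υ)
        (augIdealToHat_augHatι Υ) hI.universal isUniversal_regularToHat M k hz
    · intro M z hz
      rw [(injective_iff_map_eq_zero _).1 (boundary_injective (aug_shortExact Υ) M n) z hz,
        map_zero, Ext.comp_zero]
  choose d hd hd' using hsucc
  obtain ⟨d₀, hd₀, -⟩ := exists_extLift_zero (isUniversal_trivialToHat (Υ := Υ))
  -- In degree `n + 1` this is the map induced by `j₂ n`, so compatibility with the boundary maps is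
  -- `hd'`.
  let j₁ : ∀ n (M : ModuleCat.{u} (MonoidAlgebra ℤ Υ)), GrpH M n →+ ProfH (completion M) n
    | 0 => d₀
    | n + 1 => d n
  have hj₁ : ∀ n, IsExtLift (trivialToHat Υ) n (j₁ n)
    | 0 => hd₀
    | n + 1 => hd n
  exact ⟨j₁, j₂, hj₁, hj₂, hd', hb'⟩

end augmentation

/-! ### Continuous sections of surjections of profinite modules. -/

namespace ProfMod

variable {R : Type u} [Ring R] [TopologicalSpace R] {B C : ProfMod R}

/-- `Z` is a closed set of representatives for the fibres of `p` up to translation by `W`. -/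
structure IsTransversal (p : B ⟶ C) (W : Submodule R B) (Z : Set B) : Prop where
  closed : IsClosed Z
  add_mem : ∀ z ∈ Z, ∀ x ∈ W, z + x ∈ Z
  surj : ∀ c, ∃ z ∈ Z, p.hom z = c
  le_ker : ∀ x ∈ W, p.hom x = 0
  sub_mem : ∀ z ∈ Z, ∀ z' ∈ Z, p.hom z = p.hom z' → z - z' ∈ W

/-- The intersection still meets every fibre by compactness: within a fibre the members of the chain
are nested nonempty closed sets. -/
lemma exists_lower_bound (p : B ⟶ C) {c : Set (Set B)}
    (hc : ∀ Z ∈ c, ∃ W, IsTransversal p W Z) (hch : IsChain (· ⊆ ·) c) (hne : c.Nonempty) :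
    ∃ W, IsTransversal p W (⋂₀ c) := by
  choose! W hW using hc
  have hdir : DirectedOn (· ⊇ ·) c := fun Z hZ Z' hZ' =>
    (hch.total hZ hZ').elim (fun h => ⟨Z, hZ, subset_rfl, h⟩) fun h => ⟨Z', hZ', h, subset_rfl⟩
  obtain ⟨Z₀, hZ₀⟩ := hne
  refine ⟨⨅ Z ∈ c, W Z, isClosed_sInter fun Z hZ => (hW Z hZ).closed, fun z hz x hx Z hZ => ?_,
    fun y => ?_, fun x hx => ?_, fun z hz z' hz' h => ?_⟩
  · simp only [Submodule.mem_iInf] at hx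
    exact (hW Z hZ).add_mem z (hz Z hZ) x (hx Z hZ)
  · have hcl : ∀ Z ∈ c, IsClosed (Z ∩ p.hom ⁻¹' {y}) := fun Z hZ =>
      (hW Z hZ).closed.inter (isClosed_singleton.preimage p.hom.continuous)
    have := IsCompact.nonempty_sInter_of_directed_nonempty_isCompact_isClosed
      (S := (fun Z => Z ∩ p.hom ⁻¹' {y}) '' c)
      (hS := ⟨⟨_, Z₀, hZ₀, rfl⟩⟩)
      (by
        rintro _ ⟨Z, hZ, rfl⟩ _ ⟨Z', hZ', rfl⟩
        obtain ⟨Z'', hZ'', h1, h2⟩ := hdir Z hZ Z' hZ'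
        exact ⟨_, ⟨Z'', hZ'', rfl⟩, Set.inter_subset_inter_left _ h1,
          Set.inter_subset_inter_left _ h2⟩)
      (by
        rintro _ ⟨Z, hZ, rfl⟩
        obtain ⟨z, hz, h⟩ := (hW Z hZ).surj y
        exact ⟨z, hz, h⟩)
      (by rintro _ ⟨Z, hZ, rfl⟩; exact (hcl Z hZ).isCompact)
      (by rintro _ ⟨Z, hZ, rfl⟩; exact hcl Z hZ)
    obtain ⟨z, hz⟩ := this
    exact ⟨z, fun Z hZ => (hz _ ⟨Z, hZ, rfl⟩).1, (hz _ ⟨Z₀, hZ₀, rfl⟩).2⟩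
  · simp only [Submodule.mem_iInf] at hx
    exact (hW Z₀ hZ₀).le_ker x (hx Z₀ hZ₀)
  · simp only [Submodule.mem_iInf]
    exact fun Z hZ => (hW Z hZ).sub_mem z (hz Z hZ) z' (hz' Z hZ) h

/-- Number the finite quotient `B / U`, and keep those points of `Z` whose class has the least
number in their `W`-coset. Two kept points of one fibre then agree modulo `U` as well. -/
lemma IsTransversal.refine {p : B ⟶ C} {W : Submodule R B} {Z : Set B} (h : IsTransversal p W Z)
    (U : Submodule R B) (hU : IsOpen (U : Set B)) :
    ∃ Z' ⊆ Z, IsTransversal p (W ⊓ U) Z' := by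
  let A := B.quot U (isClosed_of_isOpen hU)
  have hA : Finite A := finite_quot hU
  let π : B ⟶ A := quotπ U (isClosed_of_isOpen hU)
  obtain ⟨n, ⟨j⟩⟩ := Finite.exists_equiv_fin A
  refine ⟨{z ∈ Z | ∀ x ∈ W, j (π.hom z) ≤ j (π.hom z + π.hom x)}, fun z hz => hz.1,
    h.closed.inter ?_, ?_, ?_, fun x hx => h.le_ker x hx.1, ?_⟩
  · exact (isClosed_discrete {a : A | ∀ x ∈ W, j a ≤ j (a + π.hom x)}).preimage π.hom.continuous
  · rintro z ⟨hz, hz'⟩ x ⟨hx, hxU⟩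
    have : π.hom x = 0 := (quotπ_eq_zero x).2 hxU
    refine ⟨h.add_mem z hz x hx, ?_⟩
    rw [map_add, this, add_zero]
    exact hz'
  · intro c
    obtain ⟨z, hz, rfl⟩ := h.surj c
    obtain ⟨_, ⟨x, hx, rfl⟩, hmin⟩ := ((Set.toFinite ((fun x => j (π.hom (z + x))) ''
      (W : Set B)))).exists_minimal ⟨_, 0, W.zero_mem, rfl⟩
    refine ⟨z + x, ⟨h.add_mem z hz x hx, fun y hy => ?_⟩, ?_⟩
    · rw [← map_add, add_assoc]
      by_contra hlt
      exact hlt (hmin ⟨x + y, W.add_mem hx hy, rfl⟩ (not_le.1 hlt).le)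
    · rw [map_add, h.le_ker x hx, add_zero]
  · rintro z ⟨hz, hz'⟩ y ⟨hy, hy'⟩ hzy
    have h1 := h.sub_mem z hz y hy hzy
    refine ⟨h1, (quotπ_eq_zero (hV := isClosed_of_isOpen hU) _).1 ?_⟩
    change π.hom (z - y) = 0
    have e1 := hy' (z - y) h1
    have e2 := hz' (y - z) (by rw [← neg_sub]; exact W.neg_mem h1)
    rw [← map_add, add_sub_cancel] at e1 e2
    rw [map_sub, j.injective (le_antisymm e2 e1), sub_self]

/-- A surjection of profinite modules has a continuous section. -/
theorem exists_continuous_section (p : B ⟶ C) (hp : Function.Surjective p.hom) :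
    ∃ s : C → B, Continuous s ∧ ∀ c, p.hom (s c) = c := by
  -- Zorn's lemma starts from all of `B` with `W` the kernel of `p`. A minimal transversal has `W =
  -- 0`, so it meets each fibre exactly once.
  obtain ⟨Z, -, ⟨W, hZ⟩, hmin⟩ := zorn_superset_nonempty {Z : Set B | ∃ W, IsTransversal p W Z}
    (fun c hc hch hne => ⟨⋂₀ c, exists_lower_bound p hc hch hne, fun Z hZ =>
      Set.sInter_subset_of_mem hZ⟩) Set.univ
    ⟨LinearMap.ker p.hom.toLinearMap, isClosed_univ, fun _ _ _ _ => trivial,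
      fun c => ⟨(hp c).choose, trivial, (hp c).choose_spec⟩, fun _ hx => hx, fun z _ z' _ h => by
        change p.hom (z - z') = 0
        rw [map_sub, h, sub_self]⟩
  have hW : ∀ x ∈ W, x = 0 := by
    intro x hx
    refine B.eq_zero_of_forall_open fun U hU => ?_
    obtain ⟨Z', hZZ, hZ'⟩ := hZ.refine U hU
    -- By minimality refining changes nothing, so `z` and `z + x` both survive and their difference
    -- `x` lies in `U`.
    have hle : Z ⊆ Z' := hmin ⟨_, hZ'⟩ hZZ
    obtain ⟨z, hz, -⟩ := hZ.surj 0
    have := hZ'.sub_mem _ (hle (hZ.add_mem z hz x hx)) _ (hle hz) (by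
      rw [map_add, hZ.le_ker x hx, add_zero])
    rw [add_sub_cancel_left] at this
    exact this.2
  have : CompactSpace Z := isCompact_iff_compactSpace.1 hZ.closed.isCompact
  let e : Z ≃ C := Equiv.ofBijective (fun z => p.hom z.1) ⟨fun z z' h => Subtype.ext
    (sub_eq_zero.1 (hW _ (hZ.sub_mem z.1 z.2 z'.1 z'.2 h))), fun c => by
      obtain ⟨z, hz, h⟩ := hZ.surj c
      exact ⟨⟨z, hz⟩, h⟩⟩
  -- A continuous bijection from a compact space to a Hausdorff space has continuous inverse; that
  -- inverse is the section.
  have he : Continuous e := p.hom.continuous.comp continuous_subtype_val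
  exact ⟨fun c => (e.symm c).1,
    continuous_subtype_val.comp he.continuous_symm_of_equiv_compact_to_t2,
    fun c => e.apply_symm_apply c⟩

end ProfMod

/-! ### Coordinates on the profinite completion of a group. -/

section hat

variable {E : Type u} [Group E]

/-- The projection of the profinite completion to a finite quotient. -/
noncomputable def hatCoord (H : FiniteIndexNormalSubgroup E) : Hat E →* E ⧸ H.toSubgroup where
  toFun x := x.1 H
  map_one' := rfl
  map_mul' _ _ := rfl

lemma hatCoord_eta (H : FiniteIndexNormalSubgroup E) (e : E) :
    hatCoord H (eta E e) = QuotientGroup.mk e := rfl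

lemma isOpen_hatCoord (H : FiniteIndexNormalSubgroup E) (q : E ⧸ H.toSubgroup) :
    IsOpen {x | hatCoord H x = q} := by
  let Q : ProfiniteGrp.{u} := (ProfiniteGrp.ProfiniteCompletion.diagram (GrpCat.of E)).obj H
  have : DiscreteTopology Q := ⟨rfl⟩
  have hev : Continuous fun x : Hat E => (x.1 H : Q) :=
    (continuous_apply (A := fun K => (ProfiniteGrp.ProfiniteCompletion.diagram (GrpCat.of E)).obj K)
      H).comp continuous_subtype_val
  exact hev.isOpen_preimage _ (isOpen_discrete ({q} : Set Q))

lemma map_hatCoord {H H' : FiniteIndexNormalSubgroup E} (h : H ≤ H') (x : Hat E) :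
    QuotientGroup.map H.toSubgroup H'.toSubgroup (MonoidHom.id E) h (hatCoord H x) =
      hatCoord H' x := x.2 h.hom

lemma hatCoord_eq_of_le {H H' : FiniteIndexNormalSubgroup E} (h : H ≤ H') {x y : Hat E}
    (hxy : hatCoord H x = hatCoord H y) : hatCoord H' x = hatCoord H' y := by
  rw [← map_hatCoord h, ← map_hatCoord h, hxy]

lemma hat_mem_nhds {x : Hat E} {s : Set (Hat E)} (hs : s ∈ 𝓝 x) :
    ∃ H : FiniteIndexNormalSubgroup E, ∀ y, hatCoord H y = hatCoord H x → y ∈ s := by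
  have hd : ∀ H, DiscreteTopology
    ((ProfiniteGrp.ProfiniteCompletion.diagram (GrpCat.of E)).obj H) := fun _ => ⟨rfl⟩
  obtain ⟨I, hI⟩ := mem_nhds_of_inducing_pi
    (A := fun H => (ProfiniteGrp.ProfiniteCompletion.diagram (GrpCat.of E)).obj H)
    (π := fun x : Hat E => x.1) IsInducing.subtypeVal hs
  have key : ∃ H : FiniteIndexNormalSubgroup E, ∀ i ∈ I, H ≤ i := by
    clear hI
    classical
    induction I using Finset.induction_on with
    | empty => exact ⟨.ofSubgroup ⊤, by simp⟩
    | insert i I _ ih =>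
      obtain ⟨H, hH⟩ := ih
      refine ⟨H ⊓ i, fun j hj => ?_⟩
      rcases Finset.mem_insert.1 hj with rfl | hj
      · exact inf_le_right
      · exact inf_le_left.trans (hH j hj)
  obtain ⟨H, hH⟩ := key
  exact ⟨H, fun y hy => hI y fun i hi => hatCoord_eq_of_le (hH i hi) hy⟩

lemma denseRange_eta : DenseRange (eta E) := ProfiniteGrp.ProfiniteCompletion.denseRange _

lemma hat_ext {x y : Hat E} (h : ∀ H, hatCoord H x = hatCoord H y) : x = y :=
  Subtype.ext (funext h)

lemma continuous_to_hat {X : Type*} [TopologicalSpace X] {f : X → Hat E}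
    (h : ∀ H q, IsOpen {x | hatCoord H (f x) = q}) : Continuous f := by
  refine continuous_iff_continuousAt.2 fun x s hs => ?_
  obtain ⟨H, hH⟩ := hat_mem_nhds hs
  exact Filter.mem_of_superset ((h H (hatCoord H (f x))).mem_nhds rfl) fun y hy => hH _ hy

variable {Υ : Type u} [Group Υ]

lemma hatMap_eta (p : E →* Υ) (e : E) : hatMap p (eta E e) = eta Υ (p e) :=
  ConcreteCategory.congr_hom (ProfiniteGrp.ProfiniteCompletion.lift_eta
    (GrpCat.ofHom p ≫ ProfiniteGrp.ProfiniteCompletion.eta (GrpCat.of Υ))) e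

lemma continuous_hatMap (p : E →* Υ) : Continuous (hatMap p) :=
  (ProfiniteGrp.profiniteCompletion.map (GrpCat.ofHom p)).hom.continuous_toFun

lemma hatMap_surjective {p : E →* Υ} (hp : Function.Surjective p) :
    Function.Surjective (hatMap p) := by
  have hcl : IsClosed (Set.range (hatMap p)) := (isCompact_range (continuous_hatMap p)).isClosed
  intro x
  refine closure_minimal ?_ hcl (denseRange_eta x)
  rintro _ ⟨g, rfl⟩
  obtain ⟨e, rfl⟩ := hp g
  exact ⟨eta E e, hatMap_eta p e⟩

/-- The extension of a homomorphism to a profinite group. -/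
lemma exists_hatLift {G : ProfiniteGrp.{u}} (f : E →* G) :
    ∃ F : Hat E →* G, Continuous F ∧ ∀ e, F (eta E e) = f e :=
  ⟨(ProfiniteGrp.ProfiniteCompletion.lift (G := GrpCat.of E) (GrpCat.ofHom f)).hom.toMonoidHom,
    (ProfiniteGrp.ProfiniteCompletion.lift (G := GrpCat.of E) (GrpCat.ofHom
      f)).hom.continuous_toFun,
    fun e => ConcreteCategory.congr_hom (ProfiniteGrp.ProfiniteCompletion.lift_eta
      (G := GrpCat.of E) (GrpCat.ofHom f)) e⟩

end hat

/-! ### From the completion of the kernel to the completion of the extension. -/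

section inl

variable {Υ : Type u} [Group Υ] {M : ModuleCat.{u} (MonoidAlgebra ℤ Υ)} {E : Type u} [Group E]

/-- An additive map commuting with the group elements is linear. -/
lemma map_smul_of_commutes {A B : Type*} [AddCommGroup A] [AddCommGroup B]
    [Module (MonoidAlgebra ℤ Υ) A] [Module (MonoidAlgebra ℤ Υ) B] (f : A →+ B)
    (h : ∀ g x, f (MonoidAlgebra.of ℤ Υ g • x) = MonoidAlgebra.of ℤ Υ g • f x)
    (a : MonoidAlgebra ℤ Υ) (x : A) : f (a • x) = a • f x := by
  induction a using MonoidAlgebra.induction_on with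
  | of g => exact h g x
  | add a b ha hb => rw [add_smul, add_smul, map_add, ha, hb]
  | smul n a ha => rw [smul_assoc, smul_assoc, map_zsmul, ha]

lemma smul_mem_of_commutes {N : AddSubgroup M}
    (h : ∀ g, ∀ x ∈ N, MonoidAlgebra.of ℤ Υ g • x ∈ N) (a : MonoidAlgebra ℤ Υ) (x : M)
    (hx : x ∈ N) : a • x ∈ N := by
  induction a using MonoidAlgebra.induction_on with
  | of g => exact h g x hx
  | add a b ha hb => rw [add_smul]; exact N.add_mem ha hb
  | smul n a ha => rw [smul_assoc]; exact N.zsmul_mem ha n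

variable (S : GroupExtension (Multiplicative M) E Υ)

/-- The inclusion of the kernel, written additively. -/
def inlM (m : M) : E := S.inl (Multiplicative.ofAdd m)

lemma inlM_add (m m' : M) : inlM S (m + m') = inlM S m * inlM S m' :=
  map_mul S.inl (Multiplicative.ofAdd m) (Multiplicative.ofAdd m')

lemma inlM_zero : inlM S 0 = 1 := map_one S.inl

lemma inlM_neg (m : M) : inlM S (-m) = (inlM S m)⁻¹ := map_inv S.inl (Multiplicative.ofAdd m)

lemma inlM_injective : Function.Injective (inlM S) := fun _ _ h =>
  Multiplicative.ofAdd.injective (S.inl_injective h)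

lemma rightHom_inlM (m : M) : S.rightHom (inlM S m) = 1 := S.rightHom_inl _

lemma exists_inlM {e : E} (h : S.rightHom e = 1) : ∃ m, inlM S m = e := by
  have : e ∈ S.inl.range := by rw [S.range_inl_eq_ker_rightHom]; exact h
  obtain ⟨m, rfl⟩ := this
  exact ⟨m.toAdd, rfl⟩

variable {S} (hS : InducesAction S)
include hS

lemma conj_inlM (e : E) (m : M) : e * inlM S m * e⁻¹ =
    inlM S (MonoidAlgebra.of ℤ Υ (S.rightHom e) • m) := hS e m

/-- The intersection of `M` with a normal subgroup of finite index. -/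
lemma exists_finIndex (H : FiniteIndexNormalSubgroup E) :
    ∃ N : FinIndex (Υ := Υ) M, ∀ m, m ∈ N.1 ↔ inlM S m ∈ H.toSubgroup := by
  let A : AddSubgroup M :=
    { carrier := {m | inlM S m ∈ H.toSubgroup}
      add_mem' := fun {a b} ha hb => by
        change inlM S (a + b) ∈ H.toSubgroup
        rw [inlM_add]; exact H.toSubgroup.mul_mem ha hb
      zero_mem' := by
        change inlM S 0 ∈ H.toSubgroup
        rw [inlM_zero]; exact H.toSubgroup.one_mem
      neg_mem' := fun {a} ha => by
        change inlM S (-a) ∈ H.toSubgroup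
        rw [inlM_neg]; exact H.toSubgroup.inv_mem ha }
  let N : Submodule (MonoidAlgebra ℤ Υ) M :=
    { A with
      smul_mem' := fun a x hx => smul_mem_of_commutes (N := A) (fun g x hx => by
        -- The action of `g` is conjugation by a lift `e`, which preserves the normal subgroup `H`.
        obtain ⟨e, rfl⟩ := S.rightHom_surjective g
        change inlM S _ ∈ H.toSubgroup
        rw [← conj_inlM hS]
        exact H.isNormal'.conj_mem _ hx e) a x hx }
  have hfin : Finite (M ⧸ N) := by
    have := H.isFiniteIndex'
    refine Finite.of_injective (β := E ⧸ H.toSubgroup)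
      (Quotient.lift (fun m => QuotientGroup.mk (inlM S m)) fun a b hab => ?_) ?_
    · have h1 : inlM S (a - b) ∈ H.toSubgroup := (Submodule.quotientRel_def N).1 hab
      have h2 := H.toSubgroup.inv_mem h1
      rw [← inlM_neg, neg_sub, sub_eq_neg_add, inlM_add, inlM_neg] at h2
      exact QuotientGroup.eq.2 h2
    · rintro ⟨a⟩ ⟨b⟩ hab
      have h1 := QuotientGroup.eq.1 hab
      rw [← inlM_neg, ← inlM_add, neg_add_eq_sub] at h1
      have h2 : b - a ∈ N := h1
      refine (Submodule.Quotient.eq N).2 ?_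
      rw [← neg_sub]
      exact N.neg_mem h2
  exact ⟨⟨N, hfin⟩, fun m => Iff.rfl⟩

/-- The continuous extension `M̂ → Ê` of the inclusion `M → E`. -/
lemma exists_inlHat : ∃ F : Multiplicative (completion M) →* Hat E,
    Continuous (fun x : completion M => F (Multiplicative.ofAdd x)) ∧
      ∀ m : M, F (Multiplicative.ofAdd (fn (toCompletion M) m)) = eta E (inlM S m) := by
  choose N hN using fun H => exists_finIndex hS H
  have hwd : ∀ H (a b : M), a - b ∈ (N H).1 →
      (QuotientGroup.mk (inlM S a) : E ⧸ H.toSubgroup) = QuotientGroup.mk (inlM S b) := by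
    intro H a b hab
    rw [← neg_mem_iff, neg_sub, sub_eq_neg_add, hN, inlM_add, inlM_neg] at hab
    exact QuotientGroup.eq.2 hab
  -- The injections of `M / (M ∩ H)` into `E / H` are compatible in `H` and assemble to the map on
  -- inverse limits.
  let F₀ (H : FiniteIndexNormalSubgroup E) : FinQuot (N H) → E ⧸ H.toSubgroup :=
    Quotient.lift (fun m => QuotientGroup.mk (inlM S m)) fun a b hab =>
      hwd H a b ((Submodule.quotientRel_def _).1 hab)
  have hle : ∀ {H H' : FiniteIndexNormalSubgroup E}, H ≤ H' → (N H).1 ≤ (N H').1 :=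
    fun h x hx => (hN _ x).2 (h ((hN _ x).1 hx))
  let F₁ (x : completionSubmodule (Υ := Υ) M) : Hat E :=
    ⟨fun H => F₀ H (x.1 (N H)), fun H H' h => by
      change QuotientGroup.map H.toSubgroup H'.toSubgroup (MonoidHom.id E) h.le
        (F₀ H (x.1 (N H))) = F₀ H' (x.1 (N H'))
      rw [← x.2 _ _ (hle h.le)]
      obtain ⟨m, hm⟩ := Submodule.mkQ_surjective _ (x.1 (N H))
      rw [← hm]
      rfl⟩
  have hF₁ : ∀ H x, hatCoord H (F₁ x) = F₀ H (x.1 (N H)) := fun _ _ => rfl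
  have hadd : ∀ x y, F₁ (x + y) = F₁ x * F₁ y := fun x y => hat_ext fun H => by
    rw [map_mul, hF₁, hF₁, hF₁]
    obtain ⟨a, ha⟩ := Submodule.mkQ_surjective _ (x.1 (N H))
    obtain ⟨b, hb⟩ := Submodule.mkQ_surjective _ (y.1 (N H))
    have hab : (x + y).1 (N H) = FinQuot.mk (N H) (a + b) := by
      change x.1 (N H) + y.1 (N H) = _
      rw [← ha, ← hb]
      rfl
    rw [hab, ← ha, ← hb]
    exact congrArg QuotientGroup.mk (inlM_add S a b)
  refine ⟨MonoidHom.mk' (fun x => F₁ x.toAdd) fun x y => hadd x.toAdd y.toAdd, ?_, fun m => rfl⟩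
  · refine continuous_to_hat fun H q => ?_
    have hc : Continuous fun x : completionSubmodule (Υ := Υ) M => x.1 (N H) :=
      (continuous_apply _).comp continuous_subtype_val
    exact (isOpen_discrete (F₀ H ⁻¹' {q})).preimage hc

end inl

/-- Cosets of open submodules are clopen and separate points. This is needed for `Crossed` to be a
profinite group. -/
lemma ProfMod.totallyDisconnected {R : Type u} [Ring R] [TopologicalSpace R] (B : ProfMod R) :
    TotallyDisconnectedSpace B := by
  have : TotallySeparatedSpace B := totallySeparatedSpace_iff_exists_isClopen.2 fun x y hxy => by
    obtain ⟨V, hV, hxV⟩ := B.exists_open_submodule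
      (isOpen_compl_singleton.mem_nhds (x := (0 : B)) (Ne.symm (sub_ne_zero.2 hxy.symm)))
    refine ⟨(fun z => z - x) ⁻¹' (V : Set B), ⟨?_, ?_⟩, ?_, ?_⟩
    · exact (isClosed_of_isOpen hV).preimage (continuous_id.sub continuous_const)
    · exact hV.preimage (continuous_id.sub continuous_const)
    · change x - x ∈ V
      rw [sub_self]; exact V.zero_mem
    · exact fun h => hxV h rfl
  infer_instance

/-! ### The profinite group attached to an extension of the augmentation ideal. -/

section crossed

variable {Υ : Type u} [Group Υ]

lemma continuous_of : Continuous (of : Hat Υ → RHat Υ) := by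
  refine Continuous.subtype_mk (continuous_pi fun i => ?_) _
  have : DiscreteTopology (Hat Υ ⧸ i.2.toSubgroup) :=
    QuotientGroup.discreteTopology i.2.isOpen'
  exact (continuous_of_discreteTopology (β := Level i) (f := fun q : Hat Υ ⧸ i.2.toSubgroup =>
    MonoidAlgebra.of (ZMod i.1) _ q)).comp continuous_quot_mk

/-- The element `g - 1` of the augmentation ideal. -/
noncomputable def augElt (g : Hat Υ) : augIdealHat (Hat Υ) :=
  (⟨of g - 1, by rw [RingHom.mem_ker, map_sub, aug_of, map_one, sub_self]⟩ :
    RingHom.ker (aug (Hat Υ)))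

/-- The element `g - 1` of the augmentation ideal. -/
noncomputable def augEltZ (g : Υ) : augIdeal Υ :=
  (⟨MonoidAlgebra.of ℤ Υ g - 1, by rw [RingHom.mem_ker, map_sub, augZ_of, map_one, sub_self]⟩ :
    RingHom.ker (augZ Υ))

/-- The crossed homomorphism property of `g ↦ g - 1` is what makes the condition defining `Crossed`
stable under multiplication. -/
lemma augElt_mul (g h : Hat Υ) : augElt (g * h) = augElt g + of g • augElt h :=
  Subtype.ext (by
    change of (g * h) - 1 = of g - 1 + of g * (of h - 1)
    rw [map_mul, mul_sub, mul_one]; abel)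

lemma augElt_one : augElt (1 : Hat Υ) = 0 :=
  Subtype.ext (by change of 1 - 1 = (0 : RHat Υ); rw [map_one, sub_self])

lemma augIdealToHat_augEltZ (g : Υ) : fn (augIdealToHat Υ) (augEltZ g) = augElt (eta Υ g) :=
  Subtype.ext (by
    change toHat Υ (MonoidAlgebra.of ℤ Υ g - 1) = of (eta Υ g) - 1
    rw [map_sub, toHat_of, map_one])

lemma continuous_augElt : Continuous (augElt : Hat Υ → augIdealHat (Hat Υ)) :=
  Continuous.subtype_mk (continuous_of.sub continuous_const) _

variable {B : ProfMod (RHat Υ)}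

/-- For `p : B ⟶ I_Υ̂`, the subgroup of all pairs `(x, g)` with `p x = g - 1` of the semidirect
product of `B` and `Υ̂`. -/
def Crossed (p : B ⟶ augIdealHat (Hat Υ)) : Type u :=
  {y : B × Hat Υ // p.hom y.1 = augElt y.2}

variable {p : B ⟶ augIdealHat (Hat Υ)}

namespace Crossed

lemma smul_smul_of (g h : Hat Υ) (x : B) : of g • of h • x = of (g * h) • x := by
  rw [map_mul, mul_smul]

lemma one_smul_of (x : B) : of (1 : Hat Υ) • x = x := by rw [map_one, one_smul]

noncomputable instance : Group (Crossed p) where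
  mul x y := ⟨(x.1.1 + of x.1.2 • y.1.1, x.1.2 * y.1.2), by
    change p.hom (x.1.1 + of x.1.2 • y.1.1) = augElt (x.1.2 * y.1.2)
    rw [map_add, map_smul, x.2, y.2, augElt_mul]⟩
  one := ⟨(0, 1), by
    change p.hom 0 = augElt 1
    rw [map_zero, augElt_one]⟩
  inv x := ⟨(-(of x.1.2⁻¹ • x.1.1), x.1.2⁻¹), by
    change p.hom (-(of x.1.2⁻¹ • x.1.1)) = augElt x.1.2⁻¹
    rw [map_neg, map_smul, x.2, neg_eq_iff_add_eq_zero, add_comm, ← augElt_mul, inv_mul_cancel,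
      augElt_one]⟩
  mul_assoc x y z := Subtype.ext (Prod.ext (by
    change x.1.1 + of x.1.2 • y.1.1 + of (x.1.2 * y.1.2) • z.1.1 =
      x.1.1 + of x.1.2 • (y.1.1 + of y.1.2 • z.1.1)
    rw [smul_add, smul_smul_of, add_assoc]) (mul_assoc _ _ _))
  one_mul x := Subtype.ext (Prod.ext (by
    change 0 + of (1 : Hat Υ) • x.1.1 = x.1.1
    rw [one_smul_of, zero_add]) (one_mul _))
  mul_one x := Subtype.ext (Prod.ext (by
    change x.1.1 + of x.1.2 • 0 = x.1.1
    rw [smul_zero, add_zero]) (mul_one _))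
  inv_mul_cancel x := Subtype.ext (Prod.ext (neg_add_cancel _) (inv_mul_cancel _))

lemma mul_fst (x y : Crossed p) : (x * y).1.1 = x.1.1 + of x.1.2 • y.1.1 := rfl
lemma mul_snd (x y : Crossed p) : (x * y).1.2 = x.1.2 * y.1.2 := rfl

lemma ext' {x y : Crossed p} (h₁ : x.1.1 = y.1.1) (h₂ : x.1.2 = y.1.2) : x = y :=
  Subtype.ext (Prod.ext h₁ h₂)

instance : TopologicalSpace (Crossed p) := inferInstanceAs (TopologicalSpace {_y : B × Hat Υ // _})

lemma continuous_fst : Continuous fun x : Crossed p => x.1.1 :=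
  _root_.continuous_fst.comp continuous_subtype_val

lemma continuous_snd : Continuous fun x : Crossed p => x.1.2 :=
  _root_.continuous_snd.comp continuous_subtype_val

instance : IsTopologicalGroup (Crossed p) where
  continuous_mul := Continuous.subtype_mk
    (((continuous_fst.comp _root_.continuous_fst).add
      ((continuous_of.comp (continuous_snd.comp _root_.continuous_fst)).smul
        (continuous_fst.comp _root_.continuous_snd))).prodMk
      ((continuous_snd.comp _root_.continuous_fst).mul
        (continuous_snd.comp _root_.continuous_snd))) _
  continuous_inv := Continuous.subtype_mk
    (((continuous_of.comp continuous_snd.inv).smul continuous_fst).neg.prodMk continuous_snd.inv) _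

instance : CompactSpace (Crossed p) := by
  have : IsClosed {y : B × Hat Υ | p.hom y.1 = augElt y.2} :=
    isClosed_eq (p.hom.continuous.comp _root_.continuous_fst)
      (continuous_augElt.comp _root_.continuous_snd)
  exact isCompact_iff_compactSpace.1 this.isCompact

instance : TotallyDisconnectedSpace (Crossed p) :=
  haveI := B.totallyDisconnected
  inferInstanceAs (TotallyDisconnectedSpace {_y : B × Hat Υ // _})

instance : T2Space (Crossed p) := inferInstanceAs (T2Space {_y : B × Hat Υ // _})

end Crossed

end crossed

/-! ### Completing a group extension by means of a crossed homomorphism. -/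

section extension

variable {Υ : Type u} [Group Υ] {M N : ModuleCat.{u} (MonoidAlgebra ℤ Υ)} {E : Type u} [Group E]
  {S : GroupExtension (Multiplicative M) E Υ}

/-- The image of `M̂` is compact, hence closed, so it suffices to approximate `x` by elements of `M`
modulo each `H`. -/
lemma exists_inlHat_eq {F : Multiplicative (completion M) →* Hat E}
    (hFc : Continuous fun x : completion M => F (Multiplicative.ofAdd x))
    (hF : ∀ m : M, F (Multiplicative.ofAdd (fn (toCompletion M) m)) = eta E (inlM S m))
    (x : Hat E) (hx : hatMap S.rightHom x = 1) : ∃ b, F b = x := by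
  have hcl : IsClosed (Set.range fun x : completion M => F (Multiplicative.ofAdd x)) :=
    (isCompact_range hFc).isClosed
  suffices x ∈ closure (Set.range fun x : completion M => F (Multiplicative.ofAdd x)) by
    rw [hcl.closure_eq] at this
    obtain ⟨b, hb⟩ := this
    exact ⟨_, hb⟩
  refine mem_closure_iff_nhds.2 fun s hs => ?_
  obtain ⟨H, hH⟩ := hat_mem_nhds hs
  have : (H.toSubgroup.map S.rightHom).Normal :=
    H.isNormal'.map _ S.rightHom_surjective
  have : (H.toSubgroup.map S.rightHom).FiniteIndex := by
    have := H.isFiniteIndex'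
    exact ⟨ne_zero_of_dvd_ne_zero Subgroup.FiniteIndex.index_ne_zero
      (H.toSubgroup.index_map_dvd S.rightHom_surjective)⟩
  -- With `K` the image of `H`, some `e` agrees with `x` modulo `H` and maps into `K`. Correcting
  -- `e` by an element of `H` moves it into `M` without changing its class.
  let K : FiniteIndexNormalSubgroup Υ := .ofSubgroup (H.toSubgroup.map S.rightHom)
  obtain ⟨e, he₁, he₂⟩ := denseRange_eta.exists_mem_open
    ((isOpen_hatCoord H (hatCoord H x)).inter
      ((isOpen_hatCoord K 1).preimage (continuous_hatMap S.rightHom)))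
    ⟨x, rfl, by change hatCoord K (hatMap S.rightHom x) = 1; rw [hx, map_one]⟩
  have he₁ : hatCoord H (eta E e) = hatCoord H x := he₁
  have he₂ : hatCoord K (hatMap S.rightHom (eta E e)) = 1 := he₂
  rw [hatMap_eta, hatCoord_eta, QuotientGroup.eq_one_iff] at he₂
  obtain ⟨h, hh, hhe⟩ := he₂
  obtain ⟨m, hm⟩ := exists_inlM S (e := h⁻¹ * e) (by rw [map_mul, map_inv, hhe, inv_mul_cancel])
  refine ⟨_, hH _ ?_, fn (toCompletion M) m, rfl⟩
  change hatCoord H (F (Multiplicative.ofAdd (fn (toCompletion M) m))) = _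
  rw [hF, ← he₁, hatCoord_eta, hatCoord_eta, hm, QuotientGroup.eq]
  have := H.isNormal'.conj_mem h hh e⁻¹
  rw [mul_inv_rev, inv_inv]
  simpa using this

/-- The profinite completion of an extension of groups, together with the class of its factor sets,
computed from a crossed homomorphism to an extension of modules. -/
theorem exists_profinite_extension (hS : InducesAction S) {i : M ⟶ N} {p : N ⟶ augIdeal Υ}
    {N' : ProfMod (RHat Υ)} {v : N ⟶ resHat.obj N'} {i' : completion M ⟶ N'}
    {p' : N' ⟶ augIdealHat (Hat Υ)} {w' : i' ≫ p' = 0}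
    (hT : (ShortComplex.mk i' p' w').ShortExact)
    (hi : toCompletion M ≫ resHat.map i' = i ≫ v)
    (hp : v ≫ resHat.map p' = p ≫ augIdealToHat Υ) (D : E → N)
    (hD : ∀ e e', D (e * e') = D e + MonoidAlgebra.of ℤ Υ (S.rightHom e) • D e')
    (hDp : ∀ e, p.hom (D e) = augEltZ (S.rightHom e)) (hDi : ∀ m, D (inlM S m) = i.hom m) :
    ∃ T : GroupExtension (Multiplicative (completion M)) (Hat E) (Hat Υ),
      IsProfiniteExtension T ∧ T.rightHom = hatMap S.rightHom ∧
      (∀ m : M, T.inl (Multiplicative.ofAdd (fn (toCompletion M) m)) = eta E (inlM S m)) ∧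
      ProfCorrespondsTo T (boundaryHat (completion M) 1 hT.extClass) := by
  have hinj : Function.Injective i'.hom := by
    have := hT.mono_f
    exact ProfMod.injective_of_mono i'
  have hsurj : Function.Surjective p'.hom := by
    have := hT.epi_g
    exact ProfMod.surjective_of_epi p'
  have hp' : ∀ b, p'.hom (i'.hom b) = 0 := fun b =>
    (congrArg (fun k : completion M ⟶ augIdealHat (Hat Υ) => k.hom b) w' :)
  -- The pair formed by the crossed homomorphism and the projection to `Υ` is a homomorphism to a
  -- profinite group, so it extends to `Ê`.
  let ψ : E →* Crossed p' := MonoidHom.mk' (fun e => ⟨(fn v (D e), eta Υ (S.rightHom e)), by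
      change p'.hom (fn v (D e)) = _
      rw [← augIdealToHat_augEltZ, ← hDp]
      exact congrArg (fun k => fn k (D e)) hp⟩) fun e e' => Crossed.ext' (by
        change fn v (D (e * e')) = fn v (D e) + of (eta Υ (S.rightHom e)) • fn v (D e')
        rw [hD, fn_add, fn_smul, toHat_of]) (by
        change eta Υ (S.rightHom (e * e')) = _
        rw [map_mul, map_mul]; rfl)
  obtain ⟨Ψ, hΨc, hΨ⟩ := exists_hatLift (G := ProfiniteGrp.of (Crossed p')) ψ
  let Ψ : Hat E →* Crossed p' := Ψ
  have hΨc : Continuous Ψ := hΨc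
  have hΨ : ∀ e, Ψ (eta E e) = ψ e := hΨ
  have hΨ2 : ∀ x, (Ψ x).1.2 = hatMap S.rightHom x := by
    have := denseRange_eta.equalizer (Crossed.continuous_snd.comp hΨc)
      (continuous_hatMap S.rightHom) (funext fun e => by
        change (Ψ (eta E e)).1.2 = hatMap S.rightHom (eta E e)
        rw [hΨ, hatMap_eta]; rfl)
    exact fun x => congrFun this x
  obtain ⟨F, hFc, hF⟩ := exists_inlHat hS
  have hdense : DenseRange (fn (toCompletion M)) := denseRange_toCompletion M
  have hΨF1 : ∀ b, (Ψ (F (Multiplicative.ofAdd b))).1.1 = i'.hom b := by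
    have := hdense.equalizer (Crossed.continuous_fst.comp (hΨc.comp hFc)) i'.hom.continuous
      (funext fun m => by
        change (Ψ (F (Multiplicative.ofAdd (fn (toCompletion M) m)))).1.1 = _
        rw [hF, hΨ]
        change fn v (D (inlM S m)) = _
        rw [hDi]
        exact (congrArg (fun k => fn k m) hi).symm)
    exact fun x => congrFun this x
  have hF2 : ∀ b, hatMap S.rightHom (F (Multiplicative.ofAdd b)) = 1 := by
    have := hdense.equalizer ((continuous_hatMap S.rightHom).comp hFc)
      (continuous_const (y := (1 : Hat Υ)))
      (funext fun m => by
        change hatMap S.rightHom (F (Multiplicative.ofAdd (fn (toCompletion M) m))) = 1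
        rw [hF, hatMap_eta, rightHom_inlM, map_one])
    exact fun x => congrFun this x
  have hΨF2 : ∀ b, (Ψ (F (Multiplicative.ofAdd b))).1.2 = 1 := fun b => by rw [hΨ2, hF2]
  -- Injectivity of `M̂ → Ê` is inherited from that of `i'`, the first coordinate of `Ψ ∘ F`.
  have hFinj : Function.Injective F := fun a b hab => by
    have h1 := hΨF1 a.toAdd
    have h2 := hΨF1 b.toAdd
    rw [ofAdd_toAdd] at h1 h2
    rw [hab, h2] at h1
    exact Multiplicative.toAdd.injective (hinj h1.symm)
  have hker := exists_inlHat_eq hFc hF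
  let T : GroupExtension (Multiplicative (completion M)) (Hat E) (Hat Υ) :=
    { inl := F
      rightHom := hatMap S.rightHom
      inl_injective := hFinj
      range_inl_eq_ker_rightHom := by
        ext x
        constructor
        · rintro ⟨b, rfl⟩
          exact hF2 b.toAdd
        · exact fun hx => hker x hx
      rightHom_surjective := hatMap_surjective S.rightHom_surjective }
  -- An element killed by `Ψ` dies in `Υ̂`, hence comes from `M̂`, where `Ψ` restricts to the
  -- injective `i'`.
  have hΨinj : Function.Injective Ψ := by
    refine (injective_iff_map_eq_one Ψ).2 fun x hx => ?_
    obtain ⟨b, rfl⟩ := hker x (by rw [← hΨ2, hx]; rfl)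
    have h1 := hΨF1 b.toAdd
    rw [ofAdd_toAdd, hx] at h1
    have h2 : b.toAdd = 0 := hinj (h1.symm.trans (map_zero _).symm)
    rw [show b = 1 from Multiplicative.toAdd.injective h2, map_one]
  have hΨsurj : Function.Surjective Ψ := by
    intro y
    obtain ⟨x, hx⟩ := hatMap_surjective S.rightHom_surjective y.1.2
    obtain ⟨b, hb⟩ := ProfMod.ker_le_of_exact hT (y.1.1 - (Ψ x).1.1) (by
      change p'.hom (y.1.1 - (Ψ x).1.1) = 0
      rw [map_sub, y.2, (Ψ x).2, hΨ2, hx, sub_self])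
    have hb : i'.hom b = y.1.1 - (Ψ x).1.1 := hb
    refine ⟨F (Multiplicative.ofAdd b) * x, ?_⟩
    rw [map_mul]
    refine Crossed.ext' ?_ ?_
    · rw [Crossed.mul_fst, hΨF1, hΨF2, Crossed.one_smul_of, hb, sub_add_cancel]
    · rw [Crossed.mul_snd, hΨF2, hΨ2, hx, one_mul]
  refine ⟨T, ⟨hFc, continuous_hatMap _, fun e b => ?_⟩, rfl, hF, ?_⟩
  · rw [mul_inv_eq_iff_eq_mul]
    apply hΨinj
    change Ψ (e * F (Multiplicative.ofAdd b)) =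
      Ψ (F (Multiplicative.ofAdd (of (hatMap S.rightHom e) • b)) * e)
    rw [map_mul, map_mul]
    refine Crossed.ext' ?_ ?_
    · rw [Crossed.mul_fst, Crossed.mul_fst, hΨF1, hΨF1, hΨF2, Crossed.one_smul_of, hΨ2, map_smul,
        add_comm]
    · rw [Crossed.mul_snd, Crossed.mul_snd, hΨF2, hΨF2, one_mul, mul_one]
  -- A continuous lift `s` of `g ↦ g - 1` gives the continuous section `g ↦ (s g, g)` of `Crossed`,
  -- carried back to `Ê` by the homeomorphism `Ψ`. Its factor set is the cocycle computed from `s`.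
  · obtain ⟨r, hrc, hr⟩ := ProfMod.exists_continuous_section p' hsurj
    let s : Hat Υ → N' := fun g => r (augElt g)
    have hsc : Continuous s := hrc.comp continuous_augElt
    have hs : ∀ g, p'.hom (s g) = augElt g := fun g => hr _
    let e : Hat E ≃ Crossed p' := Equiv.ofBijective Ψ ⟨hΨinj, hΨsurj⟩
    have hec : Continuous e.symm :=
      Continuous.continuous_symm_of_equiv_compact_to_t2 (f := e) hΨc
    let σ : Hat Υ → Hat E := fun g => e.symm ⟨(s g, g), hs g⟩
    have hΨσ : ∀ g, Ψ (σ g) = ⟨(s g, g), hs g⟩ := fun g => e.apply_symm_apply _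
    have hex : ∀ g h, ∃ b, i'.hom b = of g • s h - s (g * h) + s g := fun g h =>
      ProfMod.ker_le_of_exact hT _ (by
        change p'.hom (of g • s h - s (g * h) + s g) = 0
        rw [map_add, map_sub, map_smul, hs, hs, hs, augElt_mul]
        abel)
    choose f hf using hex
    refine ⟨σ, f, hec.comp (Continuous.subtype_mk (hsc.prodMk continuous_id) _), fun g => ?_,
      fun g h => ?_, N', i', p', w', hT, s, hsc, hs, hf, rfl⟩
    · change hatMap S.rightHom (σ g) = g
      rw [← hΨ2, hΨσ]
    · apply hΨinj
      change Ψ (σ g * σ h) = Ψ (F (Multiplicative.ofAdd (f g h)) * σ (g * h))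
      rw [map_mul, map_mul]
      refine Crossed.ext' ?_ ?_
      · rw [Crossed.mul_fst, Crossed.mul_fst, hΨF1, hΨF2, Crossed.one_smul_of, hf, hΨσ, hΨσ, hΨσ]
        change s g + of g • s h = of g • s h - s (g * h) + s g + s (g * h)
        abel
      · rw [Crossed.mul_snd, Crossed.mul_snd, hΨF2, hΨσ, hΨσ, hΨσ, one_mul]

end extension

/-! ### Factor sets and crossed homomorphisms. -/

section factorSet

variable {Υ : Type u} [Group Υ] {M : ModuleCat.{u} (MonoidAlgebra ℤ Υ)} {E : Type u} [Group E]
  {S : GroupExtension (Multiplicative M) E Υ}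

/-- `σ` is a set-theoretic section of the extension `S` with factor set `f`. -/
structure IsFactorSet (S : GroupExtension (Multiplicative M) E Υ) (σ : Υ → E) (f : Υ → Υ → M) :
    Prop where
  rightHom : ∀ g, S.rightHom (σ g) = g
  mul : ∀ g h, σ g * σ h = inlM S (f g h) * σ (g * h)

lemma exists_isFactorSet (S : GroupExtension (Multiplicative M) E Υ) :
    ∃ σ f, IsFactorSet S σ f := by
  choose σ hσ using S.rightHom_surjective
  have : ∀ g h, ∃ m, inlM S m = σ g * σ h * (σ (g * h))⁻¹ := fun g h => exists_inlM S (by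
    rw [map_mul, map_mul, map_inv, hσ, hσ, hσ, mul_inv_cancel])
  choose f hf using this
  exact ⟨σ, f, hσ, fun g h => by rw [hf, inv_mul_cancel_right]⟩

lemma mul_inlM (hS : InducesAction S) (e : E) (m : M) :
    e * inlM S m = inlM S (MonoidAlgebra.of ℤ Υ (S.rightHom e) • m) * e := by
  rw [← conj_inlM hS, inv_mul_cancel_right]

namespace IsFactorSet

variable {σ : Υ → E} {f : Υ → Υ → M} (hf : IsFactorSet S σ f)
include hf

/-- Associativity of `σ g * σ h * σ k`. The section is not assumed to preserve `1`, which is why the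
value `f 1 1` appears in what follows. -/
lemma cocycle (hS : InducesAction S) (g h k : Υ) :
    MonoidAlgebra.of ℤ Υ g • f h k + f g (h * k) = f g h + f (g * h) k := by
  have := mul_assoc (σ g) (σ h) (σ k)
  rw [hf.mul g h, mul_assoc, hf.mul, hf.mul h k, ← mul_assoc, ← mul_assoc, mul_inlM hS (σ g),
    hf.rightHom, mul_assoc _ (σ g), hf.mul, ← mul_assoc, mul_assoc g h k, mul_left_inj,
    ← inlM_add, ← inlM_add] at this
  exact (inlM_injective S this).symm

lemma one_left (hS : InducesAction S) (k : Υ) : f 1 k = f 1 1 := by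
  have := hf.cocycle hS 1 1 k
  rw [map_one, one_smul, one_mul, one_mul] at this
  exact add_right_cancel this

lemma one_right (hS : InducesAction S) (g : Υ) : f g 1 = MonoidAlgebra.of ℤ Υ g • f 1 1 := by
  have := hf.cocycle hS g 1 1
  rw [one_mul, mul_one] at this
  exact (add_right_cancel this).symm

lemma section_one : σ 1 = inlM S (f 1 1) := by
  have := hf.mul 1 1
  rw [one_mul] at this
  exact mul_right_cancel this

/-- The crossed homomorphism extending a factor set. -/
lemma exists_crossedHom (hS : InducesAction S) {N : ModuleCat.{u} (MonoidAlgebra ℤ Υ)} {i : M ⟶ N}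
    {p : N ⟶ augIdeal Υ} (w : i ≫ p = 0) {s : Υ → N} (hs : ∀ g, p.hom (s g) = augEltZ g)
    (hfs : ∀ g h, i.hom (f g h) = MonoidAlgebra.of ℤ Υ g • s h - s (g * h) + s g) :
    ∃ D : E → N,
      (∀ e e', D (e * e') = D e + MonoidAlgebra.of ℤ Υ (S.rightHom e) • D e') ∧
      (∀ e, p.hom (D e) = augEltZ (S.rightHom e)) ∧ ∀ m, D (inlM S m) = i.hom m := by
  have : ∀ e, ∃ m, inlM S m = e * (σ (S.rightHom e))⁻¹ := fun e => exists_inlM S (by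
    rw [map_mul, map_inv, hf.rightHom, mul_inv_cancel])
  -- Every `e` is uniquely `m e` times the chosen lift of its image; the crossed homomorphism is `i
  -- (m e)` plus `s` of that image.
  choose m hm using this
  have hm' : ∀ e, inlM S (m e) * σ (S.rightHom e) = e := fun e => by
    rw [hm, inv_mul_cancel_right]
  have hmul : ∀ e e', m (e * e') = m e + MonoidAlgebra.of ℤ Υ (S.rightHom e) • m e' +
      f (S.rightHom e) (S.rightHom e') := fun e e' => inlM_injective S (by
    rw [hm, mul_inv_eq_iff_eq_mul, inlM_add, inlM_add, map_mul, mul_assoc _ (inlM S (f _ _)),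
      ← hf.mul, ← mul_assoc, mul_assoc (inlM S (m e))]
    have h1 := mul_inlM hS (σ (S.rightHom e)) (m e')
    rw [hf.rightHom] at h1
    rw [← h1, ← mul_assoc, hm', mul_assoc, hm'])
  refine ⟨fun e => i.hom (m e) + s (S.rightHom e), fun e e' => ?_, fun e => ?_, fun x => ?_⟩
  · change i.hom (m (e * e')) + s (S.rightHom (e * e')) = i.hom (m e) + s (S.rightHom e) +
      MonoidAlgebra.of ℤ Υ (S.rightHom e) • (i.hom (m e') + s (S.rightHom e'))
    rw [hmul, map_add, map_add, map_smul, hfs, map_mul, smul_add]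
    abel
  · rw [map_add, hs]
    have : p.hom (i.hom (m e)) = 0 := congrArg (fun k => k.hom (m e)) w
    rw [this, zero_add]
  -- Since `σ 1` is the image of `f 1 1`, the coordinate of `x` is shifted by `f 1 1`; the term `s 1
  -- = i (f 1 1)` compensates.
  · have hx : m (inlM S x) = x - f 1 1 := inlM_injective S (by
      rw [hm, rightHom_inlM, hf.section_one, ← inlM_neg, ← inlM_add, sub_eq_add_neg])
    have h1 := hfs 1 1
    rw [map_one, one_smul, one_mul, sub_self, zero_add] at h1
    change i.hom (m (inlM S x)) + s (S.rightHom (inlM S x)) = i.hom x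
    rw [hx, rightHom_inlM, map_sub, h1, sub_add_cancel]

end IsFactorSet

end factorSet

/-! ### Realising a factor set by an extension of the augmentation ideal. -/

section twisted

variable {Υ : Type u} [Group Υ]

/-- The abelian group `A` with the action of `Υ` given by `ρ`. -/
def Twisted {A : Type u} [AddCommGroup A] (_ρ : Υ →* AddMonoid.End A) : Type u := A

namespace Twisted

variable {A : Type u} [AddCommGroup A] (ρ : Υ →* AddMonoid.End A)

instance : AddCommGroup (Twisted ρ) := inferInstanceAs (AddCommGroup A)

noncomputable instance : Module (MonoidAlgebra ℤ Υ) (Twisted ρ) :=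
  Module.compHom A (MonoidAlgebra.lift ℤ (AddMonoid.End A) Υ ρ).toRingHom

lemma of_smul (g : Υ) (x : Twisted ρ) : MonoidAlgebra.of ℤ Υ g • x = ρ g x := by
  change (MonoidAlgebra.lift ℤ (AddMonoid.End A) Υ ρ) (MonoidAlgebra.of ℤ Υ g) x = ρ g x
  rw [MonoidAlgebra.lift_of]

end Twisted

/-- The additive extension of a function on `Υ` to the group ring. -/
noncomputable def extendAdd {A : Type*} [AddCommGroup A] (φ : Υ → A) : MonoidAlgebra ℤ Υ →+ A :=
  (Finsupp.liftAddHom fun h => zmultiplesHom A (φ h)).comp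
    (MonoidAlgebra.coeffAddEquiv (R := ℤ) (M := Υ)).toAddMonoidHom

lemma extendAdd_of {A : Type*} [AddCommGroup A] (φ : Υ → A) (h : Υ) :
    extendAdd φ (MonoidAlgebra.of ℤ Υ h) = φ h := by
  change Finsupp.liftAddHom (fun h => zmultiplesHom A (φ h)) (Finsupp.single h 1) = _
  simp

variable {M : ModuleCat.{u} (MonoidAlgebra ℤ Υ)} {E : Type u} [Group E]
  {S : GroupExtension (Multiplicative M) E Υ}

/-- Every factor set of an extension is the factor set of a class. -/
lemma IsFactorSet.exists_isCocycleClass {σ : Υ → E} {f : Υ → Υ → M} (hf : IsFactorSet S σ f)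
    (hS : InducesAction S) : ∃ z, IsCocycleClass f z := by
  -- The cocycle identity extended additively in its last variable. The term independent of that
  -- variable acquires the augmentation as coefficient, so it disappears on `I_Υ`.
  have hF : ∀ (g h : Υ) (x : MonoidAlgebra ℤ Υ),
      MonoidAlgebra.of ℤ Υ g • extendAdd (f h) x + extendAdd (f g) (MonoidAlgebra.of ℤ Υ h * x) =
        augZ Υ x • f g h + extendAdd (f (g * h)) x := fun g h x => by
    induction x using MonoidAlgebra.induction_on with
    | of k =>
      rw [← map_mul, extendAdd_of, extendAdd_of, extendAdd_of, augZ_of, one_smul, hf.cocycle hS]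
    | add x y hx hy =>
      rw [mul_add, map_add, map_add, map_add, map_add, smul_add, add_smul, add_add_add_comm, hx, hy]
      abel
    | smul n x hx =>
      rw [mul_smul_comm, map_zsmul, map_zsmul, map_zsmul, map_zsmul, smul_comm _ n, ← smul_add, hx,
        smul_add, smul_assoc]
  have hF1 : ∀ x, extendAdd (f 1) x = augZ Υ x • f 1 1 := fun x => by
    induction x using MonoidAlgebra.induction_on with
    | of k => rw [extendAdd_of, augZ_of, one_smul, hf.one_left hS]
    | add x y hx hy => rw [map_add, map_add, hx, hy, add_smul]
    | smul n x hx => rw [map_zsmul, map_zsmul, hx, smul_assoc]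
  let I := RingHom.ker (augZ Υ)
  -- The action `g (m, x) = (g m + f(g, x), g x)`, with `f(g, ·)` extended additively, is
  -- multiplicative on `M × I_Υ` because augmentations vanish there.
  let r (g : Υ) : AddMonoid.End (M × I) :=
    { toFun := fun x => (MonoidAlgebra.of ℤ Υ g • x.1 + extendAdd (f g) x.2.1,
        MonoidAlgebra.of ℤ Υ g • x.2)
      map_zero' := Prod.ext (by
        change MonoidAlgebra.of ℤ Υ g • (0 : M) + extendAdd (f g) 0 = 0
        rw [smul_zero, map_zero, add_zero]) (smul_zero _)
      map_add' := fun x y => Prod.ext (by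
        change MonoidAlgebra.of ℤ Υ g • (x.1 + y.1) + extendAdd (f g) (x.2.1 + y.2.1) =
          (MonoidAlgebra.of ℤ Υ g • x.1 + extendAdd (f g) x.2.1) +
            (MonoidAlgebra.of ℤ Υ g • y.1 + extendAdd (f g) y.2.1)
        rw [smul_add, map_add, add_add_add_comm]) (smul_add _ _ _) }
  let ρ : Υ →* AddMonoid.End (M × I) :=
    { toFun := r
      map_one' := AddMonoidHom.ext fun x => Prod.ext (by
        change MonoidAlgebra.of ℤ Υ 1 • x.1 + extendAdd (f 1) x.2.1 = x.1
        rw [hF1, RingHom.mem_ker.1 x.2.2, zero_smul, add_zero, map_one, one_smul]) (by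
        change MonoidAlgebra.of ℤ Υ 1 • x.2 = x.2
        rw [map_one, one_smul])
      map_mul' := fun g h => AddMonoidHom.ext fun x => Prod.ext (by
        change MonoidAlgebra.of ℤ Υ (g * h) • x.1 + extendAdd (f (g * h)) x.2.1 =
          MonoidAlgebra.of ℤ Υ g • (MonoidAlgebra.of ℤ Υ h • x.1 + extendAdd (f h) x.2.1) +
            extendAdd (f g) (MonoidAlgebra.of ℤ Υ h * x.2.1)
        rw [smul_add, add_assoc, hF, RingHom.mem_ker.1 x.2.2, zero_smul, zero_add, map_mul,
          mul_smul]) (by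
        change MonoidAlgebra.of ℤ Υ (g * h) • x.2 = _
        rw [map_mul, mul_smul]
        rfl) }
  let N : ModuleCat.{u} (MonoidAlgebra ℤ Υ) := ModuleCat.of _ (Twisted ρ)
  let i : M ⟶ N := ModuleCat.ofHom
    { toFun := fun m => ((m, 0) : M × I)
      map_add' := fun m m' => Prod.ext rfl (add_zero 0).symm
      map_smul' := map_smul_of_commutes (B := Twisted ρ)
        ((AddMonoidHom.inl M I : M →+ M × I) : M →+ Twisted ρ) fun g m => by
          rw [Twisted.of_smul]
          refine Prod.ext ?_ (smul_zero _).symm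
          change MonoidAlgebra.of ℤ Υ g • m = MonoidAlgebra.of ℤ Υ g • m + extendAdd (f g) 0
          rw [map_zero, add_zero] }
  let p : N ⟶ augIdeal Υ := ModuleCat.ofHom (Y := augIdeal Υ)
    { toFun := fun x : M × I => x.2
      map_add' := fun _ _ => rfl
      map_smul' := map_smul_of_commutes (A := Twisted ρ) (B := I)
        ((AddMonoidHom.snd M I : M × I →+ I) : Twisted ρ →+ I) fun g x => by
          rw [Twisted.of_smul]
          rfl }
  have w : i ≫ p = 0 := rfl
  have hSE : (ShortComplex.mk i p w).ShortExact :=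
    { mono_f := (ModuleCat.mono_iff_injective _).2 fun _ _ h => congrArg Prod.fst h
      epi_g := (ModuleCat.epi_iff_surjective _).2 fun x => ⟨((0, x) : M × I), rfl⟩
      exact := (ShortComplex.moduleCat_exact_iff _).2 fun b hb =>
        ⟨(b : M × I).1, Prod.ext rfl (Eq.symm hb)⟩ }
  -- The first entry `f 1 1` corrects for the lack of normalisation: `g • f 1 1` equals `f g 1` and
  -- cancels the contribution of `-1` in `h - 1`.
  refine ⟨_, N, i, p, w, hSE, fun g => ((f 1 1, augEltZ g) : M × I), fun g => rfl, fun g h => ?_,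
    rfl⟩
  refine Eq.trans ?_ (congrArg (fun y : M × I => y - ((f 1 1, augEltZ (g * h)) : M × I) +
    ((f 1 1, augEltZ g) : M × I)) (Twisted.of_smul ρ g ((f 1 1, augEltZ h) : M × I)).symm)
  refine Prod.ext ?_ (Subtype.ext ?_)
  · change f g h = MonoidAlgebra.of ℤ Υ g • f 1 1 +
      extendAdd (f g) (MonoidAlgebra.of ℤ Υ h - 1) - f 1 1 + f 1 1
    rw [sub_add_cancel, map_sub, ← hf.one_right hS, ← map_one (MonoidAlgebra.of ℤ Υ), extendAdd_of,
      extendAdd_of, add_sub_cancel]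
  · change 0 = MonoidAlgebra.of ℤ Υ g * (MonoidAlgebra.of ℤ Υ h - 1) -
      (MonoidAlgebra.of ℤ Υ (g * h) - 1) + (MonoidAlgebra.of ℤ Υ g - 1)
    rw [map_mul, mul_sub, mul_one]
    abel

lemma exists_correspondsTo (hS : InducesAction S) : ∃ z, CorrespondsTo S z := by
  obtain ⟨σ, f, hf⟩ := exists_isFactorSet S
  obtain ⟨z, hz⟩ := hf.exists_isCocycleClass hS
  exact ⟨z, σ, f, hf.rightHom, hf.mul, hz⟩

end twisted

/-! ### The completed group extension and its class. -/

section completion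

variable {Υ : Type u} [Group Υ] {M : ModuleCat.{u} (MonoidAlgebra ℤ Υ)} {E : Type u} [Group E]
  {S : GroupExtension (Multiplicative M) E Υ}

/-- The profinite completion of an extension of groups is unique. -/
lemma profinite_extension_unique
    {T T' : GroupExtension (Multiplicative (completion M)) (Hat E) (Hat Υ)}
    (hT : IsProfiniteExtension T) (hT' : IsProfiniteExtension T') (hr : T.rightHom = T'.rightHom)
    (h : ∀ m : M, T.inl (Multiplicative.ofAdd (fn (toCompletion M) m)) =
      T'.inl (Multiplicative.ofAdd (fn (toCompletion M) m))) : T = T' := by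
  have hinl : T.inl = T'.inl := MonoidHom.ext fun b =>
    congrFun ((denseRange_toCompletion M).equalizer hT.1 hT'.1 (funext h)) b.toAdd
  cases T
  cases T'
  cases hinl
  cases hr
  rfl

/-- The profinite completion of an extension of groups, and its class. -/
theorem exists_profinite_completion (hI : IsGood (augIdealToHat Υ)) (hS : InducesAction S)
    {j₁ : GrpH M 2 → ProfH (completion M) 2} {j₂ : AugExt M 1 → ProfAugExt (completion M) 1}
    (hj : ∀ z, j₁ (boundary M 1 z) = boundaryHat (completion M) 1 (j₂ z))
    (hj₂ : ∀ (N : ModuleCat.{u} (MonoidAlgebra ℤ Υ)) (N' : ProfMod (RHat Υ))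
        (i : M ⟶ N) (p : N ⟶ augIdeal Υ) (w : i ≫ p = 0) (i' : completion M ⟶ N')
        (p' : N' ⟶ augIdealHat (Hat Υ)) (w' : i' ≫ p' = 0)
        (hS : (ShortComplex.mk i p w).ShortExact)
        (hS' : (ShortComplex.mk i' p' w').ShortExact) (v : N ⟶ resHat.obj N'),
        toCompletion M ≫ resHat.map i' = i ≫ v → v ≫ resHat.map p' = p ≫ augIdealToHat Υ →
        j₂ hS.extClass = hS'.extClass) :
    ∃ T : GroupExtension (Multiplicative (completion M)) (Hat E) (Hat Υ),
      IsProfiniteExtension T ∧ T.rightHom = hatMap S.rightHom ∧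
      (∀ m : M, T.inl (Multiplicative.ofAdd (fn (toCompletion M) m)) = eta E (inlM S m)) ∧
      ∀ z : GrpH M 2, CorrespondsTo S z → ProfCorrespondsTo T (j₁ z) := by
  -- For a given `z`, complete the module extension representing it; it stays exact because `I_Υ →
  -- I_Υ̂` is good.
  have key : ∀ z, CorrespondsTo S z →
      ∃ T : GroupExtension (Multiplicative (completion M)) (Hat E) (Hat Υ),
        IsProfiniteExtension T ∧ T.rightHom = hatMap S.rightHom ∧
        (∀ m : M, T.inl (Multiplicative.ofAdd (fn (toCompletion M) m)) = eta E (inlM S m)) ∧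
        ProfCorrespondsTo T (j₁ z) := by
    rintro z ⟨σ, f, hσ, hσf, N, i, p, w, hN, s, hs, hfs, rfl⟩
    obtain ⟨D, hD, hDp, hDi⟩ :=
      IsFactorSet.exists_crossedHom (S := S) ⟨hσ, hσf⟩ hS w hs hfs
    have hN' := isUniversal_toCompletion N
    have hp : toCompletion N ≫ resHat.map (hN'.desc (p ≫ augIdealToHat Υ)) =
        p ≫ augIdealToHat Υ := hN'.fac _
    obtain ⟨w', hT⟩ := shortExact_of_isGood hN (completionMap_toCompletion i) hp
      (isUniversal_toCompletion M) hN' hI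
    rw [hj, hj₂ _ _ _ _ _ _ _ _ hN hT _ (completionMap_toCompletion i) hp]
    exact exists_profinite_extension hS hT (completionMap_toCompletion i) hp D hD hDp hDi
  -- `T` has to be produced independently of `z`. Some class always corresponds to `S`, and by
  -- density of `M` in `M̂` the extensions obtained from different classes coincide.
  obtain ⟨z, hz⟩ := exists_correspondsTo hS
  obtain ⟨T, hT, hTr, hTi, -⟩ := key z hz
  refine ⟨T, hT, hTr, hTi, fun z hz => ?_⟩
  obtain ⟨T', hT', hTr', hTi', h⟩ := key z hz
  rwa [profinite_extension_unique hT hT' (hTr.trans hTr'.symm)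
    fun m => (hTi m).trans (hTi' m).symm]

end completion
end ProfCoh

/-! ### Assembly of the results. -/

theorem proposition2p5 (Υ : Type u) [Group Υ] (hFP : IsFPInfty Υ)
    (hsep : HasSeparableCohomology Υ) :
    ∃ (ι₁ : ∀ (M : ModuleCat.{u} (MonoidAlgebra ℤ Υ)) [Module.Finite (MonoidAlgebra ℤ Υ) M]
          (n : ℕ), GrpH M n →+ ProfH (completion M) n)
      (ι₂ : ∀ (M : ModuleCat.{u} (MonoidAlgebra ℤ Υ)) [Module.Finite (MonoidAlgebra ℤ Υ) M]
          (n : ℕ), AugExt M n →+ ProfAugExt (completion M) n)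
      (e : completion (augIdeal Υ) ≅ augIdealHat (Hat Υ)),
      -- `e` is the canonical identification of the completion of `I_Υ` with `I_Υ̂`
      toCompletion (augIdeal Υ) ≫ resHat.map e.hom = augIdealToHat Υ ∧
      -- the maps lift the maps induced by `M → M̂` along restriction from `Υ̂` to `Υ`
      (∀ (M : ModuleCat.{u} (MonoidAlgebra ℤ Υ)) [Module.Finite (MonoidAlgebra ℤ Υ) M] (n : ℕ)
        (z : GrpH M n),
        resH (completion M) n (ι₁ M n z) = z.comp (Ext.mk₀ (toCompletion M)) (add_zero n)) ∧
      (∀ (M : ModuleCat.{u} (MonoidAlgebra ℤ Υ)) [Module.Finite (MonoidAlgebra ℤ Υ) M] (n : ℕ)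
        (z : AugExt M n),
        resAugExt (completion M) n (ι₂ M n z) = z.comp (Ext.mk₀ (toCompletion M)) (add_zero n)) ∧
      -- naturality in `M`
      (∀ (M M' : ModuleCat.{u} (MonoidAlgebra ℤ Υ)) [Module.Finite (MonoidAlgebra ℤ Υ) M]
        [Module.Finite (MonoidAlgebra ℤ Υ) M'] (φ : M ⟶ M') (n : ℕ),
        (∀ z : GrpH M n, ι₁ M' n (z.comp (Ext.mk₀ φ) (add_zero n)) =
          (ι₁ M n z).comp (Ext.mk₀ (completionMap φ)) (add_zero n)) ∧
        (∀ z : AugExt M n, ι₂ M' n (z.comp (Ext.mk₀ φ) (add_zero n)) =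
          (ι₂ M n z).comp (Ext.mk₀ (completionMap φ)) (add_zero n))) ∧
      -- (a) classes of extensions of groups
      (∀ (M : ModuleCat.{u} (MonoidAlgebra ℤ Υ)) [Module.Finite (MonoidAlgebra ℤ Υ) M]
        (E : Type u) [Group E] (S : GroupExtension (Multiplicative M) E Υ), InducesAction S →
        ∃ T : GroupExtension (Multiplicative (completion M)) (Hat E) (Hat Υ),
          IsProfiniteExtension T ∧ T.rightHom = hatMap S.rightHom ∧
          (∀ m : M, T.inl (Multiplicative.ofAdd ((toCompletion M).hom m)) =
            eta E (S.inl (Multiplicative.ofAdd m))) ∧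
          ∀ z : GrpH M 2, CorrespondsTo S z → ProfCorrespondsTo T (ι₁ M 2 z)) ∧
      -- (b) classes of extensions of modules
      (∀ (M : ModuleCat.{u} (MonoidAlgebra ℤ Υ)) [Module.Finite (MonoidAlgebra ℤ Υ) M]
        (E : ModuleCat.{u} (MonoidAlgebra ℤ Υ)) (i : M ⟶ E) (p : E ⟶ augIdeal Υ) (w : i ≫ p = 0)
        (hS : (ShortComplex.mk i p w).ShortExact),
        ∃ (w' : completionMap i ≫ completionMap p ≫ e.hom = 0)
          (hT : (ShortComplex.mk (completionMap i) (completionMap p ≫ e.hom) w').ShortExact),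
          ι₂ M 1 hS.extClass = hT.extClass) ∧
      -- compatibility with the boundary maps, which are isomorphisms in positive degrees
      (∀ (M : ModuleCat.{u} (MonoidAlgebra ℤ Υ)) [Module.Finite (MonoidAlgebra ℤ Υ) M] (n : ℕ),
        (∀ z : AugExt M n,
          boundaryHat (completion M) n (ι₂ M n z) = ι₁ M (n + 1) (boundary M n z)) ∧
        (1 ≤ n → Function.Bijective (boundary M n) ∧
          Function.Bijective (boundaryHat (completion M) n))) := by
  obtain ⟨j₁, j₂, h₁, h₂, hδ, hext⟩ := exists_lifts hsep
  have hI := isUniversal_toCompletion (augIdeal Υ)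
  have := isIso_desc_augIdealToHat hsep
  have he : toCompletion (augIdeal Υ) ≫ resHat.map (hI.desc (augIdealToHat Υ)) =
      augIdealToHat Υ := hI.fac _
  refine ⟨fun M _ n => j₁ n M, fun M _ n => j₂ n M, asIso (hI.desc (augIdealToHat Υ)), he,
    fun M _ n => (h₁ n).res M, fun M _ n => (h₂ n).res M,
    fun M M' _ _ φ n => ⟨(h₁ n).naturality M M' φ, (h₂ n).naturality M M' φ⟩,
    fun M _ E _ S hS => exists_profinite_completion (isGood_augIdealToHat hsep) hS (hδ 1 M) (hext M),
    fun M _ E i p w hS => ?_, fun M _ n => ⟨fun z => (hδ n M z).symm, fun hn => ?_⟩⟩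
  -- The right-hand map is followed by the identification of the completed augmentation ideal, so
  -- the sequence lies over the good map `I_Υ → I_Υ̂`.
  · have hp : toCompletion E ≫ resHat.map (completionMap p ≫ hI.desc (augIdealToHat Υ)) =
        p ≫ augIdealToHat Υ := by
      rw [Functor.map_comp, ← Category.assoc, completionMap_toCompletion, Category.assoc, he]
    obtain ⟨w', hT⟩ := shortExact_of_isGood hS (completionMap_toCompletion i) hp
      (isUniversal_toCompletion M) (isUniversal_toCompletion E) (isGood_augIdealToHat hsep)
    exact ⟨w', hT, hext _ _ _ _ _ _ _ _ _ hS hT _ (completionMap_toCompletion i) hp⟩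
  -- Surjectivity holds in every degree; injectivity requires Ext of the projective middle term to
  -- vanish, hence a positive degree.
  · obtain ⟨n, rfl⟩ := Nat.exists_eq_add_of_le' hn
    exact ⟨⟨boundary_injective (aug_shortExact Υ) M n, boundary_surjective (aug_shortExact Υ) M _⟩,
      boundary_injective (augHat_shortExact Υ) (completion M) n,
      boundary_surjective (augHat_shortExact Υ) (completion M) _⟩
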